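/- For every $d$ let $\rho=\rho_d$ be a probability density on $\mathbb R^d$ with $\int |x|^2\rho_d(x)\,dx\le C d$ for a constant $C$. For $h>0$, $\lambda>0$, $x\in\mathbb R^d$ put $$\tilde f_{d,x,h}(\lambda)=\frac1d\log \mathbb E_{y\sim\rho_d}\,e^{-d\lambda u},\qquad u=\frac{|x-y|^2}{d h^2},\qquad \overline f_{d,h}(\lambda)=\mathbb E_{x\sim\rho_d}\tilde f_{d,x,h}(\lambda).$$ Assume that $\rho$ is pure: for all $h,\lambda,\varepsilon>0$, $\mathbb P_{x\sim\rho_d}\big(|\tilde f_{d,x,h}(\lambda)-\overline f_{d,h}(\lambda)|\ge\varepsilon\big)\to0$ as $d\to\infty$; and that $\overline f$ is well behaved: for all $h>0$ the limit $\lim_{d\to\infty}\overline f_{d,h}(\lambda)$ exists for $\lambda>0$ and is differentiable in $\lambda>0$. Let $\gamma\ge1$ and let $K(x)=\exp\!\big(d\,[c-\frac1{2\gamma}(|x|^2/d)^\gamma]\big)$ be the $\gamma$-kernel, $c=c_{\gamma,d}$ being such that $\int K=1$. For a database $\mathcal D=(y_1,\dots,y_n)$ of independent points with density $\rho_d$,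 let $\hat\rho_h(x)=\frac1{nh^d}\sum_{i=1}^nK\big(\frac{x-y_i}h\big)$. For $h,m>0$ let $$\overline g(h^2,m)=\lim_{d\to\infty}\Big(\frac1d\,\mathbb E_x\log\mathbb E_yK\Big(\frac{x-y}h\Big)^m-m\log h\Big),\qquad \phi_{\alpha,h}(m)=\frac{1-m}m\alpha+\frac1m\overline g(h^2,m),\qquad D(\alpha,h)=\frac{\partial\phi_{\alpha,h}}{\partial m}(1),$$ and assume that $m\mapsto\overline g(h^2,m)$ is strictly convex on $(0,\infty)$ for every $h>0$. Then $\log\mathbb E_yK((x-y)/h)^m$ is integrable in $x\sim\rho_d$, the limit $\overline g(h^2,m)$ exists for all $h,m>0$, and $\phi_{\alpha,h}$ is differentiable on $(0,\infty)$. For every $\alpha>0$ the equation $D(\alpha,h)=0$ has at most one solution $h>0$; call it $h_G(\alpha)$, and put $h_G(\alpha)=0$ if there is none. If $\sup\rho_d\le C_1^d$ for all $d$, with a constant $C_1$, then $h_G(\alpha)>0$. Let $n=n_d$ satisfy $\frac1d\log n_d\to\alpha$ (for example $n_d=\lfloor e^{\alpha d}\rfloor$), and let $x\sim\rho_d$ be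 independent of $\mathcal D$. As $d\to\infty$: 1. For every $h>0$, $\frac1d\log\mathbb E_{\mathcal D}\hat\rho_h(x)\to\phi_{\alpha,h}(1)$ in probability (the annealed value). 2. For every $h>h_G(\alpha)$, $\frac1d\log\hat\rho_h(x)\to f:=\phi_{\alpha,h}(1)$ in probability. 3. For every $0<h<h_G(\alpha)$ there is exactly one $m^*\in(0,1)$ with $\frac{d\phi_{\alpha,h}}{dm}(m^*)=0$, one has $\phi_{\alpha,h}(m^*)<\phi_{\alpha,h}(1)$, and $\frac1d\log\hat\rho_h(x)\to f:=\phi_{\alpha,h}(m^*)$ in probability. If moreover $\int|x|^{2p}\rho_d(x)\,dx\le C_2d^p$ for all $d$, for some $p>\gamma$ and some constant $C_2$, then in both cases 2 and 3 $\frac1d\log\hat\rho_h(x)$ is integrable and its mean over $x$ and $\mathcal D$ converges to $f$ as well. -/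

import Mathlib

open MeasureTheory Filter Topology Set

noncomputable section

namespace KDE

/-- Data space in dimension `d`. -/
abbrev E (d : ℕ) : Type := EuclideanSpace ℝ (Fin d)

/-- A family of probability densities, one on each `ℝ^d`. -/
structure IsDensityFamily (ρ : (d : ℕ) → E d → ℝ) : Prop where
  measurable : ∀ d, Measurable (ρ d)
  nonneg : ∀ d x, 0 ≤ ρ d x
  total : ∀ d, ∫⁻ x, ENNReal.ofReal (ρ d x) = 1

/-- The law with density `ρ d`. -/
def law (ρ : (d : ℕ) → E d → ℝ) (d : ℕ) : Measure (E d) :=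
  volume.withDensity (fun x => ENNReal.ofReal (ρ d x))

/-- `𝔼 |x|² = O(d)`. -/
def SecondMomentBound (ρ : (d : ℕ) → E d → ℝ) : Prop :=
  ∃ C : ℝ, ∀ d : ℕ, ∫⁻ x, ENNReal.ofReal (‖x‖ ^ 2) ∂(law ρ d) ≤ ENNReal.ofReal (C * d)

/-! ### The kernel and the estimator -/

/-- The normalization constant of the `γ`-kernel in dimension `d`: the exact one,
for which `∫ K = 1`. -/
def cNorm (γ : ℝ) (d : ℕ) : ℝ :=
  -((1 / (d : ℝ)) *
    Real.log (∫ x : E d, Real.exp (-((d : ℝ) * (1 / (2 * γ) * (‖x‖ ^ 2 / d) ^ γ)))))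

/-- The `γ`-kernel `K(x) = exp (d [c - (1 / 2γ) (|x|² / d)^γ])`. -/
def gammaKernel (γ : ℝ) (d : ℕ) (x : E d) : ℝ :=
  Real.exp ((d : ℝ) * (cNorm γ d - 1 / (2 * γ) * (‖x‖ ^ 2 / d) ^ γ))

/-- The kernel density estimator at `x` with bandwidth `h` and data points `y i`. -/
def estimator (γ : ℝ) (d : ℕ) (h : ℝ) {n : ℕ} (x : E d) (y : Fin n → E d) : ℝ :=
  1 / ((n : ℝ) * h ^ d) * ∑ i, gammaKernel γ d (h⁻¹ • (x - y i))

/-- The law of a database of `n` independent points. -/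
def databaseLaw (ρ : (d : ℕ) → E d → ℝ) (d n : ℕ) : Measure (Fin n → E d) :=
  Measure.pi (fun _ => law ρ d)

/-- The joint law of the point `x` and of the database, independent of each other. -/
def jointLaw (ρ : (d : ℕ) → E d → ℝ) (d n : ℕ) : Measure (E d × (Fin n → E d)) :=
  (law ρ d).prod (databaseLaw ρ d n)

/-! ### Pure densities -/

/-- The scaled cumulant generating function of `u = |x - y|² / (d h²)`, with `x` fixed and
`y` random. -/
def cgf (ρ : (d : ℕ) → E d → ℝ) (d : ℕ) (h l : ℝ) (x : E d) : ℝ :=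
  1 / (d : ℝ) *
    Real.log (∫ y, Real.exp (-((d : ℝ) * l * (‖x - y‖ ^ 2 / (d * h ^ 2)))) ∂(law ρ d))

/-- The mean over `x` of the scaled cumulant generating function. -/
def cgfMean (ρ : (d : ℕ) → E d → ℝ) (d : ℕ) (h l : ℝ) : ℝ :=
  ∫ x, cgf ρ d h l x ∂(law ρ d)

/-- Pure densities: the scaled cumulant generating function concentrates around its mean.
Only positive arguments are used, for which the expectation in `cgf` is always finite. -/
def IsPure (ρ : (d : ℕ) → E d → ℝ) : Prop :=
  ∀ h > 0, ∀ l > 0, ∀ ε > 0,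
    Tendsto (fun d : ℕ => law ρ d {x | ε ≤ |cgf ρ d h l x - cgfMean ρ d h l|}) atTop (𝓝 0)

/-- The mean scaled cumulant generating function has a limit, which is differentiable. -/
def WellBehavedCgf (ρ : (d : ℕ) → E d → ℝ) : Prop :=
  ∀ h > 0, ∃ F : ℝ → ℝ,
    (∀ l > 0, Tendsto (fun d : ℕ => cgfMean ρ d h l) atTop (𝓝 (F l))) ∧
      DifferentiableOn ℝ F (Ioi 0)

/-! ### Replica free entropy -/

/-- `g(x, h², m) = (1/d) log 𝔼_y K((x - y)/h)^m - m log h`. -/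
def g (ρ : (d : ℕ) → E d → ℝ) (γ : ℝ) (d : ℕ) (h m : ℝ) (x : E d) : ℝ :=
  1 / (d : ℝ) * Real.log (∫ y, gammaKernel γ d (h⁻¹ • (x - y)) ^ m ∂(law ρ d))
    - m * Real.log h

/-- The mean of `g` over `x`. -/
def gMean (ρ : (d : ℕ) → E d → ℝ) (γ : ℝ) (d : ℕ) (h m : ℝ) : ℝ :=
  ∫ x, g ρ γ d h m x ∂(law ρ d)

/-- The large-dimension limit of `gMean`. -/
def gbar (ρ : (d : ℕ) → E d → ℝ) (γ h m : ℝ) : ℝ :=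
  limUnder atTop (fun d : ℕ => gMean ρ γ d h m)

/-- The replica free entropy `φ_{α,h}(m)`. -/
def phi (ρ : (d : ℕ) → E d → ℝ) (γ α h m : ℝ) : ℝ :=
  (1 - m) / m * α + 1 / m * gbar ρ γ h m

/-- `D(α,h)`, the derivative of the replica free entropy at `m = 1`. -/
def D (ρ : (d : ℕ) → E d → ℝ) (γ α h : ℝ) : ℝ :=
  deriv (fun m => phi ρ γ α h m) 1

/-- `hG` is the critical bandwidth at `α`: the one and only positive zero of `D(α, ·)`, with
the value `0` if there is no positive zero. -/
def IsGlassBandwidth (ρ : (d : ℕ) → E d → ℝ) (γ α hG : ℝ) : Prop :=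
  0 ≤ hG ∧ ∀ h > 0, (D ρ γ α h = 0 ↔ h = hG)

/-! ### Modes of convergence -/

/-- `(1/d) log ρ̂_h(x)`, as a function of `x` and the database. -/
def logEstimator (γ : ℝ) (d : ℕ) (h : ℝ) {n : ℕ} (ω : E d × (Fin n → E d)) : ℝ :=
  1 / (d : ℝ) * Real.log (estimator γ d h ω.1 ω.2)

/-- `(1/d) log ρ̂_h(x)`, with `n d` data points in dimension `d`, tends to `f` in probability. -/
def ConcentratesAt (ρ : (d : ℕ) → E d → ℝ) (γ : ℝ) (n : ℕ → ℕ) (h f : ℝ) : Prop :=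
  ∀ ε > 0, Tendsto
    (fun d : ℕ => jointLaw ρ d (n d) {ω | ε ≤ |logEstimator γ d h ω - f|}) atTop (𝓝 0)

/-- `(1/d) log ρ̂_h(x)` is integrable and its mean tends to `f`. -/
def MeanTendsto (ρ : (d : ℕ) → E d → ℝ) (γ : ℝ) (n : ℕ → ℕ) (h f : ℝ) : Prop :=
  (∀ d, Integrable (fun ω => logEstimator γ d h ω) (jointLaw ρ d (n d))) ∧
    Tendsto (fun d : ℕ => ∫ ω, logEstimator γ d h ω ∂(jointLaw ρ d (n d))) atTop (𝓝 f)

/-- `(1/d) log 𝔼_𝒟 ρ̂_h(x)` tends to `f` in probability. -/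
def AnnealedConcentratesAt (ρ : (d : ℕ) → E d → ℝ) (γ : ℝ) (n : ℕ → ℕ) (h f : ℝ) : Prop :=
  ∀ ε > 0, Tendsto
    (fun d : ℕ => law ρ d {x | ε ≤ |1 / (d : ℝ) *
      Real.log (∫ y, estimator γ d h x y ∂(databaseLaw ρ d (n d))) - f|}) atTop (𝓝 0)

/-- A moment of order larger than `2γ` is bounded on the natural scale `|x|² ∼ d`. -/
def HigherMomentBound (ρ : (d : ℕ) → E d → ℝ) (γ : ℝ) : Prop :=
  ∃ p > γ, ∃ C : ℝ, ∀ d : ℕ,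
    ∫⁻ x, ENNReal.ofReal (‖x‖ ^ (2 * p)) ∂(law ρ d) ≤ ENNReal.ofReal (C * (d : ℝ) ^ p)

end KDE

end

noncomputable section

namespace KDE

/-! Everything reduces to one function of one variable. Put t = h^(-2γ) and let G(t) be the limit of
(1/d) log 𝔼_y exp(-d t w), where w is the kernel exponent at unit bandwidth (`energy`). If c is the
limit of the normalization constants, then the limit of the means of g is m (c - log h) + G(m t),
and φ'(m) = (J(m t) - α) / m² with J(s) = s G'(s) - G(s) (`legendre`). Strict convexity in m is
strict convexity of G, which makes J strictly increasing. So D(α,h) = J(t) - α has at most one zero,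
and with J(t_G) = α the stationary point for h < h_G is m* = t_G / t.

Existence and differentiability of G (`ScgfTendsto.rpow`). The hypotheses give a limit in
probability F for the generating functions of v = |x - y|²/d. Passing to v^γ/(2γ) needs no full
large deviation principle: the Gärtner–Ellis lower bound (`whp_measure_window`) gives a bound from
below, the tangent line of u^γ one from above, and they agree at the slope found by
`exists_stationary`. Freezing that slope while t varies squeezes G between two functions with the
same derivative.

Concentration, as in the random energy model. From above, (∑ K)^m ≤ ∑ K^m for m ≤ 1 and Markov's
inequality give the bound φ(m) for every m in (0,1]. From below, a data point has exponent near
-G'(s) with probability at least e^(-d J(s)) to exponential order. If J(s) < α, there are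
exponentially many such data points, and they contribute c - log h - J(s) + t G'(s). For h > h_G the
choice s = t gives φ(1); for h < h_G, letting s increase to t_G gives φ(m*).

Means and positivity of h_G. A random point seldom lies in a cube of far too small probability
(`exists_measure_near_ge`). This dominates the logarithmic moments, so their means converge, and it
gives G(t) ≥ -εt - C for every ε > 0. If J stayed below α, that bound would force G ≥ -α, whereas
densities of size at most C^d force G(t) ≤ A - log t / (2γ). -/

/-! ### Events of probability tending to one -/

/-- `P d` holds with probability tending to one as `d → ∞`. -/
def Whp {Ω : ℕ → Type*} [∀ d, MeasurableSpace (Ω d)] (μ : ∀ d, Measure (Ω d))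
    (P : ∀ d, Ω d → Prop) : Prop :=
  Tendsto (fun d => μ d {x | ¬ P d x}) atTop (𝓝 0)

section Whp

variable {Ω : ℕ → Type*} [∀ d, MeasurableSpace (Ω d)] {μ : ∀ d, Measure (Ω d)}
  {P Q : ∀ d, Ω d → Prop}

theorem Whp.mono (h : Whp μ P) (hPQ : ∀ᶠ d in atTop, ∀ x, P d x → Q d x) : Whp μ Q := by
  refine tendsto_of_tendsto_of_tendsto_of_le_of_le' tendsto_const_nhds h
    (Eventually.of_forall fun _ => bot_le) ?_
  filter_upwards [hPQ] with d hd
  exact measure_mono fun x hx hP => hx (hd x hP)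

theorem Whp.and (hP : Whp μ P) (hQ : Whp μ Q) : Whp μ (fun d x => P d x ∧ Q d x) := by
  have h := hP.add hQ
  rw [add_zero] at h
  refine tendsto_of_tendsto_of_tendsto_of_le_of_le tendsto_const_nhds h
    (fun _ => bot_le) fun d => ?_
  refine le_trans (measure_mono ?_) (measure_union_le _ _)
  intro x hx
  by_cases h1 : P d x
  · exact Or.inr fun h2 => hx ⟨h1, h2⟩
  · exact Or.inl h1

/-- The failure sets cannot cover the space, because one of them is eventually smaller than 1/2.
Deterministic limits can therefore be bounded using information about half of the points only. -/
theorem Whp.exists_of_measure_le [∀ d, IsProbabilityMeasure (μ d)] (hP : Whp μ P)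
    (hQ : ∀ᶠ d in atTop, μ d {x | ¬ Q d x} ≤ 1 / 2) :
    ∀ᶠ d in atTop, ∃ x, P d x ∧ Q d x := by
  have h := (hP.eventually (gt_mem_nhds (show (0 : ENNReal) < 1 / 2 by simp)))
  filter_upwards [h, hQ] with d hd hq
  by_contra! hno
  have h1 : (univ : Set (Ω d)) ⊆ {x | ¬ P d x} ∪ {x | ¬ Q d x} := by
    intro x _
    by_cases hx : P d x
    · exact Or.inr (hno x hx)
    · exact Or.inl hx
  have h2 : (1 : ENNReal) < 1 :=
    calc (1 : ENNReal) = μ d univ := measure_univ.symm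
      _ ≤ μ d {x | ¬ P d x} + μ d {x | ¬ Q d x} := (measure_mono h1).trans (measure_union_le _ _)
      _ < 1 / 2 + 1 / 2 :=
        ENNReal.add_lt_add_of_lt_of_le (ne_top_of_le_ne_top (by simp) hq) hd hq
      _ = 1 := ENNReal.add_halves 1
  exact lt_irrefl _ h2

theorem Whp.exists [∀ d, IsProbabilityMeasure (μ d)] (hP : Whp μ P) :
    ∀ᶠ d in atTop, ∃ x, P d x := by
  filter_upwards [hP.exists_of_measure_le (Q := fun _ _ => True) (by simp)] with d ⟨x, hx, _⟩
  exact ⟨x, hx⟩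

/-- Uniqueness of limits in probability, in the form of an inequality. -/
theorem le_of_whp [∀ d, IsProbabilityMeasure (μ d)] {X : ∀ d, Ω d → ℝ} {a b : ℝ}
    (ha : ∀ ε > 0, Whp μ (fun d x => a - ε ≤ X d x))
    (hb : ∀ ε > 0, Whp μ (fun d x => X d x ≤ b + ε)) : a ≤ b := by
  refine le_of_forall_pos_le_add fun ε hε => ?_
  obtain ⟨d, x, h1, h2⟩ := ((ha (ε / 2) (by linarith)).and (hb (ε / 2) (by linarith))).exists.exists
  linarith

end Whp

/-! ### Scaled cumulant generating functions -/

/-- The scaled cumulant generating function `(1/d) log ∫ exp (-d t w) dμ`. -/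
def scgf {Y : Type*} [MeasurableSpace Y] (μ : Measure Y) (w : Y → ℝ) (d : ℕ) (t : ℝ) : ℝ :=
  1 / (d : ℝ) * Real.log (∫ y, Real.exp (-((d : ℝ) * t * w y)) ∂μ)

section Scgf

variable {Y : Type*} [MeasurableSpace Y] {μ : Measure Y} [IsProbabilityMeasure μ] {w : Y → ℝ}
  {d : ℕ} {t : ℝ}

theorem integrable_exp_neg (hw : Measurable w) (h0 : ∀ y, 0 ≤ w y) (ht : 0 ≤ t) :
    Integrable (fun y => Real.exp (-((d : ℝ) * t * w y))) μ := by
  refine (integrable_const (1 : ℝ)).mono' (by fun_prop) (ae_of_all _ fun y => ?_)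
  rw [Real.norm_eq_abs, Real.abs_exp, Real.exp_le_one_iff]
  have := h0 y
  have : 0 ≤ (d : ℝ) * t * w y := by positivity
  linarith

theorem integral_exp_neg_pos (hw : Measurable w) (h0 : ∀ y, 0 ≤ w y) (ht : 0 ≤ t) :
    0 < ∫ y, Real.exp (-((d : ℝ) * t * w y)) ∂μ :=
  integral_exp_pos (integrable_exp_neg hw h0 ht)

theorem exp_scgf (hw : Measurable w) (h0 : ∀ y, 0 ≤ w y) (ht : 0 ≤ t) (hd : d ≠ 0) :
    Real.exp (d * scgf μ w d t) = ∫ y, Real.exp (-((d : ℝ) * t * w y)) ∂μ := by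
  have hd' : (d : ℝ) ≠ 0 := by exact_mod_cast hd
  rw [scgf, ← mul_assoc, mul_one_div_cancel hd', one_mul,
    Real.exp_log (integral_exp_neg_pos hw h0 ht)]

theorem integral_exp_neg_le_one (hw : Measurable w) (h0 : ∀ y, 0 ≤ w y) (ht : 0 ≤ t) :
    ∫ y, Real.exp (-((d : ℝ) * t * w y)) ∂μ ≤ 1 := by
  calc ∫ y, Real.exp (-((d : ℝ) * t * w y)) ∂μ ≤ ∫ _, (1 : ℝ) ∂μ := by
        refine integral_mono (integrable_exp_neg hw h0 ht) (integrable_const _) fun y => ?_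
        have := h0 y
        have : 0 ≤ (d : ℝ) * t * w y := by positivity
        exact Real.exp_le_one_iff.2 (by linarith)
    _ = 1 := by simp

theorem scgf_nonpos (hw : Measurable w) (h0 : ∀ y, 0 ≤ w y) (ht : 0 ≤ t) :
    scgf μ w d t ≤ 0 :=
  mul_nonpos_of_nonneg_of_nonpos (by positivity)
    (Real.log_nonpos (integral_exp_neg_pos hw h0 ht).le (integral_exp_neg_le_one hw h0 ht))

theorem scgf_le_of_le (hw : Measurable w) (h0 : ∀ y, 0 ≤ w y) (ht : 0 ≤ t) {b : ℝ} (hd : d ≠ 0)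
    (h : ∫ y, Real.exp (-((d : ℝ) * t * w y)) ∂μ ≤ Real.exp (d * b)) : scgf μ w d t ≤ b := by
  rw [← exp_scgf hw h0 ht hd, Real.exp_le_exp] at h
  have hd' : (0 : ℝ) < d := by positivity
  exact le_of_mul_le_mul_left h hd'

theorem le_scgf_of_le (hw : Measurable w) (h0 : ∀ y, 0 ≤ w y) (ht : 0 ≤ t) {b : ℝ} (hd : d ≠ 0)
    (h : Real.exp (d * b) ≤ ∫ y, Real.exp (-((d : ℝ) * t * w y)) ∂μ) : b ≤ scgf μ w d t := by
  rw [← exp_scgf hw h0 ht hd, Real.exp_le_exp] at h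
  have hd' : (0 : ℝ) < d := by positivity
  exact le_of_mul_le_mul_left h hd'

theorem scgf_anti (hw : Measurable w) (h0 : ∀ y, 0 ≤ w y) {s : ℝ} (hs : 0 ≤ s) (hst : s ≤ t)
    (hd : d ≠ 0) : scgf μ w d t ≤ scgf μ w d s := by
  refine scgf_le_of_le hw h0 (hs.trans hst) hd ?_
  rw [exp_scgf hw h0 hs hd]
  refine integral_mono (integrable_exp_neg hw h0 (hs.trans hst)) (integrable_exp_neg hw h0 hs)
    fun y => Real.exp_le_exp.2 ?_
  have := h0 y
  gcongr

/-- Hölder's inequality, obtained from the weighted AM–GM inequality after dividing each exponential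
by its own integral. -/
theorem scgf_convex (hw : Measurable w) (h0 : ∀ y, 0 ≤ w y) {s a b : ℝ} (hs : 0 ≤ s) (ht : 0 ≤ t)
    (ha : 0 ≤ a) (hb : 0 ≤ b) (hab : a + b = 1) (hd : d ≠ 0) :
    scgf μ w d (a * s + b * t) ≤ a * scgf μ w d s + b * scgf μ w d t := by
  have hst : 0 ≤ a * s + b * t := by positivity
  refine scgf_le_of_le hw h0 hst hd ?_
  set A := scgf μ w d s
  set B := scgf μ w d t
  have hA := exp_scgf (μ := μ) hw h0 hs hd
  have hB := exp_scgf (μ := μ) hw h0 ht hd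
  have iA := integrable_exp_neg (μ := μ) (d := d) hw h0 hs
  have iB := integrable_exp_neg (μ := μ) (d := d) hw h0 ht
  have key : ∀ y, Real.exp (-((d : ℝ) * (a * s + b * t) * w y)) ≤
      Real.exp (d * (a * A + b * B)) * (a * (Real.exp (-(d * A)) * Real.exp (-((d : ℝ) * s * w y)))
        + b * (Real.exp (-(d * B)) * Real.exp (-((d : ℝ) * t * w y)))) := by
    intro y
    have h := Real.geom_mean_le_arith_mean2_weighted ha hb
      (Real.exp_pos (-(d * A) + -((d : ℝ) * s * w y))).le
      (Real.exp_pos (-(d * B) + -((d : ℝ) * t * w y))).le hab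
    rw [← Real.exp_mul, ← Real.exp_mul, ← Real.exp_add] at h
    rw [← Real.exp_add, ← Real.exp_add]
    refine le_trans (le_of_eq ?_) (mul_le_mul_of_nonneg_left h (Real.exp_pos _).le)
    rw [← Real.exp_add]
    congr 1
    ring
  calc ∫ y, Real.exp (-((d : ℝ) * (a * s + b * t) * w y)) ∂μ
      ≤ ∫ y, Real.exp (d * (a * A + b * B)) *
          (a * (Real.exp (-(d * A)) * Real.exp (-((d : ℝ) * s * w y)))
        + b * (Real.exp (-(d * B)) * Real.exp (-((d : ℝ) * t * w y)))) ∂μ := by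
        refine integral_mono (integrable_exp_neg hw h0 hst) ?_ key
        exact (((iA.const_mul _).const_mul _).add ((iB.const_mul _).const_mul _)).const_mul _
    _ = Real.exp (d * (a * A + b * B)) := by
        rw [integral_const_mul, integral_add ((iA.const_mul _).const_mul _)
          ((iB.const_mul _).const_mul _), integral_const_mul, integral_const_mul,
          integral_const_mul, integral_const_mul, ← hA, ← hB, ← Real.exp_add, ← Real.exp_add]
        simp [A, B, hab]

/-- Restricting the exponential moment to an event on which `w ≤ b`. -/
theorem le_integral_exp_neg_of_le (hw : Measurable w) (h0 : ∀ y, 0 ≤ w y) (ht : 0 ≤ t) {b : ℝ}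
    {s : Set Y} (hs : MeasurableSet s) (hsb : ∀ y ∈ s, w y ≤ b) :
    Real.exp (-(d * t * b)) * μ.real s ≤ ∫ y, Real.exp (-((d : ℝ) * t * w y)) ∂μ := by
  have hi := integrable_exp_neg (μ := μ) (d := d) hw h0 ht
  calc Real.exp (-(d * t * b)) * μ.real s = ∫ _ in s, Real.exp (-(d * t * b)) ∂μ := by
        rw [setIntegral_const, smul_eq_mul, mul_comm]
    _ ≤ ∫ y in s, Real.exp (-((d : ℝ) * t * w y)) ∂μ := by
        refine setIntegral_mono_on (integrable_const _) hi.integrableOn hs fun y hy => ?_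
        have := hsb y hy
        refine Real.exp_le_exp.2 (neg_le_neg ?_)
        gcongr
    _ ≤ _ := setIntegral_le_integral hi (ae_of_all _ fun y => (Real.exp_pos _).le)

/-- The lower bound in the Gärtner–Ellis theorem, at fixed dimension: if the scaled cumulant
generating function at `t` and at `t ± τ` is close to values that rule out deviations of size `δ`
under the tilted law, then the event `|w - a| < δ` is not too rare. -/
theorem exp_le_measure_window (hw : Measurable w) (h0 : ∀ y, 0 ≤ w y) {t τ a δ η L : ℝ}
    (hτ : 0 < τ) (htτ : τ ≤ t) (hd : d ≠ 0) (hη : η ≤ τ * δ / 8)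
    (hdl : 4 ≤ Real.exp (d * (τ * δ / 2)))
    (h1 : L - η ≤ scgf μ w d t) (h2 : scgf μ w d (t - τ) ≤ L + τ * a + τ * δ / 4 + η)
    (h3 : scgf μ w d (t + τ) ≤ L - τ * a + τ * δ / 4 + η) :
    Real.exp (d * (L + t * (a - δ) - η)) ≤ 2 * μ.real {y | |w y - a| < δ} := by
  have ht : 0 < t := by linarith
  have hdpos : (0 : ℝ) < d := by positivity
  have i0 := integrable_exp_neg (μ := μ) (d := d) hw h0 ht.le
  have i1 := integrable_exp_neg (μ := μ) (d := d) (t := t - τ) hw h0 (by linarith)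
  have i2 := integrable_exp_neg (μ := μ) (d := d) (t := t + τ) hw h0 (by linarith)
  have e0 := exp_scgf (μ := μ) hw h0 ht.le hd
  have e1 := exp_scgf (μ := μ) (t := t - τ) hw h0 (by linarith) hd
  have e2 := exp_scgf (μ := μ) (t := t + τ) hw h0 (by linarith) hd
  set W := {y | |w y - a| < δ} with hW
  have hWm : MeasurableSet W := measurableSet_lt (by fun_prop) measurable_const
  -- Outside the window a one-sided Chernoff factor is at least 1: exp(dτ(w - a - δ)) on the right,
  -- exp(dτ(a - δ - w)) on the left. These shift the tilt t to t - τ and t + τ.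
  have key : ∀ y, Real.exp (-((d : ℝ) * t * w y)) ≤
      W.indicator (fun _ => Real.exp (-(d * t * (a - δ)))) y
      + (Real.exp (-(d * τ * (a + δ))) * Real.exp (-((d : ℝ) * (t - τ) * w y))
      + Real.exp (d * τ * (a - δ)) * Real.exp (-((d : ℝ) * (t + τ) * w y))) := by
    intro y
    by_cases hy : y ∈ W
    · rw [indicator_of_mem hy]
      have : a - δ ≤ w y := by have := (abs_lt.1 (show |w y - a| < δ from hy)).1; linarith
      have h : Real.exp (-((d : ℝ) * t * w y)) ≤ Real.exp (-(d * t * (a - δ))) := by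
        refine Real.exp_le_exp.2 (neg_le_neg ?_)
        gcongr
      have := Real.exp_pos (-(d * τ * (a + δ)))
      have := Real.exp_pos (-((d : ℝ) * (t - τ) * w y))
      have := Real.exp_pos (d * τ * (a - δ))
      have := Real.exp_pos (-((d : ℝ) * (t + τ) * w y))
      refine h.trans (le_add_of_nonneg_right (by positivity))
    · rw [indicator_of_notMem hy, zero_add, ← Real.exp_add, ← Real.exp_add]
      rcases le_abs.1 (not_lt.1 (show ¬ |w y - a| < δ from hy)) with h | h
      · refine le_trans (Real.exp_le_exp.2 ?_) (le_add_of_nonneg_right (Real.exp_pos _).le)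
        have : 0 ≤ d * τ * (w y - a - δ) := mul_nonneg (by positivity) (by linarith)
        linarith
      · refine le_trans (Real.exp_le_exp.2 ?_) (le_add_of_nonneg_left (Real.exp_pos _).le)
        have : 0 ≤ d * τ * (a - δ - w y) := mul_nonneg (by positivity) (by linarith)
        linarith
  have i3 : Integrable (fun y => Real.exp (-(d * τ * (a + δ))) *
      Real.exp (-((d : ℝ) * (t - τ) * w y))
      + Real.exp (d * τ * (a - δ)) * Real.exp (-((d : ℝ) * (t + τ) * w y))) μ :=
    (i1.const_mul _).add (i2.const_mul _)
  have hint := integral_mono i0 (((integrable_const _).indicator hWm).add i3) key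
  simp only [Pi.add_apply] at hint
  rw [integral_add ((integrable_const _).indicator hWm) i3,
    integral_add (i1.const_mul _) (i2.const_mul _), integral_const_mul, integral_const_mul,
    ← e0, ← e1, ← e2, integral_indicator_const _ hWm, smul_eq_mul, ← Real.exp_add,
    ← Real.exp_add] at hint
  have b0 : Real.exp (d * (L - η)) ≤ Real.exp (d * scgf μ w d t) := by gcongr
  -- Since 2η ≤ τδ/4, each tail is smaller than exp(d(L - η)) by the factor exp(-dτδ/2) ≤ 1/4; half
  -- of the mass remains for the window.
  have b1 : Real.exp (-(d * τ * (a + δ)) + d * scgf μ w d (t - τ)) ≤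
      Real.exp (d * (L - η)) * Real.exp (-(d * (τ * δ / 2))) := by
    rw [← Real.exp_add, Real.exp_le_exp]
    have : (d : ℝ) * scgf μ w d (t - τ) ≤ d * (L + τ * a + τ * δ / 4 + η) := by gcongr
    have : (d : ℝ) * η ≤ d * (τ * δ / 8) := by gcongr
    linarith
  have b2 : Real.exp (d * τ * (a - δ) + d * scgf μ w d (t + τ)) ≤
      Real.exp (d * (L - η)) * Real.exp (-(d * (τ * δ / 2))) := by
    rw [← Real.exp_add, Real.exp_le_exp]
    have : (d : ℝ) * scgf μ w d (t + τ) ≤ d * (L - τ * a + τ * δ / 4 + η) := by gcongr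
    have : (d : ℝ) * η ≤ d * (τ * δ / 8) := by gcongr
    linarith
  have b3 : Real.exp (-(d * (τ * δ / 2))) ≤ 1 / 4 := by
    rw [Real.exp_neg, one_div]
    exact inv_anti₀ (by norm_num) hdl
  have b4 : Real.exp (d * (L - η)) * Real.exp (-(d * (τ * δ / 2))) ≤
      Real.exp (d * (L - η)) * (1 / 4) := by gcongr
  have fin : Real.exp (d * (L - η)) ≤ 2 * (μ.real W * Real.exp (-(d * t * (a - δ)))) := by linarith
  calc Real.exp (d * (L + t * (a - δ) - η))
      = Real.exp (d * (L - η)) * Real.exp (d * t * (a - δ)) := by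
        rw [← Real.exp_add]; congr 1; ring
    _ ≤ 2 * (μ.real W * Real.exp (-(d * t * (a - δ)))) * Real.exp (d * t * (a - δ)) := by gcongr
    _ = 2 * μ.real W := by
        rw [mul_assoc, mul_assoc, ← Real.exp_add]; simp

end Scgf

/-- The lower bound of the Gärtner–Ellis theorem for a random scaled cumulant generating function
that tends to a deterministic limit in probability. -/
theorem whp_measure_window {X : ℕ → Type*} [∀ d, MeasurableSpace (X d)] {P : ∀ d, Measure (X d)}
    {Y : ℕ → Type*} [∀ d, MeasurableSpace (Y d)] {μ : ∀ d, Measure (Y d)}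
    [∀ d, IsProbabilityMeasure (μ d)] {w : ∀ d, X d → Y d → ℝ} (hw : ∀ d x, Measurable (w d x))
    (h0 : ∀ d x y, 0 ≤ w d x y) {Λ : ℝ → ℝ}
    (hΛ : ∀ t > 0, ∀ ε > 0, Whp P (fun d x => |scgf (μ d) (w d x) d t - Λ t| < ε))
    {t a : ℝ} (ht : 0 < t) (ha : HasDerivAt Λ (-a) t) {δ ε : ℝ} (hδ : 0 < δ) (hε : 0 < ε) :
    Whp P (fun d x => Real.exp (d * (Λ t + t * a - ε)) ≤
      (μ d).real {y | |w d x y - a| < δ}) := by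
  -- The budget ε is spent as ε/4 for replacing a by a - δ', ε/4 for η, and ε/2 for the factor 2 in
  -- front of the measure.
  obtain ⟨δ', hδ', hδδ, hδε⟩ : ∃ δ' > 0, δ' ≤ δ ∧ t * δ' ≤ ε / 4 := by
    refine ⟨min δ (ε / (4 * t)), by positivity, min_le_left _ _, ?_⟩
    calc t * min δ (ε / (4 * t)) ≤ t * (ε / (4 * t)) := by gcongr; exact min_le_right _ _
      _ = ε / 4 := by field_simp
  -- Differentiability of Λ is used here only: at t ± τ it deviates from its tangent by at most
  -- τδ'/4, the slack allowed by `exp_le_measure_window`.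
  have hlo := (hasDerivAt_iff_isLittleO_nhds_zero.1 ha).def (show (0 : ℝ) < δ' / 4 by linarith)
  obtain ⟨r, hr, hball⟩ := Metric.eventually_nhds_iff.1 hlo
  obtain ⟨τ, hτ, hτr, hτt⟩ : ∃ τ > 0, τ < r ∧ τ < t := by
    refine ⟨min r t / 2, by positivity, ?_, ?_⟩
    · linarith [min_le_left r t, lt_min hr ht]
    · linarith [min_le_right r t, lt_min hr ht]
  have hp := hball (show dist τ 0 < r by simpa [abs_of_pos hτ] using hτr)
  have hm := hball (show dist (-τ) 0 < r by simpa [abs_of_pos hτ] using hτr)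
  simp only [Real.norm_eq_abs, smul_eq_mul, abs_neg, abs_of_pos hτ] at hp hm
  have hp' := (abs_le.1 hp).2
  have hm' := (abs_le.1 hm).2
  obtain ⟨η, hη, hη1, hη2⟩ : ∃ η > 0, η ≤ τ * δ' / 8 ∧ η ≤ ε / 4 :=
    ⟨min (τ * δ' / 8) (ε / 4), by positivity, min_le_left _ _, min_le_right _ _⟩
  have hlarge : ∀ c > 0, ∀ b : ℝ, ∀ᶠ d : ℕ in atTop, b ≤ Real.exp (d * c) := by
    intro c hc b
    exact (Real.tendsto_exp_atTop.comp
      (tendsto_natCast_atTop_atTop.atTop_mul_const hc)).eventually_ge_atTop b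
  refine (((hΛ t ht η hη).and (hΛ (t - τ) (by linarith) η hη)).and
    (hΛ (t + τ) (by linarith) η hη)).mono ?_
  filter_upwards [eventually_ge_atTop 1, hlarge (τ * δ' / 2) (by positivity) 4,
    hlarge (ε / 2) (by linarith) 2] with d hd1 hd4 hd2 x ⟨⟨k0, k1⟩, k2⟩
  have hd0 : d ≠ 0 := by omega
  have := exp_le_measure_window (μ := μ d) (hw d x) (h0 d x) (a := a) (δ := δ') (η := η) (L := Λ t)
    hτ hτt.le hd0 hη1 hd4 (by linarith [(abs_lt.1 k0).1])
    (by rw [← sub_eq_add_neg] at hm'; linarith [(abs_lt.1 k1).2])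
    (by linarith [(abs_lt.1 k2).2])
  have hsub : (μ d).real {y | |w d x y - a| < δ'} ≤ (μ d).real {y | |w d x y - a| < δ} :=
    measureReal_mono fun y hy => lt_of_lt_of_le hy hδδ
  have hA : 2 * Real.exp (d * (Λ t + t * a - ε)) ≤ Real.exp (d * (Λ t + t * (a - δ') - η)) := by
    calc 2 * Real.exp (d * (Λ t + t * a - ε))
        ≤ Real.exp (d * (ε / 2)) * Real.exp (d * (Λ t + t * a - ε)) := by gcongr
      _ = Real.exp (d * (ε / 2 + (Λ t + t * a - ε))) := by rw [← Real.exp_add]; congr 1; ring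
      _ ≤ _ := by
        gcongr
        linarith
  linarith

/-! ### Convex functions on the half-line -/

section Convex

variable {f : ℝ → ℝ}

theorem hasDerivAt_deriv_of_pos (hd : DifferentiableOn ℝ f (Ioi 0)) {x : ℝ} (hx : 0 < x) :
    HasDerivAt f (deriv f x) x :=
  ((hd x hx).differentiableAt (Ioi_mem_nhds hx)).hasDerivAt

theorem monotoneOn_deriv_of_convexOn (hf : ConvexOn ℝ (Ioi 0) f)
    (hd : DifferentiableOn ℝ f (Ioi 0)) : MonotoneOn (deriv f) (Ioi 0) :=
  hf.monotoneOn_deriv fun _ hx => (hasDerivAt_deriv_of_pos hd hx).differentiableAt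

theorem sub_eq_deriv_mul_of_lt (hd : DifferentiableOn ℝ f (Ioi 0)) {x y : ℝ} (hx : 0 < x)
    (hxy : x < y) : ∃ z ∈ Ioo x y, f y - f x = deriv f z * (y - x) := by
  obtain ⟨z, hz, h⟩ := exists_deriv_eq_slope f hxy
    (hd.continuousOn.mono fun z hz => lt_of_lt_of_le hx hz.1)
    (hd.mono fun z hz => hx.trans hz.1)
  refine ⟨z, hz, ?_⟩
  rw [h, div_mul_cancel₀]
  linarith

theorem le_add_deriv_of_lt (hf : ConvexOn ℝ (Ioi 0) f) (hd : DifferentiableOn ℝ f (Ioi 0))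
    {x y : ℝ} (hx : 0 < x) (hxy : x < y) :
    deriv f x * (y - x) ≤ f y - f x ∧ f y - f x ≤ deriv f y * (y - x) := by
  obtain ⟨z, hz, h⟩ := sub_eq_deriv_mul_of_lt hd hx hxy
  have hm := monotoneOn_deriv_of_convexOn hf hd
  have hy : 0 < y := hx.trans hxy
  have hz0 : 0 < z := hx.trans hz.1
  have hyx : 0 ≤ y - x := by linarith
  rw [h]
  exact ⟨mul_le_mul_of_nonneg_right (hm hx hz0 hz.1.le) hyx,
    mul_le_mul_of_nonneg_right (hm hz0 hy hz.2.le) hyx⟩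

/-- By convexity, difference quotients with a fixed increment bound the derivative from below
(negative increment) or above (positive increment). They are continuous in the base point, so the
derivative is both lower and upper semicontinuous. -/
theorem continuousOn_deriv_of_convexOn (hf : ConvexOn ℝ (Ioi 0) f)
    (hd : DifferentiableOn ℝ f (Ioi 0)) : ContinuousOn (deriv f) (Ioi 0) := by
  intro x hx
  have hx0 : 0 < x := hx
  refine ContinuousAt.continuousWithinAt ?_
  have hder := hasDerivAt_deriv_of_pos hd hx0
  have hs := hasDerivAt_iff_tendsto_slope_zero.1 hder
  have hcont : ∀ y > 0, ContinuousAt f y := fun y hy =>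
    (hasDerivAt_deriv_of_pos hd hy).continuousAt
  refine tendsto_order.2 ⟨fun b hb => ?_, fun b hb => ?_⟩
  · have h1 := (hs.eventually (lt_mem_nhds hb)).filter_mono
      (nhdsWithin_mono 0 (show Iio (0 : ℝ) ⊆ {0}ᶜ from fun y hy => ne_of_lt hy))
    obtain ⟨h, hh, hh0, hhx⟩ := (h1.and ((eventually_mem_nhdsWithin).and
      (eventually_nhdsWithin_of_eventually_nhds
        (lt_mem_nhds (show -x < 0 by linarith))))).exists
    have hh0' : h < 0 := hh0
    have hc : ContinuousAt (fun y => h⁻¹ • (f (y + h) - f y)) x := by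
      have hc' : ContinuousAt (fun y => f (y + h)) x :=
        ContinuousAt.comp (f := fun y => y + h) (hcont (x + h) (by linarith)) (by fun_prop)
      exact (hc'.sub (hcont x hx0)).const_smul h⁻¹
    filter_upwards [hc.eventually (lt_mem_nhds hh), lt_mem_nhds (show -h < x by linarith)]
      with y hy hyh
    have := (le_add_deriv_of_lt hf hd (x := y + h) (y := y) (by linarith) (by linarith)).2
    refine lt_of_lt_of_le hy ?_
    rw [smul_eq_mul, inv_mul_eq_div, div_le_iff_of_neg hh0']
    linarith
  · have h1 := (hs.eventually (gt_mem_nhds hb)).filter_mono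
      (nhdsWithin_mono 0 (show Ioi (0 : ℝ) ⊆ {0}ᶜ from fun y hy => ne_of_gt hy))
    obtain ⟨h, hh, hh0⟩ := (h1.and eventually_mem_nhdsWithin).exists
    have hh0' : 0 < h := hh0
    have hc : ContinuousAt (fun y => h⁻¹ • (f (y + h) - f y)) x := by
      have hc' : ContinuousAt (fun y => f (y + h)) x :=
        ContinuousAt.comp (f := fun y => y + h) (hcont (x + h) (by linarith)) (by fun_prop)
      exact (hc'.sub (hcont x hx0)).const_smul h⁻¹
    filter_upwards [hc.eventually (gt_mem_nhds hh), lt_mem_nhds hx0] with y hy hy0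
    have := (le_add_deriv_of_lt hf hd (x := y) (y := y + h) hy0 (by linarith)).1
    refine lt_of_le_of_lt ?_ hy
    rw [smul_eq_mul, inv_mul_eq_div, le_div_iff₀ hh0']
    linarith

theorem deriv_nonpos_of_antitoneOn (hf : AntitoneOn f (Ioi 0)) {x : ℝ} (hx : 0 < x) : deriv f x ≤ 0 := by
  have h := hf.derivWithin_nonpos (x := x)
  rwa [derivWithin_of_mem_nhds (Ioi_mem_nhds hx)] at h

end Convex

/-- The tangent line of `u ↦ u ^ γ` lies below its graph. -/
theorem rpow_tangent_le {γ s u : ℝ} (hγ : 1 ≤ γ) (hs : 0 ≤ s) (hu : 0 ≤ u) :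
    s ^ γ + γ * s ^ (γ - 1) * (u - s) ≤ u ^ γ := by
  rcases hs.eq_or_lt with rfl | hs
  · rcases hγ.eq_or_lt with rfl | hγ
    · simp
    · rw [Real.zero_rpow (by linarith), Real.zero_rpow (by linarith)]
      simpa using Real.rpow_nonneg hu γ
  · have h := one_add_mul_self_le_rpow_one_add (s := u / s - 1) (by
      have : 0 ≤ u / s := by positivity
      linarith) hγ
    rw [add_sub_cancel, Real.div_rpow hu hs.le, le_div_iff₀ (by positivity)] at h
    refine le_trans (le_of_eq ?_) h
    rw [Real.rpow_sub_one hs.ne']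
    field_simp

/-- For a nonconstant decreasing convex `F`, the stationarity equation of the Legendre-type problem
`sup_s (-(t / 2γ) s ^ γ + inf_l (F l + l s))` has a solution. -/
theorem exists_stationary {F : ℝ → ℝ} (hF : ConvexOn ℝ (Ioi 0) F)
    (hd : DifferentiableOn ℝ F (Ioi 0)) (ha : AntitoneOn F (Ioi 0)) {γ t : ℝ} (hγ : 1 ≤ γ)
    (ht : 0 < t) :
    (∀ l > 0, deriv F l = 0) ∨ ∃ l > 0, l = t / 2 * (-deriv F l) ^ (γ - 1) := by
  by_contra! hno
  obtain ⟨⟨l₀, hl₀, hne⟩, hno⟩ := hno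
  -- For γ = 1 the exponent is 0, and `x ^ 0 = 1` even at `x = 0`, so l = t/2 is a solution.
  rcases hγ.eq_or_lt with rfl | hγ
  · exact hno (t / 2) (by positivity) (by simp)
  have hneg : 0 < -deriv F l₀ := by
    have := deriv_nonpos_of_antitoneOn ha hl₀
    rcases this.lt_or_eq with h | h
    · linarith
    · exact absurd h hne
  set q := t / 2 * (-deriv F l₀) ^ (γ - 1) with hq
  have hqpos : 0 < q := by positivity
  have hm := monotoneOn_deriv_of_convexOn hF hd
  set ψ : ℝ → ℝ := fun l => l - t / 2 * (-deriv F l) ^ (γ - 1) with hψ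
  have hcont : ContinuousOn ψ (Ioi 0) := by
    refine continuousOn_id.sub (continuousOn_const.mul ?_)
    exact (continuousOn_deriv_of_convexOn hF hd).neg.rpow_const fun _ _ => Or.inr (by linarith)
  -- As `-deriv F` decreases, the right-hand side is at least q to the left of l₀ and at most q to
  -- its right. So ψ changes sign between `min l₀ (q / 2)` and `max l₀ q`.
  have hl1 : 0 < min l₀ (q / 2) := by positivity
  have hsub : Icc (min l₀ (q / 2)) (max l₀ q) ⊆ Ioi 0 := fun x hx => lt_of_lt_of_le hl1 hx.1
  have h1 : ψ (min l₀ (q / 2)) ≤ 0 := by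
    have h2 : -deriv F l₀ ≤ -deriv F (min l₀ (q / 2)) :=
      neg_le_neg (hm hl1 hl₀ (min_le_left _ _))
    have h3 : q ≤ t / 2 * (-deriv F (min l₀ (q / 2))) ^ (γ - 1) := by
      rw [hq]
      gcongr
    have h4 : min l₀ (q / 2) ≤ q / 2 := min_le_right _ _
    simp only [hψ]
    linarith
  have h2 : 0 ≤ ψ (max l₀ q) := by
    have h2 : -deriv F (max l₀ q) ≤ -deriv F l₀ :=
      neg_le_neg (hm hl₀ (hl₀.trans_le (le_max_left _ _)) (le_max_left _ _))
    have h5 : 0 ≤ -deriv F (max l₀ q) := by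
      have := deriv_nonpos_of_antitoneOn ha (hl₀.trans_le (le_max_left l₀ q))
      linarith
    have h3 : t / 2 * (-deriv F (max l₀ q)) ^ (γ - 1) ≤ q := by
      rw [hq]
      gcongr
    have h4 : q ≤ max l₀ q := le_max_right _ _
    simp only [hψ]
    linarith
  obtain ⟨l, hl, hl0⟩ := intermediate_value_Icc
    ((min_le_left l₀ (q / 2)).trans (le_max_left l₀ q)) (hcont.mono hsub) ⟨h1, h2⟩
  refine hno l (hsub hl) ?_
  simp only [hψ] at hl0
  linarith

/-- A function squeezed between two functions that touch it and have the same derivative. -/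
theorem hasDerivAt_of_squeeze {f l u : ℝ → ℝ} {x c : ℝ} (hl : HasDerivAt l c x)
    (hu : HasDerivAt u c x) (hlf : ∀ᶠ y in 𝓝 x, l y ≤ f y) (hfu : ∀ᶠ y in 𝓝 x, f y ≤ u y)
    (hlx : l x = f x) (hux : u x = f x) : HasDerivAt f c x := by
  rw [hasDerivAt_iff_isLittleO] at *
  rw [Asymptotics.isLittleO_iff] at *
  intro ε hε
  filter_upwards [hl hε, hu hε, hlf, hfu] with y h1 h2 h3 h4
  rw [Real.norm_eq_abs, Real.norm_eq_abs] at *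
  rw [hlx] at h1
  rw [hux] at h2
  rw [abs_le] at *
  constructor <;> linarith [h1.1, h2.2]

/-! ### The rate function along the Legendre curve -/

/-- `t G'(t) - G(t)`, the Legendre transform of `G` at `G'(t)`. -/
def legendre (G : ℝ → ℝ) (t : ℝ) : ℝ := t * deriv G t - G t

section Legendre

variable {G : ℝ → ℝ}

/-- Formally the derivative is t G''(t). Without second derivatives, G(b) - G(a) ≤ G'(b)(b - a)
shows that the increment from a to b is at least a (G'(b) - G'(a)) > 0. -/
theorem legendre_strictMonoOn (hG : StrictConvexOn ℝ (Ioi 0) G)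
    (hd : DifferentiableOn ℝ G (Ioi 0)) : StrictMonoOn (legendre G) (Ioi 0) := by
  intro a ha b hb hab
  have ha' : 0 < a := ha
  have hm := hG.strictMonoOn_deriv fun _ hx => (hasDerivAt_deriv_of_pos hd hx).differentiableAt
  have h1 := (le_add_deriv_of_lt hG.convexOn hd ha' hab).2
  have h2 : a * deriv G a < a * deriv G b := mul_lt_mul_of_pos_left (hm ha hb hab) ha'
  unfold legendre
  linarith

theorem continuousOn_legendre (hG : StrictConvexOn ℝ (Ioi 0) G)
    (hd : DifferentiableOn ℝ G (Ioi 0)) : ContinuousOn (legendre G) (Ioi 0) :=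
  (continuousOn_id.mul (continuousOn_deriv_of_convexOn hG.convexOn hd)).sub hd.continuousOn

/-- Since G' ≤ 0, the curve lies below -G(t) ≤ tM, which tends to 0 with t. -/
theorem legendre_lt_of_small (ha : AntitoneOn G (Ioi 0))
    {M : ℝ} (hM : ∀ t > 0, -(t * M) ≤ G t) {α : ℝ} (hα : 0 < α) :
    ∀ t₀ > 0, ∃ t ∈ Ioc 0 t₀, legendre G t < α := by
  intro t₀ ht₀
  refine ⟨min t₀ (α / (2 * (|M| + 1))), ⟨by positivity, min_le_left _ _⟩, ?_⟩
  set t := min t₀ (α / (2 * (|M| + 1)))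
  have ht : 0 < t := by positivity
  have h1 : t * deriv G t ≤ 0 :=
    mul_nonpos_of_nonneg_of_nonpos ht.le (deriv_nonpos_of_antitoneOn ha ht)
  have h2 := hM t ht
  have h3 : t * M ≤ α / 2 := by
    calc t * M ≤ t * (|M| + 1) := by gcongr; linarith [le_abs_self M]
      _ ≤ α / (2 * (|M| + 1)) * (|M| + 1) := by gcongr; exact min_le_right _ _
      _ = α / 2 := by field_simp
  unfold legendre
  linarith

/-- Either the Legendre curve reaches the level `α`, or it stays below. -/
theorem legendre_dichotomy (hG : StrictConvexOn ℝ (Ioi 0) G) (ha : AntitoneOn G (Ioi 0))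
    (hd : DifferentiableOn ℝ G (Ioi 0)) {M : ℝ} (hM : ∀ t > 0, -(t * M) ≤ G t) {α : ℝ}
    (hα : 0 < α) :
    (∃ t > 0, legendre G t = α) ∨ ∀ t > 0, legendre G t < α := by
  by_contra! hno
  obtain ⟨h1, t₁, ht₁, hle⟩ := hno
  obtain ⟨t₀, ht₀, hlt⟩ := legendre_lt_of_small ha hM hα t₁ ht₁
  obtain ⟨t, ht, htα⟩ := intermediate_value_Icc ht₀.2
    ((continuousOn_legendre hG hd).mono fun x hx => lt_of_lt_of_le ht₀.1 hx.1) ⟨hlt.le, hle⟩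
  exact h1 t (lt_of_lt_of_le ht₀.1 ht.1) htα

/-- The derivative of (G + α)/t is (J - α)/t² < 0 with J = `legendre G`, so this quotient decreases.
By `hlin` it cannot become negative in the limit t → ∞, hence it is nonnegative everywhere. -/
theorem neg_le_of_legendre_lt (hd : DifferentiableOn ℝ G (Ioi 0)) {α : ℝ}
    (hlt : ∀ t > 0, legendre G t < α) (hlin : ∀ ε > 0, ∃ C, ∀ t > 0, -(ε * t) - C ≤ G t) :
    ∀ t > 0, -α ≤ G t := by
  have hanti : AntitoneOn (fun t => (G t + α) / t) (Ioi 0) := by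
    have hder : ∀ t > 0, HasDerivAt (fun t => (G t + α) / t) ((legendre G t - α) / t ^ 2) t := by
      intro t ht
      have := ((hasDerivAt_deriv_of_pos hd ht).add_const α).div (hasDerivAt_id t) (ne_of_gt ht)
      refine this.congr_deriv ?_
      simp only [legendre, id]
      ring
    refine antitoneOn_of_deriv_nonpos (convex_Ioi 0)
      (fun t ht => (hder t ht).continuousAt.continuousWithinAt) ?_ ?_
    · intro t ht
      rw [interior_Ioi] at ht
      exact (hder t ht).differentiableAt.differentiableWithinAt
    · intro t ht
      rw [interior_Ioi] at ht
      rw [(hder t ht).deriv]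
      exact div_nonpos_of_nonpos_of_nonneg (by linarith [hlt t ht]) (by positivity)
  intro t ht
  suffices h : 0 ≤ (G t + α) / t by
    have := (div_nonneg_iff.1 h)
    rcases this with h | h
    · linarith [h.1]
    · linarith [h.2]
  refine le_of_forall_pos_le_add fun ε hε => ?_
  obtain ⟨C, hC⟩ := hlin (ε / 2) (by linarith)
  set T := max t (2 * |C - α| / ε)
  have hT : 0 < T := ht.trans_le (le_max_left _ _)
  have h1 := hanti ht hT (le_max_left _ _)
  have h2 : -ε ≤ (G T + α) / T := by
    rw [le_div_iff₀ hT]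
    have h3 := hC T hT
    have h4 : 2 * |C - α| ≤ T * ε := (div_le_iff₀ hε).1 (le_max_right _ _)
    have := le_abs_self (C - α)
    linarith
  simp only at h1
  linarith

end Legendre

/-! ### The replica free entropy in terms of its shape function -/

section Replica

variable {G φ : ℝ → ℝ} {α c t : ℝ}

/-- Write φ(m) = (α + G(m t))/m - α + c and apply the quotient rule. The sign of φ' is that of J(m
t) - α, which turns stationarity in m into a level equation for the monotone function J = `legendre
G`. -/
theorem hasDerivAt_replica (hd : DifferentiableOn ℝ G (Ioi 0)) (ht : 0 < t)
    (hφ : ∀ m > 0, φ m = (1 - m) / m * α + 1 / m * (m * c + G (m * t))) {m : ℝ} (hm : 0 < m) :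
    HasDerivAt φ ((legendre G (m * t) - α) / m ^ 2) m := by
  have h1 : HasDerivAt (fun m => G (m * t)) (deriv G (m * t) * t) m := by
    have := HasDerivAt.comp m (h₂ := G) (h := fun m => m * t)
      (hasDerivAt_deriv_of_pos hd (mul_pos hm ht)) ((hasDerivAt_id m).mul_const t)
    rwa [one_mul] at this
  have h2 : HasDerivAt (fun m => (α + G (m * t)) / m - α + c)
      (((deriv G (m * t) * t) * m - (α + G (m * t)) * 1) / m ^ 2) m :=
    (((h1.const_add α).div (hasDerivAt_id m) hm.ne').sub_const α).add_const c
  refine (h2.congr_of_eventuallyEq ?_).congr_deriv ?_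
  · filter_upwards [lt_mem_nhds hm] with y hy
    rw [hφ y hy]
    field_simp
    ring
  · unfold legendre
    ring

theorem replica_one (hφ : ∀ m > 0, φ m = (1 - m) / m * α + 1 / m * (m * c + G (m * t))) :
    φ 1 = c + G t := by
  rw [hφ 1 one_pos]
  norm_num

/-- Below the critical bandwidth, the replica free entropy has a unique stationary point. -/
theorem replica_stationary (hG : StrictConvexOn ℝ (Ioi 0) G) (hd : DifferentiableOn ℝ G (Ioi 0))
    (ht : 0 < t) (hφ : ∀ m > 0, φ m = (1 - m) / m * α + 1 / m * (m * c + G (m * t)))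
    {tG : ℝ} (htG : 0 < tG) (hα : legendre G tG = α) (hlt : tG < t) :
    ∃ m ∈ Ioo (0 : ℝ) 1, HasDerivAt φ 0 m ∧
      (∀ m₁ ∈ Ioo (0 : ℝ) 1, HasDerivAt φ 0 m₁ → m₁ = m) ∧ φ m < φ 1 ∧
      φ m = c - α + t * deriv G tG := by
  have hmono := legendre_strictMonoOn hG hd
  have hder := fun {m : ℝ} (hm : 0 < m) => hasDerivAt_replica hd ht hφ hm
  have hm0 : 0 < tG / t := div_pos htG ht
  have hmt : tG / t * t = tG := div_mul_cancel₀ _ ht.ne'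
  -- The only m with m t = tG; it lies below 1 because tG < t.
  refine ⟨tG / t, ⟨hm0, (div_lt_one ht).2 hlt⟩, ?_, ?_, ?_, ?_⟩
  · have := hder hm0
    rwa [hmt, hα, sub_self, zero_div] at this
  · intro m₁ hm₁ h
    have h1 := (hder hm₁.1).unique h
    rw [div_eq_zero_iff, sub_eq_zero, ← hα] at h1
    rcases h1 with h1 | h1
    · have := hmono.injOn (mul_pos hm₁.1 ht) htG h1
      rw [← this, mul_div_cancel_right₀ _ ht.ne']
    · exact absurd h1 (pow_ne_zero 2 hm₁.1.ne')
  · have hs : StrictMonoOn φ (Icc (tG / t) 1) := by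
      refine strictMonoOn_of_deriv_pos (convex_Icc _ _)
        (fun m hm => (hder (hm0.trans_le hm.1)).continuousAt.continuousWithinAt) ?_
      intro m hm
      rw [interior_Icc] at hm
      have hmp := hm0.trans hm.1
      rw [(hder hmp).deriv]
      refine div_pos ?_ (by positivity)
      have : legendre G tG < legendre G (m * t) :=
        hmono htG (mul_pos hmp ht) ((div_lt_iff₀ ht).1 hm.1)
      linarith
    exact hs (left_mem_Icc.2 ((div_lt_one ht).2 hlt).le)
      (right_mem_Icc.2 ((div_lt_one ht).2 hlt).le) ((div_lt_one ht).2 hlt)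
  · rw [hφ _ hm0, hmt, ← hα]
    unfold legendre
    field_simp
    ring

end Replica

/-! ### Limits in probability of scaled cumulant generating functions -/

section ScgfLimit

variable {X : ℕ → Type*} [∀ d, MeasurableSpace (X d)] {P : ∀ d, Measure (X d)}
  {Y : ℕ → Type*} [∀ d, MeasurableSpace (Y d)] {μ : ∀ d, Measure (Y d)}
  {w : ∀ d, X d → Y d → ℝ} {Λ : ℝ → ℝ}

/-- The scaled cumulant generating function tends to `Λ t` in probability, for all `t > 0`. -/
def ScgfTendsto (P : ∀ d, Measure (X d)) (μ : ∀ d, Measure (Y d)) (w : ∀ d, X d → Y d → ℝ)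
    (Λ : ℝ → ℝ) : Prop :=
  ∀ t > 0, ∀ ε > 0, Whp P (fun d x => |scgf (μ d) (w d x) d t - Λ t| < ε)

theorem ScgfTendsto.lower (h : ScgfTendsto P μ w Λ) {t : ℝ} (ht : 0 < t) {ε : ℝ} (hε : 0 < ε) :
    Whp P (fun d x => Λ t - ε ≤ scgf (μ d) (w d x) d t) :=
  (h t ht ε hε).mono (Eventually.of_forall fun _ _ hx => by linarith [(abs_lt.1 hx).1])

theorem ScgfTendsto.upper (h : ScgfTendsto P μ w Λ) {t : ℝ} (ht : 0 < t) {ε : ℝ} (hε : 0 < ε) :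
    Whp P (fun d x => scgf (μ d) (w d x) d t ≤ Λ t + ε) :=
  (h t ht ε hε).mono (Eventually.of_forall fun _ _ hx => by linarith [(abs_lt.1 hx).2])

variable [∀ d, IsProbabilityMeasure (μ d)]

/-! ### The Laplace principle for powers -/

variable {v : ∀ d, X d → Y d → ℝ} {F : ℝ → ℝ} {γ : ℝ}

/-- Only the event |v - s| < δ is kept, whose probability is bounded below by `whp_measure_window`.
The point l need not be related to t: every l gives a valid bound, and later l is frozen while t
varies. -/
theorem whp_scgf_rpow_ge (hv : ∀ d x, Measurable (v d x)) (h0 : ∀ d x y, 0 ≤ v d x y)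
    (h : ScgfTendsto P μ v F) (hγ : 1 ≤ γ) {l s t : ℝ} (hl : 0 < l) (hs : HasDerivAt F (-s) l)
    (ht : 0 < t) {ε : ℝ} (hε : 0 < ε) :
    Whp P (fun d x => F l + l * s - t * (s ^ γ / (2 * γ)) - ε ≤
      scgf (μ d) (fun y => v d x y ^ γ / (2 * γ)) d t) := by
  have hcont : Tendsto (fun δ => t * ((s + δ) ^ γ / (2 * γ))) (𝓝[>] 0)
      (𝓝 (t * (s ^ γ / (2 * γ)))) := by
    have : ContinuousAt (fun δ => t * ((s + δ) ^ γ / (2 * γ))) 0 := by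
      refine ContinuousAt.mul continuousAt_const (ContinuousAt.div_const ?_ _)
      exact ContinuousAt.rpow_const (by fun_prop) (Or.inr (by linarith))
    have := this.tendsto
    rw [add_zero] at this
    exact this.mono_left nhdsWithin_le_nhds
  obtain ⟨δ, hδ, hδ0⟩ := ((hcont.eventually (gt_mem_nhds (show t * (s ^ γ / (2 * γ)) <
    t * (s ^ γ / (2 * γ)) + ε / 2 by linarith))).and eventually_mem_nhdsWithin).exists
  refine (whp_measure_window hv h0 h hl hs (δ := δ) (ε := ε / 2) hδ0 (by linarith)).mono ?_
  filter_upwards [eventually_ne_atTop 0] with d hd x hx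
  have hw : Measurable (fun y => v d x y ^ γ / (2 * γ)) := ((hv d x).pow_const γ).div_const _
  have hw0 : ∀ y, 0 ≤ v d x y ^ γ / (2 * γ) := fun y => by
    have := Real.rpow_nonneg (h0 d x y) γ
    positivity
  refine le_scgf_of_le hw hw0 ht.le hd ?_
  refine le_trans ?_ (le_integral_exp_neg_of_le hw hw0 ht.le (b := (s + δ) ^ γ / (2 * γ))
    (s := {y | |v d x y - s| < δ})
    (measurableSet_lt ((hv d x).sub_const s).norm measurable_const) fun y hy => ?_)
  · refine le_trans ?_ (mul_le_mul_of_nonneg_left hx (Real.exp_pos _).le)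
    rw [← Real.exp_add, Real.exp_le_exp]
    have : (d : ℝ) * (t * ((s + δ) ^ γ / (2 * γ))) ≤ d * (t * (s ^ γ / (2 * γ)) + ε / 2) := by
      gcongr
    linarith
  · have h1 : |v d x y - s| < δ := hy
    have h2 := (abs_lt.1 h1).2
    have := h0 d x y
    gcongr
    linarith

/-- Replacing u^γ by its tangent line at s turns the exponential moment of v^γ/(2γ) at t into that
of v at (t/2) s^(γ-1). Any s ≥ 0 making this argument positive is allowed. -/
theorem whp_scgf_rpow_le (hv : ∀ d x, Measurable (v d x)) (h0 : ∀ d x y, 0 ≤ v d x y)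
    (h : ScgfTendsto P μ v F) (hγ : 1 ≤ γ) {s t : ℝ} (hs0 : 0 ≤ s) (ht : 0 < t)
    (hl : 0 < t / 2 * s ^ (γ - 1)) {ε : ℝ} (hε : 0 < ε) :
    Whp P (fun d x => scgf (μ d) (fun y => v d x y ^ γ / (2 * γ)) d t ≤
      t * (1 / 2 - 1 / (2 * γ)) * s ^ γ + F (t / 2 * s ^ (γ - 1)) + ε) := by
  refine (h.upper hl hε).mono ?_
  filter_upwards [eventually_ne_atTop 0] with d hd x hx
  have hw : Measurable (fun y => v d x y ^ γ / (2 * γ)) := ((hv d x).pow_const γ).div_const _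
  have hw0 : ∀ y, 0 ≤ v d x y ^ γ / (2 * γ) := fun y => by
    have := Real.rpow_nonneg (h0 d x y) γ
    positivity
  have hss : s ^ γ = s ^ (γ - 1) * s := by
    rw [← Real.rpow_add_one' hs0 (by linarith), sub_add_cancel]
  suffices scgf (μ d) (fun y => v d x y ^ γ / (2 * γ)) d t ≤
      t * (1 / 2 - 1 / (2 * γ)) * s ^ γ + scgf (μ d) (v d x) d (t / 2 * s ^ (γ - 1)) by linarith
  refine scgf_le_of_le hw hw0 ht.le hd ?_
  rw [mul_add, Real.exp_add, exp_scgf (hv d x) (h0 d x) hl.le hd, ← integral_const_mul]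
  refine integral_mono (integrable_exp_neg hw hw0 ht.le)
    ((integrable_exp_neg (hv d x) (h0 d x) hl.le).const_mul _) fun y => ?_
  simp only
  rw [← Real.exp_add, Real.exp_le_exp]
  have h1 := rpow_tangent_le hγ hs0 (h0 d x y)
  have h2 : (s ^ γ + γ * s ^ (γ - 1) * (v d x y - s)) / (2 * γ) ≤ v d x y ^ γ / (2 * γ) := by
    gcongr
  have h3 : (s ^ γ + γ * s ^ (γ - 1) * (v d x y - s)) / (2 * γ) =
      s ^ γ / (2 * γ) + s ^ (γ - 1) * (v d x y - s) / 2 := by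
    field_simp
  have h4 : (d : ℝ) * t * (s ^ γ / (2 * γ) + s ^ (γ - 1) * (v d x y - s) / 2) ≤
      d * t * (v d x y ^ γ / (2 * γ)) := by
    rw [← h3]
    gcongr
  refine le_trans (neg_le_neg h4) (le_of_eq ?_)
  rw [hss]
  field_simp
  ring

variable [∀ d, IsProbabilityMeasure (P d)]

theorem ScgfTendsto.antitoneOn (hw : ∀ d x, Measurable (w d x)) (h0 : ∀ d x y, 0 ≤ w d x y)
    (h : ScgfTendsto P μ w Λ) : AntitoneOn Λ (Ioi 0) := by
  intro s hs t ht hst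
  have hs' : 0 < s := hs
  refine le_of_whp (μ := P) (X := fun d x => scgf (μ d) (w d x) d t)
    (fun ε hε => h.lower ht hε) fun ε hε => ?_
  refine (h.upper hs hε).mono ?_
  filter_upwards [eventually_ne_atTop 0] with d hd x hx
  exact (scgf_anti (hw d x) (h0 d x) hs'.le hst hd).trans hx

theorem ScgfTendsto.convexOn (hw : ∀ d x, Measurable (w d x)) (h0 : ∀ d x y, 0 ≤ w d x y)
    (h : ScgfTendsto P μ w Λ) : ConvexOn ℝ (Ioi 0) Λ := by
  refine ⟨convex_Ioi 0, fun s hs t ht a b ha hb hab => ?_⟩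
  have hs' : 0 < s := hs
  have ht' : 0 < t := ht
  have hst : 0 < a • s + b • t := (convex_Ioi (0 : ℝ)) hs ht ha hb hab
  simp only [smul_eq_mul] at hst ⊢
  refine le_of_whp (μ := P) (X := fun d x => scgf (μ d) (w d x) d (a * s + b * t))
    (fun ε hε => h.lower hst hε) fun ε hε => ?_
  refine ((h.upper hs hε).and (h.upper ht hε)).mono ?_
  filter_upwards [eventually_ne_atTop 0] with d hd x hx
  have h1 := mul_le_mul_of_nonneg_left hx.1 ha
  have h2 := mul_le_mul_of_nonneg_left hx.2 hb
  have h3 := scgf_convex (μ := μ d) (hw d x) (h0 d x) hs'.le ht'.le ha hb hab hd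
  have h4 : a * ε + b * ε = ε := by rw [← add_mul, hab, one_mul]
  linarith

/-- A lower bound for the limit, from a lower bound for the probability of small values. -/
theorem ScgfTendsto.ge (hw : ∀ d x, Measurable (w d x)) (h0 : ∀ d x y, 0 ≤ w d x y)
    (h : ScgfTendsto P μ w Λ) {M C : ℝ}
    (hM : ∀ᶠ d : ℕ in atTop,
      P d {x | ¬ Real.exp (-(d * C)) ≤ (μ d).real {y | w d x y ≤ M}} ≤ 1 / 2)
    {t : ℝ} (ht : 0 < t) : -(t * M) - C ≤ Λ t := by
  refine le_of_forall_pos_le_add fun ε hε => ?_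
  obtain ⟨d, ⟨x, h1, h2⟩, hd⟩ :=
    (((h.upper ht hε).exists_of_measure_le hM).and (eventually_ne_atTop 0)).exists
  refine le_trans (le_scgf_of_le (hw d x) (h0 d x) ht.le hd ?_) h1
  refine le_trans ?_ (le_integral_exp_neg_of_le (hw d x) (h0 d x) ht.le (b := M)
    (s := {y | w d x y ≤ M}) (measurableSet_le (hw d x) measurable_const) fun y hy => hy)
  calc Real.exp (d * (-(t * M) - C)) = Real.exp (-(d * t * M)) * Real.exp (-(d * C)) := by
        rw [← Real.exp_add]; congr 1; ring
    _ ≤ _ := by gcongr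

/-- If small values have probability at least `1 / 2`, then the limit vanishes at the origin. -/
theorem ScgfTendsto.ge_of_half (hw : ∀ d x, Measurable (w d x)) (h0 : ∀ d x y, 0 ≤ w d x y)
    (h : ScgfTendsto P μ w Λ) {M : ℝ}
    (hM : ∀ᶠ d : ℕ in atTop, P d {x | ¬ 1 / 2 ≤ (μ d).real {y | w d x y ≤ M}} ≤ 1 / 2)
    {t : ℝ} (ht : 0 < t) : -(t * M) ≤ Λ t := by
  refine le_of_forall_pos_le_add fun ε hε => ?_
  suffices -(t * M) - ε ≤ Λ t by linarith
  refine h.ge hw h0 ?_ ht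
  have hlarge : ∀ᶠ d : ℕ in atTop, 2 ≤ Real.exp (d * ε) :=
    (Real.tendsto_exp_atTop.comp
      (tendsto_natCast_atTop_atTop.atTop_mul_const hε)).eventually_ge_atTop 2
  filter_upwards [hM, hlarge] with d hd hd2
  refine le_trans (measure_mono fun x hx hx' => hx (le_trans ?_ hx')) hd
  rw [Real.exp_neg, one_div]
  exact inv_anti₀ (by norm_num) hd2

/-- The Laplace principle: the scaled cumulant generating function of `v ^ γ / (2 γ)` has a
differentiable limit if that of `v` has one. -/
theorem ScgfTendsto.rpow (hv : ∀ d x, Measurable (v d x)) (h0 : ∀ d x y, 0 ≤ v d x y)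
    (h : ScgfTendsto P μ v F) (hdF : DifferentiableOn ℝ F (Ioi 0)) (hγ : 1 ≤ γ) {M : ℝ}
    (hM : ∀ t > 0, -(t * M) ≤ F t) :
    ∃ G, DifferentiableOn ℝ G (Ioi 0) ∧
      ScgfTendsto P μ (fun d x y => v d x y ^ γ / (2 * γ)) G := by
  have hF := h.convexOn hv h0
  have ha := h.antitoneOn hv h0
  by_cases hconst : ∀ l > 0, deriv F l = 0
  -- Degenerate case: F is constant, and -(tM) ≤ F t for small t makes the constant nonnegative.
  -- With slope s = 0 the lower bound then gives the limit G = 0.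
  · have hF0 : 0 ≤ F 1 := by
      refine le_of_forall_pos_le_add fun ε hε => ?_
      have hl : 0 < min (1 / 2) (ε / (|M| + 1)) := by positivity
      have hl1 : min (1 / 2) (ε / (|M| + 1)) < 1 :=
        (min_le_left _ _).trans_lt (by norm_num)
      obtain ⟨z, hz, hz'⟩ := sub_eq_deriv_mul_of_lt hdF hl hl1
      rw [hconst z (hl.trans hz.1), zero_mul] at hz'
      have h1 := hM _ hl
      have h2 : min (1 / 2) (ε / (|M| + 1)) * M ≤ ε := by
        calc min (1 / 2) (ε / (|M| + 1)) * M ≤ min (1 / 2) (ε / (|M| + 1)) * (|M| + 1) := by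
              gcongr; linarith [le_abs_self M]
          _ ≤ ε / (|M| + 1) * (|M| + 1) := by gcongr; exact min_le_right _ _
          _ = ε := by field_simp
      linarith
    refine ⟨fun _ => 0, differentiableOn_const 0, fun t ht ε hε => ?_⟩
    have hd1 : HasDerivAt F (-0) 1 := by
      have := hasDerivAt_deriv_of_pos hdF one_pos
      rwa [hconst 1 one_pos, ← neg_zero] at this
    refine (whp_scgf_rpow_ge hv h0 h hγ one_pos hd1 ht (half_pos hε)).mono
      (Eventually.of_forall fun d x hx => ?_)
    have hn := scgf_nonpos (μ := μ d) (d := d) (w := fun y => v d x y ^ γ / (2 * γ))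
      (((hv d x).pow_const γ).div_const _) (fun y => by
        have := Real.rpow_nonneg (h0 d x y) γ
        positivity) ht.le
    rw [Real.zero_rpow (by linarith)] at hx
    rw [sub_zero, abs_lt]
    constructor
    · norm_num at hx
      linarith
    · linarith
  · have hstat : ∀ t > 0, ∃ l > 0, l = t / 2 * (-deriv F l) ^ (γ - 1) := fun t ht =>
      (exists_stationary hF hdF ha hγ ht).resolve_left hconst
    choose! l hl hls using hstat
    set s : ℝ → ℝ := fun t => -deriv F (l t) with hs
    have hs0 : ∀ t > 0, 0 ≤ s t := fun t ht => by
      have := deriv_nonpos_of_antitoneOn ha (hl t ht)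
      simp only [hs]
      linarith
    have hder : ∀ t > 0, HasDerivAt F (-(s t)) (l t) := fun t ht => by
      simpa [hs] using hasDerivAt_deriv_of_pos hdF (hl t ht)
    set G : ℝ → ℝ := fun t => F (l t) + l t * s t - t * (s t ^ γ / (2 * γ)) with hG
    have hss : ∀ t > 0, s t ^ γ = s t ^ (γ - 1) * s t := fun t ht => by
      rw [← Real.rpow_add_one' (hs0 t ht) (by linarith), sub_add_cancel]
    -- At a stationary l the tangent-line bound equals the window bound, which settles the limit.
    have hup : ∀ t > 0, t * (1 / 2 - 1 / (2 * γ)) * s t ^ γ + F (t / 2 * s t ^ (γ - 1)) = G t := by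
      intro t ht
      simp only [hG]
      have h1 : t / 2 * s t ^ γ = l t * s t := by
        rw [hss t ht, ← mul_assoc]
        exact congrArg (· * s t) (hls t ht).symm
      rw [← hls t ht, ← h1]
      ring
    have hpow : ∀ t > 0, 0 < s t ^ (γ - 1) := by
      intro t ht
      have h1 := hl t ht
      rw [hls t ht] at h1
      exact (mul_pos_iff_of_pos_left (by positivity)).1 h1
    have hlim : ScgfTendsto P μ (fun d x y => v d x y ^ γ / (2 * γ)) G := by
      intro t ht ε hε
      have h1 := whp_scgf_rpow_ge hv h0 h hγ (hl t ht) (hder t ht) ht (half_pos hε)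
      have h2 := whp_scgf_rpow_le hv h0 h hγ (hs0 t ht) ht
        (mul_pos (by positivity) (hpow t ht)) (half_pos hε)
      refine (h1.and h2).mono (Eventually.of_forall fun d x hx => ?_)
      have h3 := hx.1
      have h4 := hx.2
      rw [hup t ht] at h4
      rw [abs_lt]
      constructor
      · simp only [hG]
        linarith
      · linarith
    refine ⟨G, fun t ht => ?_, hlim⟩
    have ht' : 0 < t := ht
    refine HasDerivAt.differentiableAt (f' := -(s t ^ γ / (2 * γ))) ?_ |>.differentiableWithinAt
    -- With l and s frozen at their values for t, both bounds hold for all r near t, touch G at r =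
    -- t, and have slope -s^γ/(2γ) there. No regularity of l or s as functions of t is needed.
    refine hasDerivAt_of_squeeze (l := fun r => F (l t) + l t * s t - r * (s t ^ γ / (2 * γ)))
      (u := fun r => r * (1 / 2 - 1 / (2 * γ)) * s t ^ γ + F (r / 2 * s t ^ (γ - 1)))
      ?_ ?_ ?_ ?_ rfl (hup t ht)
    · have := ((hasDerivAt_id t).mul_const (s t ^ γ / (2 * γ))).const_sub (F (l t) + l t * s t)
      simpa using this
    · have h1 : HasDerivAt (fun r => F (r / 2 * s t ^ (γ - 1)))
          (-(s t) * (1 / 2 * s t ^ (γ - 1))) t := by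
        have hin : HasDerivAt (fun r => r / 2 * s t ^ (γ - 1)) (1 / 2 * s t ^ (γ - 1)) t :=
          ((hasDerivAt_id t).div_const 2).mul_const _
        have hF' := hder t ht
        rw [hls t ht] at hF'
        exact HasDerivAt.comp t hF' hin
      have h2 : HasDerivAt (fun r => r * (1 / 2 - 1 / (2 * γ)) * s t ^ γ)
          (1 * (1 / 2 - 1 / (2 * γ)) * s t ^ γ) t :=
        ((hasDerivAt_id t).mul_const _).mul_const _
      refine (h2.add h1).congr_deriv ?_
      rw [hss t ht]
      ring
    · filter_upwards [lt_mem_nhds ht'] with r hr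
      exact le_of_whp (μ := P)
        (fun ε hε => whp_scgf_rpow_ge hv h0 h hγ (hl t ht) (hder t ht) hr hε)
        (fun ε hε => hlim.upper hr hε)
    · filter_upwards [lt_mem_nhds ht'] with r hr
      exact le_of_whp (μ := P) (fun ε hε => hlim.lower hr hε)
        (fun ε hε => whp_scgf_rpow_le hv h0 h hγ (hs0 t ht) hr
          (mul_pos (by positivity) (hpow t ht)) hε)

end ScgfLimit

/-! ### Convergence of means -/

section Means

theorem integrable_of_le {Ω : Type*} [MeasurableSpace Ω] {P : Measure Ω} [IsProbabilityMeasure P]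
    {X V : Ω → ℝ} {T : Ω → ENNReal} (hX : AEStronglyMeasurable X P) (hV : Measurable V)
    (hV0 : ∀ x, 0 ≤ V x) (hVi : ∫⁻ x, ENNReal.ofReal (V x) ∂P ≠ ⊤)
    (hT : Measurable T) (hTi : ∫⁻ x, T x ∂P ≠ ⊤) {K η : ℝ}
    (h : ∀ᵐ x ∂P, |X x| ≤ K + η * V x + (T x).toReal) : Integrable X P := by
  have h1 : Integrable V P := by
    refine ⟨hV.aestronglyMeasurable, ?_⟩
    rw [hasFiniteIntegral_iff_ofReal (ae_of_all _ hV0)]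
    exact hVi.lt_top
  have h2 : Integrable (fun x => (T x).toReal) P := integrable_toReal_of_lintegral_ne_top
    hT.aemeasurable hTi
  exact (((integrable_const K).add (h1.const_mul η)).add h2).mono' hX h

/-- A sequence that converges in probability and is dominated, up to an arbitrarily small multiple
of a bounded sequence in `L¹`, by a constant plus a sequence that vanishes in `L¹`, converges in
mean. -/
theorem tendsto_integral_of_whp {Ω : ℕ → Type*} [∀ d, MeasurableSpace (Ω d)]
    {P : ∀ d, Measure (Ω d)} [∀ d, IsProbabilityMeasure (P d)] {X V : ∀ d, Ω d → ℝ}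
    {T : ℝ → ∀ d, Ω d → ENNReal} {a C : ℝ} (hXi : ∀ᶠ d in atTop, Integrable (X d) (P d))
    (hV : ∀ d, Measurable (V d)) (hV0 : ∀ d x, 0 ≤ V d x)
    (hVi : ∀ᶠ d in atTop, ∫⁻ x, ENNReal.ofReal (V d x) ∂(P d) ≤ ENNReal.ofReal C)
    (hT : ∀ η d, Measurable (T η d))
    (hTi : ∀ η > 0, Tendsto (fun d => ∫⁻ x, T η d x ∂(P d)) atTop (𝓝 0))
    (hdom : ∀ η > 0, ∃ K, ∀ᶠ d in atTop, ∀ᵐ x ∂(P d),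
      |X d x| ≤ K + η * V d x + (T η d x).toReal)
    (hwhp : ∀ ε > 0, Whp P (fun d x => |X d x - a| < ε)) :
    Tendsto (fun d => ∫ x, X d x ∂(P d)) atTop (𝓝 a) := by
  rw [Metric.tendsto_nhds]
  intro δ hδ
  have hC1 : 0 < |C| + 1 := by positivity
  -- Four contributions of at most δ/5 each: the exceptional event, the deviation off it, the term
  -- ηV, and T. Their sum 4δ/5 is strictly below δ.
  set η := δ / (5 * (|C| + 1)) with hη
  have hη0 : 0 < η := by positivity
  obtain ⟨K, hK⟩ := hdom η hη0
  have hA := ENNReal.Tendsto.const_mul (a := ENNReal.ofReal (|K| + |a|)) (hwhp (δ / 5) (by linarith))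
    (Or.inr ENNReal.ofReal_ne_top)
  rw [mul_zero] at hA
  have hδ5 : (0 : ENNReal) < ENNReal.ofReal (δ / 5) := ENNReal.ofReal_pos.2 (by linarith)
  filter_upwards [hXi, hVi, hK, hA.eventually (gt_mem_nhds hδ5),
    (hTi η hη0).eventually (gt_mem_nhds hδ5)] with d hXd hVd hKd hAd hTd
  have hTfin : ∀ᵐ x ∂(P d), T η d x < ⊤ := ae_lt_top (hT η d) (hTd.trans_le le_top).ne
  set A := {x | ¬ |X d x - a| < δ / 5} with hAdef
  have hpt : ∀ᵐ x ∂(P d), ‖X d x - a‖ₑ ≤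
      A.indicator (fun _ => ENNReal.ofReal (|K| + |a|)) x
      + (ENNReal.ofReal (δ / 5) + (ENNReal.ofReal η * ENNReal.ofReal (V d x) + T η d x)) := by
    filter_upwards [hKd, hTfin] with x hx hTx
    rw [← ofReal_norm, Real.norm_eq_abs]
    by_cases hxA : x ∈ A
    · rw [indicator_of_mem hxA]
      have h1 : |X d x - a| ≤ (|K| + |a|) + (η * V d x + (T η d x).toReal) := by
        have := abs_sub (X d x) a
        have := le_abs_self K
        linarith
      have hηV : 0 ≤ η * V d x := mul_nonneg hη0.le (hV0 d x)
      calc ENNReal.ofReal |X d x - a|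
          ≤ ENNReal.ofReal ((|K| + |a|) + (η * V d x + (T η d x).toReal)) :=
            ENNReal.ofReal_le_ofReal h1
        _ = ENNReal.ofReal (|K| + |a|) + (ENNReal.ofReal η * ENNReal.ofReal (V d x) + T η d x) := by
            rw [ENNReal.ofReal_add (by positivity) (by positivity),
              ENNReal.ofReal_add hηV ENNReal.toReal_nonneg, ENNReal.ofReal_mul hη0.le,
              ENNReal.ofReal_toReal hTx.ne]
        _ ≤ _ := by
            exact add_le_add le_rfl le_add_self
    · have h1 : |X d x - a| < δ / 5 := not_not.1 hxA
      rw [indicator_of_notMem hxA, zero_add]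
      exact (ENNReal.ofReal_le_ofReal h1.le).trans le_self_add
  have hint : ∫⁻ x, ‖X d x - a‖ₑ ∂(P d) ≤ ENNReal.ofReal (4 * (δ / 5)) := by
    have hm1 : Measurable fun x => ENNReal.ofReal η * ENNReal.ofReal (V d x) :=
      ((hV d).ennreal_ofReal).const_mul _
    have hm2 : Measurable fun x => ENNReal.ofReal η * ENNReal.ofReal (V d x) + T η d x :=
      hm1.add (hT η d)
    have hm3 : Measurable fun x => ENNReal.ofReal (δ / 5) +
        (ENNReal.ofReal η * ENNReal.ofReal (V d x) + T η d x) := measurable_const.add hm2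
    calc ∫⁻ x, ‖X d x - a‖ₑ ∂(P d)
        ≤ ∫⁻ x, (A.indicator (fun _ => ENNReal.ofReal (|K| + |a|)) x
            + (ENNReal.ofReal (δ / 5) + (ENNReal.ofReal η * ENNReal.ofReal (V d x) + T η d x)))
              ∂(P d) := lintegral_mono_ae hpt
      _ = ∫⁻ x, A.indicator (fun _ => ENNReal.ofReal (|K| + |a|)) x ∂(P d)
            + (ENNReal.ofReal (δ / 5) + (ENNReal.ofReal η * ∫⁻ x, ENNReal.ofReal (V d x) ∂(P d)
              + ∫⁻ x, T η d x ∂(P d))) := by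
          rw [lintegral_add_right _ hm3,
            lintegral_add_left measurable_const, lintegral_add_left hm1,
            lintegral_const_mul _ (hV d).ennreal_ofReal]
          simp
      _ ≤ ENNReal.ofReal (δ / 5) + (ENNReal.ofReal (δ / 5) + (ENNReal.ofReal (δ / 5)
            + ENNReal.ofReal (δ / 5))) := by
          gcongr
          · exact (lintegral_indicator_const_le _ _).trans hAd.le
          · calc ENNReal.ofReal η * ∫⁻ x, ENNReal.ofReal (V d x) ∂(P d)
                ≤ ENNReal.ofReal η * ENNReal.ofReal C := by gcongr
              _ = ENNReal.ofReal (η * C) := (ENNReal.ofReal_mul hη0.le).symm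
              _ ≤ ENNReal.ofReal (δ / 5) := by
                refine ENNReal.ofReal_le_ofReal ?_
                calc η * C ≤ η * (|C| + 1) := by gcongr; linarith [le_abs_self C]
                  _ = δ / 5 := by rw [hη]; field_simp
      _ = ENNReal.ofReal (4 * (δ / 5)) := by
          rw [← ENNReal.ofReal_add (by positivity) (by positivity),
            ← ENNReal.ofReal_add (by positivity) (by positivity),
            ← ENNReal.ofReal_add (by positivity) (by positivity)]
          congr 1
          ring
  have h1 : ∫ x, X d x ∂(P d) - a = ∫ x, (X d x - a) ∂(P d) := by
    rw [integral_sub hXd (integrable_const a)]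
    simp
  rw [Real.dist_eq, h1, ← Real.norm_eq_abs]
  have h2 := (enorm_integral_le_lintegral_enorm (μ := P d) fun x => X d x - a).trans hint
  rw [← ofReal_norm] at h2
  have h3 := (ENNReal.ofReal_le_ofReal_iff (by positivity)).1 h2
  linarith

end Means

/-! ### Cubes -/

/-- The index of the cube of side `r` that contains `x`. -/
def cell {d : ℕ} (r : ℝ) (x : E d) : Fin d → ℤ := fun i => ⌊x i / r⌋

theorem measurable_cell {d : ℕ} (r : ℝ) : Measurable (cell (d := d) r) := by
  refine measurable_pi_lambda _ fun i => Int.measurable_floor.comp ?_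
  fun_prop

theorem norm_sub_sq_le_of_cell_eq {d : ℕ} {r : ℝ} (hr : 0 < r) {x y : E d}
    (h : cell r x = cell r y) : ‖x - y‖ ^ 2 ≤ d * r ^ 2 := by
  rw [EuclideanSpace.real_norm_sq_eq]
  calc ∑ i, (x - y) i ^ 2 ≤ ∑ _i : Fin d, r ^ 2 := by
        refine Finset.sum_le_sum fun i _ => ?_
        have h1 : ⌊x i / r⌋ = ⌊y i / r⌋ := congrFun h i
        have h2 := Int.abs_sub_lt_one_of_floor_eq_floor h1
        rw [← sub_div, abs_div, abs_of_pos hr, div_lt_one hr] at h2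
        rw [sq_le_sq, abs_of_pos hr]
        exact h2.le
    _ = d * r ^ 2 := by simp

/-- The measure on `ℤ` with weights `exp (-|k|)`. -/
def expWeight : Measure ℤ :=
  Measure.count.withDensity fun k => ENNReal.ofReal (Real.exp (-|(k : ℝ)|))

theorem expWeight_singleton (k : ℤ) :
    expWeight {k} = ENNReal.ofReal (Real.exp (-|(k : ℝ)|)) := by
  rw [expWeight, withDensity_apply _ (measurableSet_singleton k), Measure.restrict_singleton]
  simp

instance : IsFiniteMeasure expWeight := by
  refine isFiniteMeasure_withDensity_ofReal ?_
  have hs : Summable fun k : ℤ => Real.exp (-|(k : ℝ)|) := by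
    refine Summable.of_nat_of_neg ?_ ?_
    · simpa using Real.summable_exp_neg_nat
    · simpa using Real.summable_exp_neg_nat
  refine Integrable.hasFiniteIntegral ?_
  rw [integrable_count_iff]
  exact hs.norm

theorem sum_abs_le {d : ℕ} (x : E d) : ∑ i, |x i| ≤ √d * ‖x‖ := by
  have h := sq_sum_le_card_mul_sum_sq (s := Finset.univ) (f := fun i => |x i|)
  simp only [sq_abs, Finset.card_univ, Fintype.card_fin] at h
  rw [← EuclideanSpace.real_norm_sq_eq] at h
  refine le_of_sq_le_sq ?_ (by positivity)
  rw [mul_pow, Real.sq_sqrt (by positivity)]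
  exact h

/-- Integrating weight over probability cancels the probability cell by cell and leaves at most the
total weight, whatever μ is. So cells much less likely than their prescribed weight are seldom
visited. -/
theorem lintegral_cell_ratio_le {d : ℕ} (μ : Measure (E d)) [IsFiniteMeasure μ] (r : ℝ) :
    ∫⁻ x, Measure.pi (fun _ : Fin d => expWeight) {cell r x} / μ {y | cell r y = cell r x} ∂μ ≤
      expWeight univ ^ d := by
  have hκ : ∀ i, μ.map (cell r) {i} = μ {y | cell r y = i} := fun i =>
    Measure.map_apply (measurable_cell r) (measurableSet_singleton i)
  simp_rw [← hκ]
  rw [← lintegral_map (μ := μ) (f := fun i => Measure.pi (fun _ : Fin d => expWeight) {i} /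
    μ.map (cell r) {i}) (measurable_of_countable _) (measurable_cell r), lintegral_countable']
  calc ∑' i, Measure.pi (fun _ : Fin d => expWeight) {i} / μ.map (cell r) {i} * μ.map (cell r) {i}
      ≤ ∑' i, Measure.pi (fun _ : Fin d => expWeight) {i} :=
        ENNReal.tsum_le_tsum fun i => by
          rw [mul_comm]
          exact ENNReal.mul_div_le
    _ = ∫⁻ _, 1 ∂Measure.pi (fun _ : Fin d => expWeight) := by
        rw [lintegral_countable']; simp
    _ = expWeight univ ^ d := by simp [Measure.pi_univ]

/-- The probability of a neighbourhood of a random point is at least exponentially small, with an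
error that is uniformly integrable. -/
theorem exists_measure_near_ge {r η : ℝ} (hr : 0 < r) (hη : 0 < η) :
    ∃ K, ∀ d : ℕ, d ≠ 0 → ∀ μ : Measure (E d), IsProbabilityMeasure μ →
      ∃ T : E d → ENNReal, Measurable T ∧ ∫⁻ x, T x ∂μ ≤ (d : ENNReal)⁻¹ ∧
        ∀ᵐ x ∂μ, Real.exp (-(d * (K + η * (‖x‖ ^ 2 / d) + (T x).toReal))) ≤
          μ.real {y | ‖x - y‖ ^ 2 / d ≤ r ^ 2} := by
  set S := expWeight univ with hS
  have hStop : S ≠ ⊤ := measure_ne_top _ _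
  have hS0 : S ≠ 0 := by
    have h1 : expWeight {0} ≤ S := measure_mono (subset_univ _)
    rw [expWeight_singleton] at h1
    exact (lt_of_lt_of_le (by simp) h1).ne'
  have hSpos : 0 < S.toReal := ENNReal.toReal_pos hS0 hStop
  -- The logarithm comes from the total weight S^d, the 1 from rounding the coordinates, and the
  -- last term from √d‖x‖/r ≤ d/(4ηr²) + η‖x‖².
  refine ⟨Real.log S.toReal + 1 + 1 / (4 * η * r ^ 2), fun d hd μ hμ => ?_⟩
  have hdpos : (0 : ℝ) < d := by positivity
  set κ : (Fin d → ℤ) → ENNReal := fun i => μ {y | cell r y = i} with hκ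
  set ν : (Fin d → ℤ) → ENNReal := fun i => Measure.pi (fun _ : Fin d => expWeight) {i} with hν
  set R : E d → ENNReal := fun x => ν (cell r x) / κ (cell r x) with hR
  have hRm : Measurable R := (measurable_of_countable (fun i => ν i / κ i)).comp (measurable_cell r)
  have hRi : ∫⁻ x, R x ∂μ ≤ S ^ d := lintegral_cell_ratio_le μ r
  have hSd : S ^ d ≠ 0 := pow_ne_zero _ hS0
  have hSd' : S ^ d ≠ ⊤ := ENNReal.pow_ne_top hStop
  have hd0 : (d : ENNReal) ≠ 0 := by exact_mod_cast hd
  have hRfin : ∀ᵐ x ∂μ, R x < ⊤ := ae_lt_top hRm (hRi.trans_lt hSd'.lt_top).ne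
  -- The ratio R has mean at most S^d. Applying log u ≤ u to u = R/S^d gives log R ≤ d log S + dT
  -- with this T, whose mean is at most 1/d.
  refine ⟨fun x => (d : ENNReal)⁻¹ * (S ^ d)⁻¹ * R x, hRm.const_mul _, ?_, ?_⟩
  · rw [lintegral_const_mul _ hRm]
    calc (d : ENNReal)⁻¹ * (S ^ d)⁻¹ * ∫⁻ x, R x ∂μ ≤ (d : ENNReal)⁻¹ * (S ^ d)⁻¹ * S ^ d := by
          gcongr
      _ = (d : ENNReal)⁻¹ := by rw [mul_assoc, ENNReal.inv_mul_cancel hSd hSd', mul_one]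
  · filter_upwards [hRfin] with x hx
    set q := cell r x with hq
    have hνreal : ν q = ENNReal.ofReal (Real.exp (-∑ i, |(q i : ℝ)|)) := by
      simp only [hν, Measure.pi_singleton, expWeight_singleton]
      rw [← ENNReal.ofReal_prod_of_nonneg fun i _ => (Real.exp_pos _).le, ← Real.exp_sum,
        Finset.sum_neg_distrib]
    have hν0 : ν q ≠ 0 := by
      rw [hνreal]
      simp [Real.exp_pos]
    have hκ0 : κ q ≠ 0 := by
      intro h0
      simp only [hR, ← hq, h0, ENNReal.div_zero hν0] at hx
      exact lt_irrefl _ hx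
    have hκtop : κ q ≠ ⊤ := measure_ne_top _ _
    have hκpos : 0 < (κ q).toReal := ENNReal.toReal_pos hκ0 hκtop
    have hRr : (R x).toReal = Real.exp (-∑ i, |(q i : ℝ)|) / (κ q).toReal := by
      simp only [hR, ← hq]
      rw [ENNReal.toReal_div, hνreal, ENNReal.toReal_ofReal (Real.exp_pos _).le]
    have hlog : Real.log ((R x).toReal / S.toReal ^ d) ≤ (R x).toReal / S.toReal ^ d := by
      have h0 : 0 ≤ (R x).toReal / S.toReal ^ d := by positivity
      have := Real.log_le_self h0
      exact this
    have hRpos : 0 < (R x).toReal := by rw [hRr]; positivity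
    rw [Real.log_div hRpos.ne' (by positivity), Real.log_pow, hRr,
      Real.log_div (Real.exp_pos _).ne' hκpos.ne', Real.log_exp, ← hRr] at hlog
    have hsum : ∑ i, |(q i : ℝ)| ≤ d * (1 + 1 / (4 * η * r ^ 2) + η * (‖x‖ ^ 2 / d)) := by
      calc ∑ i, |(q i : ℝ)| ≤ ∑ i, (|x i| / r + 1) := by
            refine Finset.sum_le_sum fun i _ => ?_
            have h1 : |(q i : ℝ) - x i / r| ≤ 1 := by
              have h2 := Int.floor_le (x i / r)
              have h3 := Int.lt_floor_add_one (x i / r)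
              rw [abs_le]
              constructor
              · have : (q i : ℝ) = ⌊x i / r⌋ := rfl
                linarith
              · have : (q i : ℝ) = ⌊x i / r⌋ := rfl
                linarith
            have h2 : |x i / r| = |x i| / r := by rw [abs_div, abs_of_pos hr]
            have h3 := abs_sub_abs_le_abs_sub (q i : ℝ) (x i / r)
            linarith
        _ = (∑ i, |x i|) / r + d := by
            rw [Finset.sum_add_distrib, Finset.sum_div]; simp
        _ ≤ √d * ‖x‖ / r + d := by gcongr; exact sum_abs_le x
        _ ≤ d * (1 + 1 / (4 * η * r ^ 2) + η * (‖x‖ ^ 2 / d)) := by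
            have h1 : √d * ‖x‖ / r ≤ d * (1 / (4 * η * r ^ 2)) + η * ‖x‖ ^ 2 := by
              have h2 : 0 ≤ (√d / (2 * r) - η * ‖x‖) ^ 2 / η := by positivity
              have h3 : (√d / (2 * r) - η * ‖x‖) ^ 2 / η =
                  (√d) ^ 2 * (1 / (4 * η * r ^ 2)) + η * ‖x‖ ^ 2 - √d * ‖x‖ / r := by
                field_simp
                ring
              rw [h3, Real.sq_sqrt hdpos.le] at h2
              linarith
            have h4 : d * (1 + 1 / (4 * η * r ^ 2) + η * (‖x‖ ^ 2 / d)) =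
                d + d * (1 / (4 * η * r ^ 2)) + η * ‖x‖ ^ 2 := by
              field_simp
            linarith
    have hT : ((d : ENNReal)⁻¹ * (S ^ d)⁻¹ * R x).toReal = (R x).toReal / S.toReal ^ d / d := by
      simp only [ENNReal.toReal_mul, ENNReal.toReal_inv, ENNReal.toReal_pow, ENNReal.toReal_natCast]
      field_simp
    rw [hT]
    have hdT : d * ((R x).toReal / S.toReal ^ d / d) = (R x).toReal / S.toReal ^ d := by
      field_simp
    calc Real.exp (-(d * (Real.log S.toReal + 1 + 1 / (4 * η * r ^ 2) + η * (‖x‖ ^ 2 / d)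
          + (R x).toReal / S.toReal ^ d / d)))
        ≤ Real.exp (Real.log (κ q).toReal) := by
          rw [Real.exp_le_exp, mul_add, hdT]
          linarith
      _ = (κ q).toReal := Real.exp_log hκpos
      _ ≤ _ := by
          refine measureReal_mono (fun y hy => ?_) (measure_ne_top _ _)
          have := norm_sub_sq_le_of_cell_eq hr (x := x) (y := y) (Eq.symm hy)
          refine (div_le_iff₀ hdpos).2 ?_
          linarith

/-! ### The shape function of the model -/

/-- The exponent of the `γ`-kernel at unit bandwidth, per dimension. -/
def energy (γ : ℝ) (d : ℕ) (x y : E d) : ℝ := (‖x - y‖ ^ 2 / d) ^ γ / (2 * γ)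

theorem energy_nonneg {γ : ℝ} (hγ : 1 ≤ γ) (d : ℕ) (x y : E d) : 0 ≤ energy γ d x y := by
  have : 0 ≤ (‖x - y‖ ^ 2 / d) ^ γ := Real.rpow_nonneg (by positivity) _
  unfold energy
  positivity

theorem measurable_energy_uncurry (γ : ℝ) (d : ℕ) :
    Measurable (Function.uncurry (energy γ d)) := by
  unfold energy Function.uncurry
  fun_prop

theorem measurable_energy (γ : ℝ) (d : ℕ) (x : E d) : Measurable (energy γ d x) :=
  (measurable_energy_uncurry γ d).of_uncurry_left

theorem measure_not_mono {Ω : Type*} [MeasurableSpace Ω] {μ : Measure Ω} {p q : Ω → Prop}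
    (h : ∀ x, q x → p x) : μ {x | ¬ p x} ≤ μ {x | ¬ q x} :=
  measure_mono fun x hx hq => hx (h x hq)

section Law

variable {ρ : (d : ℕ) → E d → ℝ}

theorem IsDensityFamily.isProbabilityMeasure_law (hρ : IsDensityFamily ρ) (d : ℕ) :
    IsProbabilityMeasure (law ρ d) :=
  ⟨by rw [law, withDensity_apply _ MeasurableSet.univ, Measure.restrict_univ, hρ.total]⟩

theorem cgf_one (d : ℕ) (l : ℝ) (x : E d) :
    cgf ρ d 1 l x = scgf (law ρ d) (fun y => ‖x - y‖ ^ 2 / d) d l := by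
  simp [cgf, scgf]

theorem SecondMomentBound.exists_pos (hmom : SecondMomentBound ρ) :
    ∃ C > 0, ∀ d : ℕ, ∫⁻ x, ENNReal.ofReal (‖x‖ ^ 2) ∂(law ρ d) ≤ ENNReal.ofReal (C * d) := by
  obtain ⟨C, hC⟩ := hmom
  refine ⟨|C| + 1, by positivity, fun d => (hC d).trans (ENNReal.ofReal_le_ofReal ?_)⟩
  have := le_abs_self C
  gcongr
  linarith

theorem SecondMomentBound.lintegral_le (hmom : SecondMomentBound ρ) :
    ∃ C > 0, ∀ d : ℕ, ∫⁻ x, ENNReal.ofReal (‖x‖ ^ 2 / d) ∂(law ρ d) ≤ ENNReal.ofReal C := by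
  obtain ⟨C, hC0, hC⟩ := hmom.exists_pos
  refine ⟨C, hC0, fun d => ?_⟩
  rcases Nat.eq_zero_or_pos d with rfl | hd
  · simp
  have hd' : (0 : ℝ) < d := by exact_mod_cast hd
  simp_rw [div_eq_inv_mul, ENNReal.ofReal_mul (inv_nonneg.2 hd'.le)]
  rw [lintegral_const_mul _ (by fun_prop)]
  calc ENNReal.ofReal (d : ℝ)⁻¹ * ∫⁻ x, ENNReal.ofReal (‖x‖ ^ 2) ∂(law ρ d)
      ≤ ENNReal.ofReal (d : ℝ)⁻¹ * ENNReal.ofReal (C * d) := by gcongr; exact hC d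
    _ = ENNReal.ofReal C := by
      rw [← ENNReal.ofReal_mul (inv_nonneg.2 hd'.le)]
      congr 1
      field_simp

theorem SecondMomentBound.tail (hmom : SecondMomentBound ρ) :
    ∃ M > 0, ∀ d : ℕ, law ρ d {x | ¬ ‖x‖ ^ 2 / d ≤ M} ≤ 1 / 4 := by
  obtain ⟨C, hC0, hC⟩ := hmom.lintegral_le
  refine ⟨4 * C, by positivity, fun d => ?_⟩
  calc law ρ d {x | ¬ ‖x‖ ^ 2 / d ≤ 4 * C}
      ≤ law ρ d {x | ENNReal.ofReal (4 * C) ≤ ENNReal.ofReal (‖x‖ ^ 2 / d)} :=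
        measure_mono fun x hx => ENNReal.ofReal_le_ofReal (not_le.1 hx).le
    _ ≤ (∫⁻ x, ENNReal.ofReal (‖x‖ ^ 2 / d) ∂(law ρ d)) / ENNReal.ofReal (4 * C) :=
        meas_ge_le_lintegral_div (by fun_prop) (by simpa using hC0) ENNReal.ofReal_ne_top
    _ ≤ ENNReal.ofReal C / ENNReal.ofReal (4 * C) := by gcongr; exact hC d
    _ = 1 / 4 := by
        rw [← ENNReal.ofReal_div_of_pos (by positivity), mul_comm, ← div_div, div_self hC0.ne',
          ENNReal.ofReal_div_of_pos (by norm_num)]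
        simp

/-- Two points of a ball that carries at least 3/4 of the mass are within its diameter. The
resulting bound -(tM) on the limit functions controls them near t = 0. -/
theorem SecondMomentBound.near_half (hρ : IsDensityFamily ρ) (hmom : SecondMomentBound ρ) :
    ∃ M > 0, ∀ d : ℕ,
      law ρ d {x | ¬ 1 / 2 ≤ (law ρ d).real {y | ‖x - y‖ ^ 2 / d ≤ M}} ≤ 1 / 2 := by
  have := hρ.isProbabilityMeasure_law
  obtain ⟨M, hM0, hM⟩ := hmom.tail
  refine ⟨4 * M, by positivity, fun d => ?_⟩
  have h14 : (1 / 4 : ENNReal) ≤ 1 / 2 := by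
    rw [one_div, one_div]
    exact ENNReal.inv_le_inv.2 (by norm_num)
  refine (measure_not_mono fun x hx' => ?_).trans ((hM d).trans h14)
  have hball : {y : E d | ‖y‖ ^ 2 / d ≤ M} ⊆ {y | ‖x - y‖ ^ 2 / d ≤ 4 * M} := by
    intro y hy
    have hx'' : ‖x‖ ^ 2 / d ≤ M := hx'
    have hy'' : ‖y‖ ^ 2 / d ≤ M := hy
    have h1 : ‖x - y‖ ^ 2 ≤ 2 * ‖x‖ ^ 2 + 2 * ‖y‖ ^ 2 := by
      have := norm_sub_le x y
      have h2 : ‖x - y‖ ^ 2 ≤ (‖x‖ + ‖y‖) ^ 2 := by gcongr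
      nlinarith [sq_nonneg (‖x‖ - ‖y‖)]
    calc ‖x - y‖ ^ 2 / d ≤ (2 * ‖x‖ ^ 2 + 2 * ‖y‖ ^ 2) / d := by gcongr
      _ = 2 * (‖x‖ ^ 2 / d) + 2 * (‖y‖ ^ 2 / d) := by ring
      _ ≤ 4 * M := by linarith
  refine le_trans ?_ (measureReal_mono hball)
  have hms : MeasurableSet {y : E d | ‖y‖ ^ 2 / d ≤ M} :=
    measurableSet_le (by fun_prop) measurable_const
  have hc : (law ρ d).real {y : E d | ‖y‖ ^ 2 / d ≤ M}ᶜ ≤ 1 / 4 := by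
    have := ENNReal.toReal_mono (by simp) (hM d)
    simpa [Measure.real, compl_ofPred] using this
  have := probReal_compl_eq_one_sub (μ := law ρ d) hms
  linarith

/-- Here the radius is arbitrarily small, at the price of an exponentially small probability. This
controls the limit functions as t → ∞. -/
theorem SecondMomentBound.near (hρ : IsDensityFamily ρ) (hmom : SecondMomentBound ρ) {r : ℝ}
    (hr : 0 < r) : ∃ C, ∀ᶠ d : ℕ in atTop,
      law ρ d {x | ¬ Real.exp (-(d * C)) ≤ (law ρ d).real {y | ‖x - y‖ ^ 2 / d ≤ r ^ 2}} ≤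
        1 / 2 := by
  have := hρ.isProbabilityMeasure_law
  obtain ⟨M, hM0, hM⟩ := hmom.tail
  obtain ⟨K, hK⟩ := exists_measure_near_ge hr one_pos
  refine ⟨K + M + 1, ?_⟩
  filter_upwards [eventually_ge_atTop 4] with d hd
  obtain ⟨T, hTm, hTi, hT⟩ := hK d (by omega) (law ρ d) inferInstance
  have hT1 : law ρ d {x | 1 ≤ T x} ≤ 1 / 4 := by
    have := mul_meas_ge_le_lintegral (μ := law ρ d) hTm 1
    rw [one_mul] at this
    refine this.trans (hTi.trans ?_)
    rw [one_div]
    exact ENNReal.inv_le_inv.2 (by exact_mod_cast hd)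
  calc law ρ d {x | ¬ Real.exp (-(d * (K + M + 1))) ≤
        (law ρ d).real {y | ‖x - y‖ ^ 2 / d ≤ r ^ 2}}
      ≤ law ρ d ({x | ¬ ‖x‖ ^ 2 / d ≤ M} ∪ {x | 1 ≤ T x}) := by
        refine measure_mono_ae ?_
        filter_upwards [hT] with x hx hx'
        by_contra hno
        have hno' : ¬ (¬ ‖x‖ ^ 2 / d ≤ M ∨ 1 ≤ T x) := hno
        push Not at hno'
        refine hx' (le_trans (Real.exp_le_exp.2 (neg_le_neg ?_)) hx)
        have : (T x).toReal ≤ 1 := by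
          have := ENNReal.toReal_mono (by simp) hno'.2.le
          simpa using this
        gcongr
        linarith [hno'.1]
    _ ≤ 1 / 4 + 1 / 4 := (measure_union_le _ _).trans (add_le_add (hM d) hT1)
    _ = 1 / 2 := by
        have h4 : (1 / 4 : ENNReal) = 1 / 2 / 2 := by
          rw [one_div, one_div, div_eq_mul_inv, ← ENNReal.mul_inv (by simp) (by simp)]
          norm_num
        rw [h4]
        exact ENNReal.add_halves _

/-- The limit of the scaled cumulant generating functions of the kernel exponent. -/
theorem exists_shape (hρ : IsDensityFamily ρ) (hmom : SecondMomentBound ρ) (hpure : IsPure ρ)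
    (hwell : WellBehavedCgf ρ) {γ : ℝ} (hγ : 1 ≤ γ) :
    ∃ G : ℝ → ℝ, DifferentiableOn ℝ G (Ioi 0) ∧ ScgfTendsto (law ρ) (law ρ) (energy γ) G ∧
      AntitoneOn G (Ioi 0) ∧ (∃ M, ∀ t > 0, -(t * M) ≤ G t) ∧
      ∀ ε > 0, ∃ C, ∀ t > 0, -(ε * t) - C ≤ G t := by
  have := hρ.isProbabilityMeasure_law
  -- Bandwidth one suffices, because h merely rescales the argument of the generating function.
  obtain ⟨F, hF, hdF⟩ := hwell 1 one_pos
  have hsm : ∀ (d : ℕ) (x : E d), Measurable fun y : E d => ‖x - y‖ ^ 2 / d := by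
    intro d x
    fun_prop
  have hs0 : ∀ (d : ℕ) (x y : E d), 0 ≤ ‖x - y‖ ^ 2 / d := fun d x y => by positivity
  have hlimF : ScgfTendsto (law ρ) (law ρ) (fun d x y => ‖x - y‖ ^ 2 / d) F := by
    intro l hl ε hε
    have h1 : Whp (law ρ) fun d x => |cgf ρ d 1 l x - cgfMean ρ d 1 l| < ε / 2 := by
      have := hpure 1 one_pos l hl (ε / 2) (half_pos hε)
      simpa only [Whp, not_lt] using this
    refine h1.mono ?_
    filter_upwards [Metric.tendsto_nhds.1 (hF l hl) (ε / 2) (half_pos hε)] with d hd x hx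
    rw [Real.dist_eq] at hd
    rw [← cgf_one]
    have := abs_sub_le (cgf ρ d 1 l x) (cgfMean ρ d 1 l) (F l)
    linarith
  obtain ⟨M, hM0, hM⟩ := hmom.near_half hρ
  have hFM : ∀ t > 0, -(t * M) ≤ F t := fun t ht =>
    hlimF.ge_of_half hsm hs0 (Eventually.of_forall hM) ht
  obtain ⟨G, hdG, hG⟩ := hlimF.rpow hsm hs0 hdF hγ hFM
  have hG' : ScgfTendsto (law ρ) (law ρ) (energy γ) G := hG
  have hm := fun d x => measurable_energy γ d x
  have h0 := energy_nonneg hγ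
  have hmono : ∀ (d : ℕ) (x : E d) (M : ℝ), 0 ≤ M →
      (law ρ d).real {y | ‖x - y‖ ^ 2 / d ≤ M} ≤
        (law ρ d).real {y | energy γ d x y ≤ M ^ γ / (2 * γ)} := by
    intro d x M hM
    refine measureReal_mono fun y hy => ?_
    have hy' : ‖x - y‖ ^ 2 / d ≤ M := hy
    show (‖x - y‖ ^ 2 / d) ^ γ / (2 * γ) ≤ M ^ γ / (2 * γ)
    gcongr
  refine ⟨G, hdG, hG', hG'.antitoneOn hm h0, ⟨M ^ γ / (2 * γ), fun t ht => ?_⟩, fun ε hε => ?_⟩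
  · refine hG'.ge_of_half hm h0 (Eventually.of_forall fun d => ?_) ht
    refine (measure_not_mono fun x hx' => ?_).trans (hM d)
    exact hx'.trans (hmono d x M hM0.le)
  -- Chosen so that |x - y|²/d ≤ r² forces energy at most ε/(2γ) ≤ ε.
  · set r := ε ^ (1 / (2 * γ)) with hr
    have hr0 : 0 < r := by positivity
    have hrε : (r ^ 2) ^ γ = ε := by
      rw [hr, ← Real.rpow_natCast, ← Real.rpow_mul hε.le, ← Real.rpow_mul hε.le]
      have : 1 / (2 * γ) * ((2 : ℕ) : ℝ) * γ = 1 := by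
        push_cast
        field_simp
      rw [this, Real.rpow_one]
    obtain ⟨C, hC⟩ := hmom.near hρ hr0
    refine ⟨C, fun t ht => ?_⟩
    have h1 : -(t * ((r ^ 2) ^ γ / (2 * γ))) - C ≤ G t := by
      refine hG'.ge hm h0 ?_ ht
      filter_upwards [hC] with d hd
      refine (measure_not_mono fun x hx' => ?_).trans hd
      exact hx'.trans (hmono d x (r ^ 2) (by positivity))
    rw [hrε] at h1
    have h2 : t * (ε / (2 * γ)) ≤ ε * t := by
      have : ε / (2 * γ) ≤ ε := div_le_self hε.le (by linarith)
      nlinarith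
    linarith

theorem measurable_scgf (hρ : IsDensityFamily ρ) (γ : ℝ) (d : ℕ) (t : ℝ) :
    Measurable fun x => scgf (law ρ d) (energy γ d x) d t := by
  have := hρ.isProbabilityMeasure_law
  have h1 : StronglyMeasurable (Function.uncurry fun x y : E d =>
      Real.exp (-((d : ℝ) * t * energy γ d x y))) := by
    refine Measurable.stronglyMeasurable ?_
    have := measurable_energy_uncurry γ d
    unfold Function.uncurry at this ⊢
    fun_prop
  have := (h1.integral_prod_right (ν := law ρ d)).measurable
  unfold scgf
  fun_prop

/-- Uniform integrability of the scaled cumulant generating functions. -/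
theorem exists_abs_scgf_le {γ : ℝ} (hγ : 1 ≤ γ) {t : ℝ} (ht : 0 < t) {η : ℝ}
    (hη : 0 < η) : ∃ K, ∀ d : ℕ, d ≠ 0 → ∀ μ : Measure (E d), IsProbabilityMeasure μ →
      ∃ T : E d → ENNReal, Measurable T ∧ ∫⁻ x, T x ∂μ ≤ (d : ENNReal)⁻¹ ∧
        ∀ᵐ x ∂μ, |scgf μ (energy γ d x) d t| ≤ K + η * (‖x‖ ^ 2 / d) + (T x).toReal := by
  obtain ⟨K, hK⟩ := exists_measure_near_ge one_pos hη
  refine ⟨t * (1 / (2 * γ)) + K, fun d hd μ hμ => ?_⟩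
  obtain ⟨T, hTm, hTi, hT⟩ := hK d hd μ hμ
  refine ⟨T, hTm, hTi, ?_⟩
  filter_upwards [hT] with x hx
  have hm := measurable_energy γ d x
  have h0 := energy_nonneg hγ d x
  rw [abs_of_nonpos (scgf_nonpos hm h0 ht.le)]
  suffices -(t * (1 / (2 * γ)) + K + η * (‖x‖ ^ 2 / d) + (T x).toReal) ≤
    scgf μ (energy γ d x) d t by linarith
  refine le_scgf_of_le hm h0 ht.le hd (le_trans ?_ (le_integral_exp_neg_of_le hm h0 ht.le
    (b := 1 / (2 * γ)) (s := {y | ‖x - y‖ ^ 2 / d ≤ 1 ^ 2})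
    (measurableSet_le (by fun_prop) measurable_const) fun y hy => ?_))
  · refine le_trans (le_of_eq ?_) (mul_le_mul_of_nonneg_left hx (Real.exp_pos _).le)
    rw [← Real.exp_add]
    congr 1
    ring
  · have hy' : ‖x - y‖ ^ 2 / d ≤ 1 := by simpa using hy
    have : (‖x - y‖ ^ 2 / d) ^ γ ≤ 1 := Real.rpow_le_one (by positivity) hy' (by linarith)
    unfold energy
    gcongr

theorem integrable_scgf (hρ : IsDensityFamily ρ) (hmom : SecondMomentBound ρ) {γ : ℝ}
    (hγ : 1 ≤ γ) {t : ℝ} (ht : 0 < t) {d : ℕ} (hd : d ≠ 0) :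
    Integrable (fun x => scgf (law ρ d) (energy γ d x) d t) (law ρ d) := by
  have := hρ.isProbabilityMeasure_law
  obtain ⟨C, -, hC⟩ := hmom.lintegral_le
  obtain ⟨K, hK⟩ := exists_abs_scgf_le hγ ht one_pos
  obtain ⟨T, hTm, hTi, hT⟩ := hK d hd (law ρ d) inferInstance
  exact integrable_of_le (V := fun x => ‖x‖ ^ 2 / d)
    (measurable_scgf hρ γ d t).aestronglyMeasurable (by fun_prop) (fun x => by positivity)
    ((hC d).trans_lt ENNReal.ofReal_lt_top).ne hTm
    (hTi.trans_lt (ENNReal.inv_lt_top.2 (by positivity))).ne hT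

/-- Convergence in probability is upgraded to convergence of means by the domination of
`exists_abs_scgf_le`, in which the coefficient of ‖x‖²/d is arbitrarily small. -/
theorem tendsto_integral_scgf (hρ : IsDensityFamily ρ) (hmom : SecondMomentBound ρ) {γ : ℝ}
    (hγ : 1 ≤ γ) {G : ℝ → ℝ} (hG : ScgfTendsto (law ρ) (law ρ) (energy γ) G) {t : ℝ}
    (ht : 0 < t) :
    Tendsto (fun d => ∫ x, scgf (law ρ d) (energy γ d x) d t ∂(law ρ d)) atTop (𝓝 (G t)) := by
  have := hρ.isProbabilityMeasure_law
  obtain ⟨C, -, hC⟩ := hmom.lintegral_le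
  -- Zero is used for η ≤ 0 and for d = 0, so that the choice yields a T that is measurable for all
  -- η and d.
  have hex : ∀ η : ℝ, ∃ K, ∃ T : ∀ d : ℕ, E d → ENNReal, (∀ d, Measurable (T d)) ∧
      (∀ d, d ≠ 0 → ∫⁻ x, T d x ∂(law ρ d) ≤ (d : ENNReal)⁻¹) ∧ (0 < η → ∀ d, d ≠ 0 →
        ∀ᵐ x ∂(law ρ d), |scgf (law ρ d) (energy γ d x) d t| ≤
          K + η * (‖x‖ ^ 2 / d) + (T d x).toReal) := by
    intro η
    by_cases hη : 0 < η
    · obtain ⟨K, hK⟩ := exists_abs_scgf_le hγ ht hη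
      have : ∀ d : ℕ, ∃ T : E d → ENNReal, Measurable T ∧
          (d ≠ 0 → ∫⁻ x, T x ∂(law ρ d) ≤ (d : ENNReal)⁻¹) ∧ (d ≠ 0 →
          ∀ᵐ x ∂(law ρ d), |scgf (law ρ d) (energy γ d x) d t| ≤
            K + η * (‖x‖ ^ 2 / d) + (T x).toReal) := by
        intro d
        by_cases hd : d = 0
        · exact ⟨0, measurable_zero, fun h => absurd hd h, fun h => absurd hd h⟩
        · obtain ⟨T, hTm, hTi, hT⟩ := hK d hd (law ρ d) inferInstance
          exact ⟨T, hTm, fun _ => hTi, fun _ => hT⟩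
      choose T hTm hTi hT using this
      exact ⟨K, T, hTm, hTi, fun _ => hT⟩
    · exact ⟨0, 0, fun d => measurable_zero, fun d _ => by simp, fun h => absurd h hη⟩
  choose K T hTm hTi hT using hex
  refine tendsto_integral_of_whp (V := fun d x => ‖x‖ ^ 2 / d) (T := T) (C := C) ?_
    (fun d => by fun_prop) (fun d x => by positivity) (Eventually.of_forall hC) hTm
    (fun η _ => ?_) (fun η hη => ⟨K η, ?_⟩) (hG t ht)
  · filter_upwards [eventually_ne_atTop 0] with d hd
    exact integrable_scgf hρ hmom hγ ht hd
  · refine tendsto_of_tendsto_of_tendsto_of_le_of_le' tendsto_const_nhds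
      ENNReal.tendsto_inv_nat_nhds_zero (Eventually.of_forall fun _ => bot_le) ?_
    filter_upwards [eventually_ne_atTop 0] with d hd
    exact hTi η d hd
  · filter_upwards [eventually_ne_atTop 0] with d hd
    exact hT η hη d hd

/-! ### The replica functions in terms of the shape function -/

theorem gammaKernel_smul (γ : ℝ) {d : ℕ} {h : ℝ} (hh : 0 < h) (x y : E d) :
    gammaKernel γ d (h⁻¹ • (x - y)) =
      Real.exp (d * (cNorm γ d - h ^ (-(2 * γ)) * energy γ d x y)) := by
  unfold gammaKernel energy
  have h1 : ‖h⁻¹ • (x - y)‖ ^ 2 / d = (h ^ 2)⁻¹ * (‖x - y‖ ^ 2 / d) := by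
    rw [norm_smul, mul_pow, norm_inv, Real.norm_eq_abs, abs_of_pos hh]
    field_simp
  have h2 : ((h ^ 2)⁻¹) ^ γ = h ^ (-(2 * γ)) := by
    rw [Real.inv_rpow (by positivity), ← Real.rpow_natCast, ← Real.rpow_mul hh.le,
      Real.rpow_neg hh.le]
    norm_num
  rw [h1, Real.mul_rpow (by positivity) (by positivity), h2]
  congr 1
  ring

theorem integral_gammaKernel_rpow {γ : ℝ} {d : ℕ} {h : ℝ} (hh : 0 < h)
    (m : ℝ) (x : E d) :
    ∫ y, gammaKernel γ d (h⁻¹ • (x - y)) ^ m ∂(law ρ d) = Real.exp (d * (m * cNorm γ d)) *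
      ∫ y, Real.exp (-((d : ℝ) * (m * h ^ (-(2 * γ))) * energy γ d x y)) ∂(law ρ d) := by
  rw [← integral_const_mul]
  congr 1
  ext y
  rw [gammaKernel_smul γ hh, ← Real.exp_mul, ← Real.exp_add]
  congr 1
  ring

/-- Homogeneity of the kernel exponent merges h and m into the single argument m h^(-2γ) of a
generating function free of h; the remaining part is not random. -/
theorem g_eq (hρ : IsDensityFamily ρ) {γ : ℝ} (hγ : 1 ≤ γ) {d : ℕ} (hd : d ≠ 0) {h m : ℝ}
    (hh : 0 < h) (hm : 0 < m) (x : E d) :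
    g ρ γ d h m x = m * (cNorm γ d - Real.log h) +
      scgf (law ρ d) (energy γ d x) d (m * h ^ (-(2 * γ))) := by
  have := hρ.isProbabilityMeasure_law
  have ht : 0 < m * h ^ (-(2 * γ)) := by positivity
  rw [g, integral_gammaKernel_rpow hh, Real.log_mul (Real.exp_pos _).ne'
    (integral_exp_neg_pos (measurable_energy γ d x) (energy_nonneg hγ d x) ht.le).ne', Real.log_exp,
    scgf]
  field_simp
  ring

theorem integrable_g (hρ : IsDensityFamily ρ) (hmom : SecondMomentBound ρ) {γ : ℝ} (hγ : 1 ≤ γ)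
    {h m : ℝ} (hh : 0 < h) (hm : 0 < m) (d : ℕ) : Integrable (g ρ γ d h m) (law ρ d) := by
  have := hρ.isProbabilityMeasure_law
  by_cases hd : d = 0
  · subst hd
    have h1 : g ρ γ 0 h m = fun _ => -(m * Real.log h) := by
      ext x
      simp [g]
    rw [h1]
    exact integrable_const _
  · have h1 : g ρ γ d h m = fun x => m * (cNorm γ d - Real.log h) +
        scgf (law ρ d) (energy γ d x) d (m * h ^ (-(2 * γ))) :=
      funext fun x => g_eq hρ hγ hd hh hm x
    rw [h1]
    exact (integrable_const _).add (integrable_scgf hρ hmom hγ (by positivity) hd)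

theorem tendsto_gMean (hρ : IsDensityFamily ρ) (hmom : SecondMomentBound ρ) {γ : ℝ} (hγ : 1 ≤ γ)
    {G : ℝ → ℝ} (hG : ScgfTendsto (law ρ) (law ρ) (energy γ) G) {c : ℝ}
    (hc : Tendsto (cNorm γ) atTop (𝓝 c)) {h m : ℝ} (hh : 0 < h) (hm : 0 < m) :
    Tendsto (fun d => gMean ρ γ d h m) atTop
      (𝓝 (m * (c - Real.log h) + G (m * h ^ (-(2 * γ))))) := by
  have := hρ.isProbabilityMeasure_law
  have ht : 0 < m * h ^ (-(2 * γ)) := by positivity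
  refine (((hc.sub_const (Real.log h)).const_mul m).add
    (tendsto_integral_scgf hρ hmom hγ hG ht)).congr' ?_
  filter_upwards [eventually_ne_atTop 0] with d hd
  unfold gMean
  simp_rw [g_eq hρ hγ hd hh hm]
  rw [integral_add (integrable_const _) (integrable_scgf hρ hmom hγ ht hd)]
  simp

theorem whp_g (hρ : IsDensityFamily ρ) {γ : ℝ} (hγ : 1 ≤ γ)
    {G : ℝ → ℝ} (hG : ScgfTendsto (law ρ) (law ρ) (energy γ) G) {c : ℝ}
    (hc : Tendsto (cNorm γ) atTop (𝓝 c)) {h m : ℝ} (hh : 0 < h) (hm : 0 < m) {ε : ℝ}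
    (hε : 0 < ε) :
    Whp (law ρ) fun d x =>
      |g ρ γ d h m x - (m * (c - Real.log h) + G (m * h ^ (-(2 * γ))))| < ε := by
  refine (hG (m * h ^ (-(2 * γ))) (by positivity) (ε / 2) (half_pos hε)).mono ?_
  filter_upwards [eventually_ne_atTop 0,
    Metric.tendsto_nhds.1 ((hc.sub_const (Real.log h)).const_mul m) (ε / 2) (half_pos hε)]
    with d hd hcd x hx
  rw [g_eq hρ hγ hd hh hm]
  rw [Real.dist_eq] at hcd
  have := abs_add_le (m * (cNorm γ d - Real.log h) - m * (c - Real.log h))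
    (scgf (law ρ d) (energy γ d x) d (m * h ^ (-(2 * γ))) - G (m * h ^ (-(2 * γ))))
  refine lt_of_le_of_lt (le_of_eq ?_) (this.trans_lt (by linarith))
  congr 1
  ring

end Law

/-! ### The normalization of the kernel -/

theorem tendsto_log_div_self : Tendsto (fun x : ℝ => Real.log x / x) atTop (𝓝 0) := by
  simpa using Real.tendsto_pow_log_div_mul_add_atTop 1 0 1 one_ne_zero

theorem tendsto_log_factorial_div :
    Tendsto (fun n : ℕ => Real.log n.factorial / n - Real.log n) atTop (𝓝 (-1)) := by
  have h1 : Tendsto (fun n : ℕ => Real.log (Stirling.stirlingSeq n)) atTop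
      (𝓝 (Real.log √Real.pi)) :=
    Stirling.tendsto_stirlingSeq_sqrt_pi.log (by positivity)
  have h2 := h1.div_atTop (tendsto_natCast_atTop_atTop (R := ℝ))
  have h3 : Tendsto (fun n : ℕ => Real.log (2 * n) / n) atTop (𝓝 0) := by
    have h := (tendsto_log_div_self.comp ((tendsto_natCast_atTop_atTop (R := ℝ)).const_mul_atTop
      (show (0 : ℝ) < 2 by norm_num))).const_mul 2
    rw [mul_zero] at h
    refine h.congr fun n => ?_
    simp only [Function.comp_apply]
    field_simp
  have h4 := (h2.add (h3.const_mul (1 / 2))).sub_const 1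
  rw [mul_zero, add_zero, zero_sub] at h4
  refine h4.congr' ?_
  filter_upwards [eventually_ne_atTop 0] with n hn
  have hn' : (n : ℝ) ≠ 0 := by exact_mod_cast hn
  have h5 := Stirling.log_stirlingSeq_formula n
  rw [h5, Real.log_div hn' (Real.exp_pos 1).ne', Real.log_exp]
  field_simp
  ring

/-- Stirling's formula for the Gamma function, to leading exponential order. -/
theorem tendsto_log_Gamma_div :
    Tendsto (fun x : ℝ => Real.log (Real.Gamma (x + 1)) / x - Real.log x) atTop (𝓝 (-1)) := by
  have hfl : Tendsto (fun x : ℝ => ((⌊x⌋₊ : ℕ) : ℝ) / x) atTop (𝓝 1) := tendsto_nat_floor_div_atTop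
  have h1 := hfl.mul (tendsto_log_factorial_div.comp (tendsto_nat_floor_atTop (α := ℝ)))
  have h2 := hfl.mul (hfl.log one_ne_zero)
  have h3 : Tendsto (fun x : ℝ => (1 - (⌊x⌋₊ : ℝ) / x) * Real.log x) atTop (𝓝 0) := by
    refine tendsto_of_tendsto_of_tendsto_of_le_of_le' tendsto_const_nhds tendsto_log_div_self ?_ ?_
    · filter_upwards [eventually_ge_atTop 1] with x hx
      have : (⌊x⌋₊ : ℝ) ≤ x := Nat.floor_le (by linarith)
      have : (⌊x⌋₊ : ℝ) / x ≤ 1 := div_le_one_of_le₀ this (by linarith)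
      exact mul_nonneg (by linarith) (Real.log_nonneg hx)
    · filter_upwards [eventually_ge_atTop 1] with x hx
      have hx0 : 0 < x := by linarith
      have h := Nat.lt_floor_add_one x
      have h' : 1 - (⌊x⌋₊ : ℝ) / x ≤ 1 / x := by
        rw [sub_le_iff_le_add, ← add_div, le_div_iff₀ hx0]
        linarith
      calc (1 - (⌊x⌋₊ : ℝ) / x) * Real.log x ≤ 1 / x * Real.log x := by
            gcongr
            exact Real.log_nonneg hx
        _ = Real.log x / x := by ring
  -- With n = ⌊x⌋₊ this is (n/x)(log n!/n - log n) + (n/x) log(n/x) - (1 - n/x) log x.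
  have hlow : Tendsto (fun x : ℝ => Real.log (⌊x⌋₊.factorial) / x - Real.log x) atTop
      (𝓝 (-1)) := by
    have h := (h1.add h2).sub h3
    simp only [Real.log_one, mul_zero, sub_zero, one_mul, add_zero] at h
    refine h.congr' ?_
    filter_upwards [eventually_ge_atTop 1] with x hx
    have hx0 : 0 < x := by linarith
    have hn : 0 < ⌊x⌋₊ := Nat.floor_pos.2 hx
    have hn' : (0 : ℝ) < (⌊x⌋₊ : ℝ) := by exact_mod_cast hn
    simp only [Function.comp_apply]
    rw [Real.log_div hn'.ne' hx0.ne']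
    field_simp
    ring
  -- The added term is log(x + 1)/x; it absorbs the factor n + 1 of (n + 1)!.
  have hup : Tendsto (fun x : ℝ => (Real.log (⌊x⌋₊.factorial) / x - Real.log x)
      + (1 + 1 / x) * (Real.log (x + 1) / (x + 1))) atTop (𝓝 (-1)) := by
    have h4 := tendsto_log_div_self.comp (tendsto_atTop_add_const_right atTop (1 : ℝ) tendsto_id)
    have h5 : Tendsto (fun x : ℝ => 1 + 1 / x) atTop (𝓝 (1 + 0)) :=
      tendsto_const_nhds.add (tendsto_const_nhds.div_atTop tendsto_id)
    have h := hlow.add (h5.mul h4)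
    rw [mul_zero, add_zero] at h
    exact h
  refine tendsto_of_tendsto_of_tendsto_of_le_of_le' hlow hup ?_ ?_
  · filter_upwards [eventually_ge_atTop 1] with x hx
    have hx0 : 0 < x := by linarith
    have hn : (1 : ℝ) ≤ (⌊x⌋₊ : ℝ) := by exact_mod_cast Nat.floor_pos.2 hx
    have hmono : Real.Gamma ((⌊x⌋₊ : ℝ) + 1) ≤ Real.Gamma (x + 1) := by
      refine Real.Gamma_strictMonoOn_Ici.monotoneOn ?_ ?_ ?_
      · rw [mem_Ici]; linarith
      · rw [mem_Ici]; linarith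
      · have := Nat.floor_le hx0.le
        linarith
    rw [Real.Gamma_nat_eq_factorial] at hmono
    have hf : (0 : ℝ) < (⌊x⌋₊.factorial : ℝ) := by positivity
    have := Real.log_le_log hf hmono
    gcongr
  · filter_upwards [eventually_ge_atTop 1] with x hx
    have hx0 : 0 < x := by linarith
    have hmono : Real.Gamma (x + 1) ≤ Real.Gamma (((⌊x⌋₊ + 1 : ℕ) : ℝ) + 1) := by
      refine Real.Gamma_strictMonoOn_Ici.monotoneOn ?_ ?_ ?_
      · rw [mem_Ici]; linarith
      · rw [mem_Ici]
        push_cast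
        have := Nat.lt_floor_add_one x
        linarith
      · push_cast
        have := Nat.lt_floor_add_one x
        linarith
    rw [Real.Gamma_nat_eq_factorial, Nat.factorial_succ, Nat.cast_mul] at hmono
    have h6 := Real.log_le_log (Real.Gamma_pos_of_pos (by linarith)) hmono
    have hf : (⌊x⌋₊.factorial : ℝ) ≠ 0 := by positivity
    rw [Real.log_mul (by positivity) hf] at h6
    have h7 : Real.log ((⌊x⌋₊ + 1 : ℕ) : ℝ) ≤ Real.log (x + 1) := by
      refine Real.log_le_log (by positivity) ?_
      push_cast
      have := Nat.floor_le hx0.le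
      linarith
    have h8 : (1 + 1 / x) * (Real.log (x + 1) / (x + 1)) = Real.log (x + 1) / x := by
      field_simp
    rw [h8]
    have h9 : Real.log (Real.Gamma (x + 1)) / x ≤
        (Real.log (x + 1) + Real.log (⌊x⌋₊.factorial)) / x := by
      gcongr
      linarith
    rw [add_div] at h9
    linarith

/-- Polar coordinates: the volume of the unit ball times a one-dimensional Gamma integral in the
radius. -/
theorem integral_kernel_base {γ : ℝ} (hγ : 1 ≤ γ) {d : ℕ} (hd : d ≠ 0) :
    ∫ x : E d, Real.exp (-((d : ℝ) * (1 / (2 * γ) * (‖x‖ ^ 2 / d) ^ γ))) =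
      √Real.pi ^ d * (Real.Gamma (d / (2 * γ) + 1) / Real.Gamma (d / 2 + 1)) *
        ((d : ℝ) ^ (1 - γ) / (2 * γ)) ^ (-(d / (2 * γ))) := by
  have hdpos : (0 : ℝ) < d := by positivity
  have : Nonempty (Fin d) := ⟨⟨0, Nat.pos_of_ne_zero hd⟩⟩
  have hnt : Nontrivial (E d) := by
    refine Module.nontrivial_of_finrank_pos (R := ℝ) ?_
    rw [finrank_euclideanSpace_fin]
    exact Nat.pos_of_ne_zero hd
  have h1 := integral_fun_norm_addHaar (E := E d) volume
    (fun r => Real.exp (-((d : ℝ) * (1 / (2 * γ) * (r ^ 2 / d) ^ γ))))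
  simp only [smul_eq_mul, finrank_euclideanSpace_fin, nsmul_eq_mul] at h1
  rw [h1]
  have hb : 0 < (d : ℝ) ^ (1 - γ) / (2 * γ) := by positivity
  have h2 : ∫ r in Ioi (0 : ℝ), r ^ (d - 1) *
      Real.exp (-((d : ℝ) * (1 / (2 * γ) * (r ^ 2 / d) ^ γ))) =
      ∫ r in Ioi (0 : ℝ), r ^ ((d : ℝ) - 1) *
        Real.exp (-((d : ℝ) ^ (1 - γ) / (2 * γ)) * r ^ (2 * γ)) := by
    refine setIntegral_congr_fun measurableSet_Ioi fun r hr => ?_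
    have hr0 : 0 < r := hr
    have e1 : r ^ (d - 1) = r ^ ((d : ℝ) - 1) := by
      rw [← Real.rpow_natCast, Nat.cast_sub (Nat.one_le_iff_ne_zero.2 hd), Nat.cast_one]
    have e2 : (r ^ 2 / d) ^ γ = r ^ (2 * γ) / (d : ℝ) ^ γ := by
      rw [Real.div_rpow (by positivity) hdpos.le, ← Real.rpow_natCast, ← Real.rpow_mul hr0.le]
      norm_num
    rw [e1, e2, Real.rpow_sub hdpos, Real.rpow_one]
    congr 2
    field_simp
  rw [h2, integral_rpow_mul_exp_neg_mul_rpow (by linarith) (by linarith) hb, Measure.real,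
    EuclideanSpace.volume_ball]
  simp only [ENNReal.ofReal_one, one_pow, one_mul, Fintype.card_fin, sub_add_cancel]
  have hG : 0 < Real.Gamma ((d : ℝ) / 2 + 1) := Real.Gamma_pos_of_pos (by positivity)
  rw [ENNReal.toReal_ofReal (by positivity), Real.Gamma_add_one (s := (d : ℝ) / (2 * γ))
    (by positivity), neg_div]
  ring

theorem integral_kernel_base_pos {γ : ℝ} (hγ : 1 ≤ γ) {d : ℕ} (hd : d ≠ 0) :
    0 < ∫ x : E d, Real.exp (-((d : ℝ) * (1 / (2 * γ) * (‖x‖ ^ 2 / d) ^ γ))) := by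
  have hdpos : (0 : ℝ) < d := by positivity
  rw [integral_kernel_base hγ hd]
  have h1 : 0 < Real.Gamma ((d : ℝ) / 2 + 1) := Real.Gamma_pos_of_pos (by positivity)
  have h2 : 0 < Real.Gamma ((d : ℝ) / (2 * γ) + 1) := Real.Gamma_pos_of_pos (by positivity)
  have h3 := Real.pi_pos
  positivity

/-- By Stirling's formula the terms of order log d cancel: the two Gamma factors give 1/(2γ) - 1/2
and the power of d gives -(1 - γ)/(2γ). -/
theorem exists_tendsto_cNorm {γ : ℝ} (hγ : 1 ≤ γ) : ∃ c, Tendsto (cNorm γ) atTop (𝓝 c) := by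
  have hA : ∀ a > 0, Tendsto (fun d : ℕ => a * (Real.log (Real.Gamma (d * a + 1)) / (d * a) -
      Real.log (d * a))) atTop (𝓝 (a * (-1))) := fun a ha =>
    (tendsto_log_Gamma_div.comp
      ((tendsto_natCast_atTop_atTop (R := ℝ)).atTop_mul_const ha)).const_mul a
  have hγ2 : 0 < 1 / (2 * γ) := by positivity
  have h := ((((hA (1 / (2 * γ)) hγ2).sub (hA (1 / 2) (by norm_num))).const_add
    (Real.log Real.pi / 2 + Real.log 2 / 2))).neg
  refine ⟨_, h.congr' ?_⟩
  filter_upwards [eventually_ne_atTop 0] with d hd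
  have hdpos : (0 : ℝ) < d := by positivity
  have h1 : 0 < Real.Gamma ((d : ℝ) / 2 + 1) := Real.Gamma_pos_of_pos (by positivity)
  have h2 : 0 < Real.Gamma ((d : ℝ) / (2 * γ) + 1) := Real.Gamma_pos_of_pos (by positivity)
  have hpi := Real.pi_pos
  have hb : 0 < (d : ℝ) ^ (1 - γ) / (2 * γ) := by positivity
  have hb' : 0 < (d : ℝ) ^ (1 - γ) := by positivity
  have hlog : Real.log (√Real.pi ^ d * (Real.Gamma (d / (2 * γ) + 1) / Real.Gamma (d / 2 + 1)) *
      ((d : ℝ) ^ (1 - γ) / (2 * γ)) ^ (-(d / (2 * γ)))) =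
      d * (Real.log Real.pi / 2) + (Real.log (Real.Gamma (d / (2 * γ) + 1)) -
        Real.log (Real.Gamma (d / 2 + 1))) +
        -(d / (2 * γ)) * ((1 - γ) * Real.log d - Real.log (2 * γ)) := by
    rw [Real.log_mul (by positivity) (by positivity),
      Real.log_mul (by positivity) (by positivity), Real.log_pow, Real.log_div h2.ne' h1.ne',
      Real.log_rpow hb, Real.log_div hb'.ne' (by positivity), Real.log_rpow hdpos,
      Real.log_sqrt hpi.le]
  have e1 : (d : ℝ) * (1 / (2 * γ)) = d / (2 * γ) := by ring
  have e2 : (d : ℝ) * (1 / 2) = d / 2 := by ring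
  rw [cNorm, integral_kernel_base hγ hd, hlog, e1, e2, Real.log_div hdpos.ne' (by positivity),
    Real.log_div hdpos.ne' (by norm_num)]
  field_simp
  ring

/-! ### Bounded densities -/

section Bounded

variable {ρ : (d : ℕ) → E d → ℝ}

/-- Bounding the density by its supremum leaves the Lebesgue integral of a rescaled kernel. The
dilation by R = t^(1/(2γ)) contributes R^(-d), hence the logarithm of t. -/
theorem scgf_le_of_density_le (hρ : IsDensityFamily ρ) {γ : ℝ} (hγ : 1 ≤ γ) {C : ℝ} (hC : 0 < C)
    (hb : ∀ d x, ρ d x ≤ C ^ d) {d : ℕ} (hd : d ≠ 0) {t : ℝ} (ht : 0 < t) (x : E d) :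
    scgf (law ρ d) (energy γ d x) d t ≤ Real.log C - 1 / (2 * γ) * Real.log t - cNorm γ d := by
  have := hρ.isProbabilityMeasure_law
  have hdpos : (0 : ℝ) < d := by positivity
  set Φ : E d → ℝ := fun z => Real.exp (-((d : ℝ) * (1 / (2 * γ) * (‖z‖ ^ 2 / d) ^ γ))) with hΦ
  have hI := integral_kernel_base_pos hγ hd
  have hIc : ∫ z, Φ z = Real.exp (-(d * cNorm γ d)) := by
    rw [cNorm, mul_neg, neg_neg, ← mul_assoc, mul_one_div_cancel hdpos.ne', one_mul,
      Real.exp_log hI]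
  set R := t ^ (1 / (2 * γ)) with hR
  have hR0 : 0 < R := by positivity
  have hRt : (R ^ 2) ^ γ = t := by
    rw [hR, ← Real.rpow_natCast, ← Real.rpow_mul ht.le, ← Real.rpow_mul ht.le]
    have : 1 / (2 * γ) * ((2 : ℕ) : ℝ) * γ = 1 := by
      push_cast
      field_simp
    rw [this, Real.rpow_one]
  have hpt : ∀ y, Real.exp (-((d : ℝ) * t * energy γ d x y)) = Φ (R • (x - y)) := by
    intro y
    simp only [hΦ, energy]
    rw [norm_smul, Real.norm_eq_abs, abs_of_pos hR0, mul_pow, mul_div_assoc,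
      Real.mul_rpow (by positivity) (by positivity), hRt]
    congr 1
    ring
  have hint : ∫ y, Φ (R • (x - y)) = (R ^ d)⁻¹ * Real.exp (-(d * cNorm γ d)) := by
    rw [integral_sub_left_eq_self (fun z => Φ (R • z)) volume x, Measure.integral_comp_smul,
      finrank_euclideanSpace_fin, hIc, smul_eq_mul, abs_of_pos (by positivity)]
  -- A function that is not integrable has integral 0 by convention, but this integral is positive.
  have hintegrable : Integrable fun y => Φ (R • (x - y)) := by
    by_contra hno
    rw [integral_undef hno] at hint
    have : 0 < (R ^ d)⁻¹ * Real.exp (-(d * cNorm γ d)) := by positivity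
    linarith
  refine scgf_le_of_le (measurable_energy γ d x) (energy_nonneg hγ d x) ht.le hd ?_
  simp_rw [hpt]
  rw [law, integral_withDensity_eq_integral_toReal_smul (hρ.measurable d).ennreal_ofReal
    (ae_of_all _ fun _ => ENNReal.ofReal_lt_top)]
  calc ∫ y, (ENNReal.ofReal (ρ d y)).toReal • Φ (R • (x - y))
      ≤ ∫ y, C ^ d * Φ (R • (x - y)) := by
        refine integral_mono_of_nonneg (ae_of_all _ fun y => ?_) (hintegrable.const_mul _)
          (ae_of_all _ fun y => ?_)
        · exact mul_nonneg ENNReal.toReal_nonneg (Real.exp_pos _).le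
        · simp only [smul_eq_mul]
          rw [ENNReal.toReal_ofReal (hρ.nonneg d y)]
          exact mul_le_mul_of_nonneg_right (hb d y) (Real.exp_pos _).le
    _ = C ^ d * ((R ^ d)⁻¹ * Real.exp (-(d * cNorm γ d))) := by
        rw [integral_const_mul, hint]
    _ = Real.exp (d * (Real.log C - 1 / (2 * γ) * Real.log t - cNorm γ d)) := by
        have e1 : C ^ d = Real.exp (d * Real.log C) := by
          rw [Real.exp_nat_mul, Real.exp_log hC]
        have e2 : (R ^ d)⁻¹ = Real.exp (-(d * (1 / (2 * γ) * Real.log t))) := by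
          rw [Real.exp_neg, Real.exp_nat_mul, hR, Real.rpow_def_of_pos ht, mul_comm]
        rw [e1, e2, ← Real.exp_add, ← Real.exp_add]
        congr 1
        ring

theorem shape_le_of_density_le (hρ : IsDensityFamily ρ) {γ : ℝ} (hγ : 1 ≤ γ)
    {G : ℝ → ℝ} (hG : ScgfTendsto (law ρ) (law ρ) (energy γ) G) {c : ℝ}
    (hc : Tendsto (cNorm γ) atTop (𝓝 c)) {C : ℝ} (hb : ∀ d x, ρ d x ≤ C ^ d) :
    ∃ A, ∀ t > 0, G t ≤ A - 1 / (2 * γ) * Real.log t := by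
  have := hρ.isProbabilityMeasure_law
  have hb' : ∀ d x, ρ d x ≤ (|C| + 1) ^ d := fun d x =>
    (hb d x).trans ((le_abs_self _).trans (by rw [abs_pow]; gcongr; linarith))
  refine ⟨Real.log (|C| + 1) - c, fun t ht => ?_⟩
  refine le_of_whp (μ := law ρ) (fun ε hε => hG.lower ht hε) fun ε hε => ?_
  -- The bound holds for every x, so any event of probability tending to one can be weakened to it.
  refine (hG.lower ht hε).mono ?_
  filter_upwards [eventually_ne_atTop 0, Metric.tendsto_nhds.1 hc ε hε] with d hd hcd x _
  have h := scgf_le_of_density_le hρ hγ (by positivity) hb' hd ht x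
  rw [Real.dist_eq] at hcd
  linarith [(abs_lt.1 hcd).1]

/-- For densities that are at most exponentially large, the Legendre curve is unbounded. -/
theorem exists_legendre_ge {G : ℝ → ℝ} (hd : DifferentiableOn ℝ G (Ioi 0))
    (hlin : ∀ ε > 0, ∃ C, ∀ t > 0, -(ε * t) - C ≤ G t) {A b : ℝ} (hb : 0 < b)
    (hA : ∀ t > 0, G t ≤ A - b * Real.log t) (α : ℝ) : ∃ t > 0, α ≤ legendre G t := by
  by_contra! hno
  -- At this t the upper bound A - b log t equals -α - 1, contradicting G ≥ -α.
  have h := neg_le_of_legendre_lt hd hno hlin (Real.exp ((A + α + 1) / b)) (Real.exp_pos _)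
  have h2 := hA (Real.exp ((A + α + 1) / b)) (Real.exp_pos _)
  rw [Real.log_exp, mul_div_cancel₀ _ hb.ne'] at h2
  linarith

end Bounded

/-! ### Independent samples -/

theorem rpow_sum_le {ι : Type*} (s : Finset ι) (f : ι → ℝ) (hf : ∀ i, 0 ≤ f i) {m : ℝ} (hm : 0 < m)
    (hm1 : m ≤ 1) : (∑ i ∈ s, f i) ^ m ≤ ∑ i ∈ s, f i ^ m := by
  classical
  induction s using Finset.induction_on with
  | empty => simp [Real.zero_rpow hm.ne']
  | insert a s ha ih =>
    rw [Finset.sum_insert ha, Finset.sum_insert ha]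
    refine (Real.rpow_add_le_add_rpow (hf a) (Finset.sum_nonneg fun i _ => hf i) hm.le hm1).trans ?_
    linarith

/-- A Chernoff bound: the number of sample points in `A` is rarely below a quarter of its mean. -/
theorem measure_count_le {Y : Type*} [MeasurableSpace Y] (μ : Measure Y) [IsProbabilityMeasure μ]
    {A : Set Y} (hA : MeasurableSet A) (n : ℕ) :
    (Measure.pi fun _ : Fin n => μ).real
      {y | ∑ i, A.indicator (fun _ => (1 : ℝ)) (y i) ≤ n * μ.real A / 4} ≤
      Real.exp (-(n * μ.real A / 4)) := by
  set f : Y → ℝ := fun y => Real.exp (-A.indicator (fun _ => (1 : ℝ)) y) with hf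
  have hfm : Measurable f := ((measurable_const.indicator hA).neg).exp
  have hf1 : ∀ y, f y ≤ 1 := fun y =>
    Real.exp_le_one_iff.2 (neg_nonpos.2 (indicator_nonneg (fun _ _ => zero_le_one) y))
  have hfi : Integrable f μ := (integrable_const (1 : ℝ)).mono' hfm.aestronglyMeasurable
    (ae_of_all _ fun y => by rw [Real.norm_eq_abs, Real.abs_exp]; exact hf1 y)
  -- From e^(-1) ≤ 1/2 the mean is at most 1 - μ(A)/2. Markov's inequality at a quarter of the mean
  -- count then loses half of the exponent.
  have hle : ∫ y, f y ∂μ ≤ Real.exp (-(μ.real A / 2)) := by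
    calc ∫ y, f y ∂μ ≤ ∫ y, (1 - A.indicator (fun _ => (1 / 2 : ℝ)) y) ∂μ := by
          refine integral_mono hfi
            ((integrable_const _).sub ((integrable_const _).indicator hA)) fun y => ?_
          by_cases hy : y ∈ A
          · simp only [hf, indicator_of_mem hy]
            have := Real.exp_neg_one_lt_d9
            linarith
          · simp [hf, indicator_of_notMem hy]
      _ = 1 - μ.real A / 2 := by
          rw [integral_sub (integrable_const _) ((integrable_const _).indicator hA),
            integral_indicator_const _ hA]
          simp
          ring
      _ ≤ _ := by
          have := Real.add_one_le_exp (-(μ.real A / 2))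
          linarith
  have hprod : ∀ y : Fin n → Y,
      Real.exp (-∑ i, A.indicator (fun _ => (1 : ℝ)) (y i)) = ∏ i, f (y i) := by
    intro y
    rw [← Finset.sum_neg_distrib, Real.exp_sum]
  have hint : ∫ y : Fin n → Y, ∏ i, f (y i) ∂(Measure.pi fun _ => μ) ≤
      Real.exp (-(n * μ.real A / 2)) := by
    rw [integral_fintype_prod_eq_pow, Fintype.card_fin]
    calc (∫ y, f y ∂μ) ^ n ≤ Real.exp (-(μ.real A / 2)) ^ n := by
          refine pow_le_pow_left₀ (integral_nonneg fun y => (Real.exp_pos _).le) hle n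
      _ = _ := by
          rw [← Real.exp_nat_mul]
          congr 1
          ring
  have hi : Integrable (fun y : Fin n → Y => ∏ i, f (y i)) (Measure.pi fun _ => μ) :=
    Integrable.fintype_prod fun _ => hfi
  have hmk := mul_meas_ge_le_integral_of_nonneg (μ := Measure.pi fun _ : Fin n => μ)
    (ae_of_all _ fun y => Finset.prod_nonneg fun i _ => (Real.exp_pos _).le) hi
    (Real.exp (-(n * μ.real A / 4)))
  have hset : {y : Fin n → Y | ∑ i, A.indicator (fun _ => (1 : ℝ)) (y i) ≤ n * μ.real A / 4} =
      {y | Real.exp (-(n * μ.real A / 4)) ≤ ∏ i, f (y i)} := by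
    ext y
    show (_ : ℝ) ≤ _ ↔ (_ : ℝ) ≤ _
    rw [← hprod, Real.exp_le_exp, neg_le_neg_iff]
  rw [hset]
  have h2 := hmk.trans hint
  have h3 : Real.exp (-(n * μ.real A / 2)) =
      Real.exp (-(n * μ.real A / 4)) * Real.exp (-(n * μ.real A / 4)) := by
    rw [← Real.exp_add]
    congr 1
    ring
  rw [h3] at h2
  exact le_of_mul_le_mul_left h2 (Real.exp_pos _)

/-- Events on a product space whose sections are likely with high probability. -/
theorem Whp.prod {X Y : ℕ → Type*} [∀ d, MeasurableSpace (X d)] [∀ d, MeasurableSpace (Y d)]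
    {μ : ∀ d, Measure (X d)} {ν : ∀ d, Measure (Y d)} [∀ d, IsProbabilityMeasure (μ d)]
    [∀ d, IsProbabilityMeasure (ν d)] {Q : ∀ d, X d → Prop} {R : ∀ d, X d × Y d → Prop}
    (hQ : Whp μ Q) {u : ℕ → ℝ} (hu : Tendsto u atTop (𝓝 0))
    (hm : ∀ d, MeasurableSet {ω | R d ω})
    (hR : ∀ᶠ d in atTop, ∀ x, Q d x → (ν d).real {y | ¬ R d (x, y)} ≤ u d) :
    Whp (fun d => (μ d).prod (ν d)) R := by
  have hu' := ENNReal.tendsto_ofReal hu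
  rw [ENNReal.ofReal_zero] at hu'
  have h := Tendsto.add hQ hu'
  rw [add_zero] at h
  refine tendsto_of_tendsto_of_tendsto_of_le_of_le' tendsto_const_nhds h
    (Eventually.of_forall fun _ => bot_le) ?_
  filter_upwards [hR] with d hd
  have hmc : MeasurableSet {ω | ¬ R d ω} := (hm d).compl
  rw [Measure.prod_apply hmc]
  calc ∫⁻ x, ν d (Prod.mk x ⁻¹' {ω | ¬ R d ω}) ∂(μ d)
      ≤ ∫⁻ x, ({x | ¬ Q d x}.indicator (fun _ => 1) x + ENNReal.ofReal (u d)) ∂(μ d) := by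
        refine lintegral_mono fun x => ?_
        by_cases hx : Q d x
        · have h1 := hd x hx
          rw [Measure.real, ← ENNReal.le_ofReal_iff_toReal_le (measure_ne_top _ _)
            (ENNReal.toReal_nonneg.trans h1)] at h1
          exact h1.trans le_add_self
        · have hx' : x ∈ {x | ¬ Q d x} := hx
          rw [indicator_of_mem hx']
          exact prob_le_one.trans le_self_add
    _ = ∫⁻ x, {x | ¬ Q d x}.indicator (fun _ => 1) x ∂(μ d) + ENNReal.ofReal (u d) := by
        rw [lintegral_add_right _ measurable_const]
        simp
    _ ≤ μ d {x | ¬ Q d x} + ENNReal.ofReal (u d) := by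
        gcongr
        exact (lintegral_indicator_const_le _ _).trans (by rw [one_mul])

/-! ### Bounds for the estimator at a fixed point -/

section Fixed

variable {ρ : (d : ℕ) → E d → ℝ} {γ h : ℝ} {d n : ℕ}

theorem gammaKernel_pos (γ : ℝ) (d : ℕ) (x : E d) : 0 < gammaKernel γ d x := Real.exp_pos _

theorem measurable_gammaKernel (γ : ℝ) (d : ℕ) : Measurable (gammaKernel γ d) := by
  unfold gammaKernel
  fun_prop

theorem measurable_logEstimator (γ : ℝ) (d : ℕ) (h : ℝ) (n : ℕ) :
    Measurable fun ω : E d × (Fin n → E d) => logEstimator γ d h ω := by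
  have := measurable_gammaKernel γ d
  unfold logEstimator estimator
  refine (Real.measurable_log.comp (Measurable.const_mul ?_ _)).const_mul _
  exact Finset.measurable_sum _ fun i _ => this.comp (by fun_prop)

theorem estimator_pos (hh : 0 < h) (hn : n ≠ 0) (x : E d) (y : Fin n → E d) :
    0 < estimator γ d h x y := by
  have : NeZero n := ⟨hn⟩
  have h1 : 0 < ∑ i, gammaKernel γ d (h⁻¹ • (x - y i)) :=
    Finset.sum_pos (fun i _ => gammaKernel_pos _ _ _) Finset.univ_nonempty
  have h2 : (0 : ℝ) < n := by positivity
  unfold estimator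
  positivity

theorem le_logEstimator_iff (hh : 0 < h) (hn : n ≠ 0) (hd : d ≠ 0) {x : E d} {y : Fin n → E d}
    {b : ℝ} : b ≤ logEstimator γ d h (x, y) ↔ Real.exp (d * b) ≤ estimator γ d h x y := by
  have hdpos : (0 : ℝ) < d := by positivity
  rw [logEstimator, ← Real.le_log_iff_exp_le (estimator_pos hh hn x y), one_div,
    ← div_eq_inv_mul, le_div_iff₀ hdpos, mul_comm]

theorem integrable_gammaKernel_rpow (hρ : IsDensityFamily ρ) (hγ : 1 ≤ γ) (hh : 0 < h) {m : ℝ}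
    (hm : 0 < m) (x : E d) :
    Integrable (fun y => gammaKernel γ d (h⁻¹ • (x - y)) ^ m) (law ρ d) := by
  have := hρ.isProbabilityMeasure_law
  have h1 : (fun y => gammaKernel γ d (h⁻¹ • (x - y)) ^ m) = fun y =>
      Real.exp (d * (m * cNorm γ d)) *
        Real.exp (-((d : ℝ) * (m * h ^ (-(2 * γ))) * energy γ d x y)) := by
    ext y
    rw [gammaKernel_smul γ hh, ← Real.exp_mul, ← Real.exp_add]
    congr 1
    ring
  rw [h1]
  exact (integrable_exp_neg (measurable_energy γ d x) (energy_nonneg hγ d x)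
    (by positivity)).const_mul _

theorem integral_gammaKernel_eq_exp_g (hρ : IsDensityFamily ρ) (hγ : 1 ≤ γ) (hh : 0 < h) {m : ℝ}
    (hm : 0 < m) (hd : d ≠ 0) (x : E d) :
    ∫ y, gammaKernel γ d (h⁻¹ • (x - y)) ^ m ∂(law ρ d) =
      Real.exp (d * (g ρ γ d h m x + m * Real.log h)) := by
  have := hρ.isProbabilityMeasure_law
  rw [g_eq hρ hγ hd hh hm, integral_gammaKernel_rpow hh,
    ← exp_scgf (measurable_energy γ d x) (energy_nonneg hγ d x) (by positivity) hd, ← Real.exp_add]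
  congr 1
  ring

theorem integral_database_sum (hρ : IsDensityFamily ρ) (n : ℕ) {f : E d → ℝ}
    (hf : Integrable f (law ρ d)) :
    Integrable (fun y : Fin n → E d => ∑ i, f (y i)) (databaseLaw ρ d n) ∧
      ∫ y : Fin n → E d, ∑ i, f (y i) ∂(databaseLaw ρ d n) = n * ∫ y, f y ∂(law ρ d) := by
  have := hρ.isProbabilityMeasure_law
  have hi : ∀ i : Fin n, Integrable (fun y : Fin n → E d => f (y i)) (databaseLaw ρ d n) :=
    fun i => (measurePreserving_eval (fun _ : Fin n => law ρ d) i).integrable_comp_of_integrable hf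
  refine ⟨integrable_finsetSum _ fun i _ => hi i, ?_⟩
  rw [integral_finsetSum _ fun i _ => hi i]
  have : ∀ i : Fin n, ∫ y : Fin n → E d, f (y i) ∂(databaseLaw ρ d n) = ∫ y, f y ∂(law ρ d) :=
    fun i => integral_comp_eval (μ := fun _ : Fin n => law ρ d) hf.aestronglyMeasurable
  simp [this]

/-- The mean of the estimator over the database. -/
theorem integral_estimator (hρ : IsDensityFamily ρ) (hγ : 1 ≤ γ) (hh : 0 < h) (hd : d ≠ 0)
    (hn : n ≠ 0) (x : E d) :
    ∫ y, estimator γ d h x y ∂(databaseLaw ρ d n) = Real.exp (d * g ρ γ d h 1 x) := by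
  have hi := integrable_gammaKernel_rpow hρ hγ hh one_pos x
  have hg := integral_gammaKernel_eq_exp_g hρ hγ hh one_pos hd x
  simp_rw [Real.rpow_one] at hi hg
  have hn' : (n : ℝ) ≠ 0 := by exact_mod_cast hn
  unfold estimator
  rw [integral_const_mul, (integral_database_sum hρ n hi).2, hg]
  have e1 : h ^ d = Real.exp (d * Real.log h) := by rw [Real.exp_nat_mul, Real.exp_log hh]
  have e2 : Real.exp (d * (g ρ γ d h 1 x + 1 * Real.log h)) =
      Real.exp (d * g ρ γ d h 1 x) * Real.exp (d * Real.log h) := by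
    rw [← Real.exp_add]
    congr 1
    ring
  rw [e1, e2]
  have := Real.exp_pos (d * Real.log h)
  field_simp

/-- Markov's inequality for a fractional moment of the estimator. -/
theorem measure_le_logEstimator (hρ : IsDensityFamily ρ) (hγ : 1 ≤ γ) (hh : 0 < h) (hd : d ≠ 0)
    (hn : n ≠ 0) {m : ℝ} (hm : 0 < m) (hm1 : m ≤ 1) (x : E d) (b : ℝ) :
    (databaseLaw ρ d n).real {y | b ≤ logEstimator γ d h (x, y)} ≤
      Real.exp ((1 - m) * Real.log n + d * (g ρ γ d h m x - m * b)) := by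
  have := hρ.isProbabilityMeasure_law
  have hpd : IsProbabilityMeasure (databaseLaw ρ d n) := by unfold databaseLaw; infer_instance
  have hn' : (0 : ℝ) < n := by positivity
  have hi := integrable_gammaKernel_rpow hρ hγ hh hm x
  obtain ⟨hsi, hs⟩ := integral_database_sum hρ n hi
  have hmk := mul_meas_ge_le_integral_of_nonneg (μ := databaseLaw ρ d n)
    (ae_of_all _ fun y => Finset.sum_nonneg fun i _ =>
      Real.rpow_nonneg (gammaKernel_pos γ d (h⁻¹ • (x - y i))).le m) hsi
    (Real.exp (m * (d * b) + m * (Real.log n + d * Real.log h)))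
  rw [hs, integral_gammaKernel_eq_exp_g hρ hγ hh hm hd] at hmk
  have hsub : (databaseLaw ρ d n).real {y | b ≤ logEstimator γ d h (x, y)} ≤
      (databaseLaw ρ d n).real {y | Real.exp (m * (d * b) + m * (Real.log n + d * Real.log h)) ≤
        ∑ i, gammaKernel γ d (h⁻¹ • (x - y i)) ^ m} := by
    refine measureReal_mono fun y hy => ?_
    have hy' := (le_logEstimator_iff hh hn hd).1 hy
    have e1 : (n : ℝ) * h ^ d = Real.exp (Real.log n + d * Real.log h) := by
      rw [Real.exp_add, Real.exp_log hn', Real.exp_nat_mul, Real.exp_log hh]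
    unfold estimator at hy'
    rw [e1, one_div, ← Real.exp_neg, ← div_le_iff₀' (Real.exp_pos _), ← Real.exp_sub] at hy'
    have h2 : Real.exp (d * b - -(Real.log n + d * Real.log h)) ^ m ≤
        (∑ i, gammaKernel γ d (h⁻¹ • (x - y i))) ^ m :=
      Real.rpow_le_rpow (Real.exp_pos _).le hy' hm.le
    rw [← Real.exp_mul] at h2
    refine le_trans (le_of_eq ?_) (h2.trans (rpow_sum_le _ _ (fun i => (gammaKernel_pos _ _ _).le)
      hm hm1))
    congr 1
    ring
  refine hsub.trans ?_
  rw [← le_div_iff₀' (Real.exp_pos _)] at hmk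
  refine hmk.trans (le_of_eq ?_)
  have e3 : (n : ℝ) = Real.exp (Real.log n) := (Real.exp_log hn').symm
  nth_rewrite 1 [e3]
  rw [← Real.exp_add, ← Real.exp_sub]
  congr 1
  ring

/-- If the exponent of the kernel is close to `a` with probability at least `p`, then the estimator
is not much smaller than the contribution of the points where this happens. -/
theorem measure_logEstimator_lt (hρ : IsDensityFamily ρ) (hh : 0 < h) (hd : d ≠ 0)
    (hn : n ≠ 0) {x : E d} {a δ q : ℝ}
    (hq : Real.exp (-(d * q)) ≤ (law ρ d).real {y | |energy γ d x y - a| < δ}) :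
    (databaseLaw ρ d n).real {y | ¬ cNorm γ d - Real.log h - h ^ (-(2 * γ)) * (a + δ) - q
      - Real.log 4 / d ≤ logEstimator γ d h (x, y)} ≤
      Real.exp (-(Real.exp (Real.log n - d * q) / 4)) := by
  have := hρ.isProbabilityMeasure_law
  have hpd : IsProbabilityMeasure (databaseLaw ρ d n) := by unfold databaseLaw; infer_instance
  have hn' : (0 : ℝ) < n := by positivity
  have hdpos : (0 : ℝ) < d := by positivity
  set A := {y | |energy γ d x y - a| < δ} with hA
  have hAm : MeasurableSet A :=
    measurableSet_lt ((measurable_energy γ d x).sub_const a).norm measurable_const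
  set t := h ^ (-(2 * γ)) with ht
  have ht0 : 0 < t := by positivity
  have hnq : Real.exp (Real.log n - d * q) ≤ n * (law ρ d).real A := by
    rw [Real.exp_sub, Real.exp_log hn', div_eq_mul_inv, ← Real.exp_neg]
    gcongr
  have hcount := measure_count_le (law ρ d) hAm n
  refine le_trans (measureReal_mono (fun y hy => ?_) (measure_ne_top _ _))
    (hcount.trans (Real.exp_le_exp.2 (by linarith)))
  by_contra hno
  refine hy ((le_logEstimator_iff hh hn hd).2 ?_)
  have hno' : n * (law ρ d).real A / 4 < ∑ i, A.indicator (fun _ => (1 : ℝ)) (y i) := not_le.1 hno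
  have hterm : ∀ i, Real.exp (d * (cNorm γ d - t * (a + δ))) *
      A.indicator (fun _ => (1 : ℝ)) (y i) ≤ gammaKernel γ d (h⁻¹ • (x - y i)) := by
    intro i
    by_cases hi : y i ∈ A
    · rw [indicator_of_mem hi, mul_one, gammaKernel_smul γ hh, Real.exp_le_exp]
      have h1 : |energy γ d x (y i) - a| < δ := hi
      have h2 : energy γ d x (y i) ≤ a + δ := by linarith [(abs_lt.1 h1).2]
      gcongr
    · rw [indicator_of_notMem hi, mul_zero]
      exact (gammaKernel_pos _ _ _).le
  have e1 : (n : ℝ) * h ^ d = Real.exp (Real.log n + d * Real.log h) := by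
    rw [Real.exp_add, Real.exp_log hn', Real.exp_nat_mul, Real.exp_log hh]
  unfold estimator
  rw [e1, one_div, ← Real.exp_neg]
  calc Real.exp (d * (cNorm γ d - Real.log h - t * (a + δ) - q - Real.log 4 / d))
      = Real.exp (-(Real.log n + d * Real.log h)) * (Real.exp (d * (cNorm γ d - t * (a + δ))) *
          (Real.exp (Real.log n - d * q) / 4)) := by
        have e4 : Real.exp (Real.log n - d * q) / 4 =
            Real.exp (Real.log n - d * q - Real.log 4) := by
          rw [Real.exp_sub _ (Real.log 4), Real.exp_log (by norm_num)]
        rw [e4, ← Real.exp_add, ← Real.exp_add]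
        congr 1
        field_simp
        ring
    _ ≤ Real.exp (-(Real.log n + d * Real.log h)) * (Real.exp (d * (cNorm γ d - t * (a + δ))) *
          ∑ i, A.indicator (fun _ => (1 : ℝ)) (y i)) := by
        gcongr
        linarith
    _ ≤ _ := by
        rw [Finset.mul_sum]
        gcongr with i
        exact hterm i

end Fixed

/-! ### Concentration of the estimator -/

section Concentration

variable {ρ : (d : ℕ) → E d → ℝ} {γ h α c : ℝ} {n : ℕ → ℕ} {G : ℝ → ℝ}

theorem eventually_ne_zero_of_log (hα : 0 < α)
    (hn : Tendsto (fun d : ℕ => Real.log (n d) / d) atTop (𝓝 α)) : ∀ᶠ d in atTop, n d ≠ 0 := by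
  filter_upwards [hn.eventually (lt_mem_nhds hα)] with d hd h0
  simp [h0] at hd

theorem IsDensityFamily.isProbabilityMeasure_databaseLaw (hρ : IsDensityFamily ρ) (d n : ℕ) :
    IsProbabilityMeasure (databaseLaw ρ d n) := by
  have := hρ.isProbabilityMeasure_law
  unfold databaseLaw
  infer_instance

/-- The m-th moment over the database is at most n^(1-m) h^(-dm) 𝔼 K^m. Fractional m matter because
the first moment may be dominated by databases too rare to be seen. -/
theorem whp_logEstimator_le (hρ : IsDensityFamily ρ) (hγ : 1 ≤ γ)
    (hG : ScgfTendsto (law ρ) (law ρ) (energy γ) G) (hc : Tendsto (cNorm γ) atTop (𝓝 c))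
    (hα : 0 < α) (hn : Tendsto (fun d : ℕ => Real.log (n d) / d) atTop (𝓝 α)) (hh : 0 < h)
    {m : ℝ} (hm : 0 < m) (hm1 : m ≤ 1) {ε : ℝ} (hε : 0 < ε) :
    Whp (fun d => jointLaw ρ d (n d)) fun d ω => logEstimator γ d h ω ≤
      (1 - m) / m * α + 1 / m * (m * (c - Real.log h) + G (m * h ^ (-(2 * γ)))) + ε := by
  have := hρ.isProbabilityMeasure_law
  have := fun d => hρ.isProbabilityMeasure_databaseLaw d (n d)
  set gb := m * (c - Real.log h) + G (m * h ^ (-(2 * γ))) with hgb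
  -- One third of mε pays for the fluctuation of g, one for that of log n / d, and one is left as
  -- exponential decay.
  have hε3 : 0 < m * (ε / 3) := by positivity
  refine Whp.prod (whp_g hρ hγ hG hc hh hm hε3)
    (u := fun d => Real.exp (-(d * (m * (ε / 3))))) ?_ (fun d => ?_) ?_
  · exact Real.tendsto_exp_neg_atTop_nhds_zero.comp
      ((tendsto_natCast_atTop_atTop (R := ℝ)).atTop_mul_const hε3)
  · exact measurableSet_le (measurable_logEstimator γ d h (n d)) measurable_const
  · filter_upwards [eventually_ne_atTop 0, eventually_ne_zero_of_log hα hn,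
      hn.eventually (gt_mem_nhds (show α < α + m * (ε / 3) by linarith))] with d hd hnd hnα x hx
    have hdpos : (0 : ℝ) < d := by positivity
    rw [div_lt_iff₀ hdpos] at hnα
    refine le_trans (measureReal_mono (fun y hy => (not_le.1 hy).le) (measure_ne_top _ _))
      ((measure_le_logEstimator hρ hγ hh hd hnd hm hm1 x
        ((1 - m) / m * α + 1 / m * gb + ε)).trans (Real.exp_le_exp.2 ?_))
    have hx1 := (abs_lt.1 hx).2
    have h1 : m * ((1 - m) / m * α + 1 / m * gb + ε) = (1 - m) * α + gb + m * ε := by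
      field_simp
    have h2 : (1 - m) * Real.log (n d) ≤ (1 - m) * ((α + m * (ε / 3)) * d) := by
      gcongr
    have h3 : d * g ρ γ d h m x ≤ d * (gb + m * (ε / 3)) := by
      gcongr
      linarith
    have h4 : 0 ≤ m * (m * (ε / 3)) * d := by positivity
    rw [h1]
    nlinarith

/-- Energies near -G'(s) occur with probability at least e^(-d J(s)) to exponential order, J =
`legendre G`, so J(s) < α ensures exponentially many such data points. The parameter s is free of h:
it is h^(-2γ) in the annealed regime and tends to the critical value below it. -/
theorem whp_le_logEstimator (hρ : IsDensityFamily ρ) (hγ : 1 ≤ γ)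
    (hG : ScgfTendsto (law ρ) (law ρ) (energy γ) G) (hdG : DifferentiableOn ℝ G (Ioi 0))
    (hc : Tendsto (cNorm γ) atTop (𝓝 c))
    (hα : 0 < α) (hn : Tendsto (fun d : ℕ => Real.log (n d) / d) atTop (𝓝 α)) (hh : 0 < h)
    {s : ℝ} (hs : 0 < s) (hsα : legendre G s < α) {ε : ℝ} (hε : 0 < ε) :
    Whp (fun d => jointLaw ρ d (n d)) fun d ω =>
      c - Real.log h - legendre G s + h ^ (-(2 * γ)) * deriv G s - ε ≤ logEstimator γ d h ω := by
  have := hρ.isProbabilityMeasure_law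
  have := fun d => hρ.isProbabilityMeasure_databaseLaw d (n d)
  set t := h ^ (-(2 * γ)) with ht
  have ht0 : 0 < t := by positivity
  -- One κ is lost in the window probability, one in log n / d, and the third leaves at least e^(dκ)
  -- expected points.
  obtain ⟨κ, hκ, hκ1, hκ2⟩ : ∃ κ > 0, 3 * κ ≤ α - legendre G s ∧ κ ≤ ε / 4 := by
    refine ⟨min ((α - legendre G s) / 3) (ε / 4), by
      have : 0 < α - legendre G s := by linarith
      positivity, ?_, min_le_right _ _⟩
    linarith [min_le_left ((α - legendre G s) / 3) (ε / 4)]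
  set δ := ε / (4 * t) with hδ
  have hδ0 : 0 < δ := by positivity
  have hder : HasDerivAt G (-(-deriv G s)) s := by
    rw [neg_neg]
    exact hasDerivAt_deriv_of_pos hdG hs
  have hwin := whp_measure_window (fun d x => measurable_energy γ d x)
    (fun d => energy_nonneg hγ d) hG hs hder hδ0 hκ
  refine Whp.prod hwin (u := fun d => Real.exp (-(Real.exp (d * κ) / 4))) ?_ (fun d => ?_) ?_
  · refine Real.tendsto_exp_neg_atTop_nhds_zero.comp (Tendsto.atTop_div_const (by norm_num) ?_)
    exact Real.tendsto_exp_atTop.comp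
      ((tendsto_natCast_atTop_atTop (R := ℝ)).atTop_mul_const hκ)
  · exact measurableSet_le measurable_const (measurable_logEstimator γ d h (n d))
  · have hlog4 : Tendsto (fun d : ℕ => Real.log 4 / (d : ℝ)) atTop (𝓝 0) :=
      tendsto_const_nhds.div_atTop tendsto_natCast_atTop_atTop
    filter_upwards [eventually_ne_atTop 0, eventually_ne_zero_of_log hα hn,
      hn.eventually (lt_mem_nhds (show α - κ < α by linarith)),
      hc.eventually (lt_mem_nhds (show c - ε / 4 < c by linarith)),
      hlog4.eventually (gt_mem_nhds (show (0 : ℝ) < ε / 4 by linarith))]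
      with d hd hnd hnα hcd hd4 x hx
    have hdpos : (0 : ℝ) < d := by positivity
    rw [lt_div_iff₀ hdpos] at hnα
    have hq : Real.exp (-(d * (legendre G s + κ))) ≤
        (law ρ d).real {y | |energy γ d x y - -deriv G s| < δ} := by
      refine le_trans (le_of_eq ?_) hx
      congr 1
      unfold legendre
      ring
    refine le_trans (measureReal_mono (fun y hy hy' => hy (le_trans ?_ hy')) (measure_ne_top _ _))
      ((measure_logEstimator_lt hρ hh hd hnd hq).trans (Real.exp_le_exp.2 ?_))
    · have h1 : t * (-deriv G s + δ) = -(t * deriv G s) + ε / 4 := by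
        rw [hδ]
        field_simp
      rw [← ht, h1]
      linarith
    · have h2 : d * κ ≤ Real.log (n d) - d * (legendre G s + κ) := by
        have : d * (κ + (legendre G s + κ)) ≤ d * (α - κ) := by
          gcongr
          linarith
        linarith
      have h3 := Real.exp_le_exp.2 h2
      linarith

theorem concentratesAt_of_whp {f : ℝ}
    (hup : ∀ ε > 0, Whp (fun d => jointLaw ρ d (n d)) fun d ω => logEstimator γ d h ω ≤ f + ε)
    (hlow : ∀ ε > 0, Whp (fun d => jointLaw ρ d (n d)) fun d ω => f - ε ≤ logEstimator γ d h ω) :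
    ConcentratesAt ρ γ n h f := by
  intro ε hε
  have h1 : Whp (fun d => jointLaw ρ d (n d)) fun d ω => |logEstimator γ d h ω - f| < ε := by
    refine ((hup (ε / 2) (half_pos hε)).and (hlow (ε / 2) (half_pos hε))).mono
      (Eventually.of_forall fun d ω hω => abs_lt.2 ⟨?_, ?_⟩)
    · linarith [hω.2]
    · linarith [hω.1]
  simpa only [Whp, not_lt] using h1

theorem annealedConcentratesAt (hρ : IsDensityFamily ρ) (hγ : 1 ≤ γ)
    (hG : ScgfTendsto (law ρ) (law ρ) (energy γ) G) (hc : Tendsto (cNorm γ) atTop (𝓝 c))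
    (hα : 0 < α) (hn : Tendsto (fun d : ℕ => Real.log (n d) / d) atTop (𝓝 α)) (hh : 0 < h) :
    AnnealedConcentratesAt ρ γ n h (c - Real.log h + G (h ^ (-(2 * γ)))) := by
  intro ε hε
  have h1 : Whp (law ρ) fun d x => |1 / (d : ℝ) *
      Real.log (∫ y, estimator γ d h x y ∂(databaseLaw ρ d (n d))) -
        (c - Real.log h + G (h ^ (-(2 * γ))))| < ε := by
    refine (whp_g hρ hγ hG hc hh one_pos hε).mono ?_
    filter_upwards [eventually_ne_atTop 0, eventually_ne_zero_of_log hα hn] with d hd hnd x hx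
    have hd' : (d : ℝ) ≠ 0 := by exact_mod_cast hd
    rw [integral_estimator hρ hγ hh hd hnd, Real.log_exp, ← mul_assoc, one_div_mul_cancel hd',
      one_mul]
    rwa [one_mul, one_mul] at hx
  simpa only [Whp, not_lt] using h1

end Concentration

/-! ### Convergence of the mean of the estimator -/

section Mean

variable {ρ : (d : ℕ) → E d → ℝ} {γ h : ℝ}

/-- The powers γ and p are compared at the threshold b with b^(p-γ) = 1/η. -/
theorem rpow_le_add_mul_rpow {γ p η : ℝ} (hγ : 0 ≤ γ) (hp : γ < p) (hη : 0 < η) :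
    ∃ K, ∀ z ≥ 0, z ^ γ ≤ K + η * z ^ p := by
  set b := (η⁻¹) ^ (1 / (p - γ)) with hb
  have hpγ : 0 < p - γ := by linarith
  have hb0 : 0 < b := by positivity
  refine ⟨b ^ γ, fun z hz => ?_⟩
  rcases le_total z b with h | h
  · have h1 : z ^ γ ≤ b ^ γ := Real.rpow_le_rpow hz h hγ
    have h2 : 0 ≤ η * z ^ p := by positivity
    linarith
  · have hz0 : 0 < z := hb0.trans_le h
    have h1 : η⁻¹ ≤ z ^ (p - γ) := by
      calc η⁻¹ = b ^ (p - γ) := by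
            rw [hb, ← Real.rpow_mul (by positivity), one_div_mul_cancel hpγ.ne', Real.rpow_one]
        _ ≤ _ := Real.rpow_le_rpow hb0.le h hpγ.le
    have h2 : z ^ γ ≤ η * z ^ p := by
      have e : z ^ p = z ^ (p - γ) * z ^ γ := by
        rw [← Real.rpow_add hz0]
        congr 1
        ring
      rw [e, ← mul_assoc]
      refine le_mul_of_one_le_left (by positivity) ?_
      calc (1 : ℝ) = η * η⁻¹ := (mul_inv_cancel₀ hη.ne').symm
        _ ≤ η * z ^ (p - γ) := by gcongr
    have h3 : 0 ≤ b ^ γ := by positivity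
    linarith

/-- The distance of the point to the first data point, on the natural scale, to the power `p`. -/
def firstDist (p : ℝ) (d n : ℕ) (ω : E d × (Fin n → E d)) : ℝ :=
  if hn : 0 < n then (‖ω.1 - ω.2 ⟨0, hn⟩‖ ^ 2 / d) ^ p else 0

theorem measurable_firstDist (p : ℝ) (d n : ℕ) : Measurable (firstDist p d n) := by
  unfold firstDist
  by_cases hn : 0 < n
  · simp only [hn, dite_true]
    fun_prop
  · simp only [hn, dite_false]
    fun_prop

theorem firstDist_nonneg (p : ℝ) (d n : ℕ) (ω : E d × (Fin n → E d)) : 0 ≤ firstDist p d n ω := by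
  unfold firstDist
  split_ifs
  · positivity
  · exact le_rfl

theorem norm_sub_sq_div_rpow_le {p : ℝ} (hp : 0 ≤ p) {d : ℕ} (x y : E d) :
    (‖x - y‖ ^ 2 / d) ^ p ≤ 4 ^ p / (d : ℝ) ^ p * (‖x‖ ^ (2 * p) + ‖y‖ ^ (2 * p)) := by
  have h1 : ‖x - y‖ ^ 2 ≤ 4 * (max ‖x‖ ‖y‖) ^ 2 := by
    have h2 : ‖x - y‖ ≤ 2 * max ‖x‖ ‖y‖ := by
      linarith [norm_sub_le x y, le_max_left ‖x‖ ‖y‖, le_max_right ‖x‖ ‖y‖]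
    calc ‖x - y‖ ^ 2 ≤ (2 * max ‖x‖ ‖y‖) ^ 2 := by gcongr
      _ = _ := by ring
  have hmax : 0 ≤ max ‖x‖ ‖y‖ := le_max_of_le_left (norm_nonneg x)
  have h3 : (max ‖x‖ ‖y‖) ^ (2 * p) ≤ ‖x‖ ^ (2 * p) + ‖y‖ ^ (2 * p) := by
    have hx : 0 ≤ ‖x‖ ^ (2 * p) := by positivity
    have hy : 0 ≤ ‖y‖ ^ (2 * p) := by positivity
    rcases max_choice ‖x‖ ‖y‖ with h | h <;> rw [h] <;> linarith
  calc (‖x - y‖ ^ 2 / d) ^ p ≤ (4 * (max ‖x‖ ‖y‖) ^ 2 / d) ^ p := by gcongr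
    _ = 4 ^ p / (d : ℝ) ^ p * (max ‖x‖ ‖y‖) ^ (2 * p) := by
        rw [Real.div_rpow (by positivity) (by positivity), Real.mul_rpow (by norm_num)
          (by positivity), ← Real.rpow_natCast, ← Real.rpow_mul hmax]
        push_cast
        ring
    _ ≤ _ := by gcongr

theorem lintegral_firstDist_le (hρ : IsDensityFamily ρ) {p C : ℝ} (hp : 0 ≤ p)
    (hC : ∀ d : ℕ, ∫⁻ x, ENNReal.ofReal (‖x‖ ^ (2 * p)) ∂(law ρ d) ≤
      ENNReal.ofReal (C * (d : ℝ) ^ p)) {d : ℕ} (hd : d ≠ 0) (n : ℕ) :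
    ∫⁻ ω, ENNReal.ofReal (firstDist p d n ω) ∂(jointLaw ρ d n) ≤
      ENNReal.ofReal (4 ^ p * (2 * |C|)) := by
  have := hρ.isProbabilityMeasure_law
  have := hρ.isProbabilityMeasure_databaseLaw d n
  have hdpos : (0 : ℝ) < d := by positivity
  by_cases hn : 0 < n
  swap
  · simp [firstDist, hn]
  have hA : 0 ≤ 4 ^ p / (d : ℝ) ^ p := by positivity
  have hm : Measurable fun x : E d => ENNReal.ofReal (‖x‖ ^ (2 * p)) := by fun_prop
  have hm1 : Measurable fun ω : E d × (Fin n → E d) => ENNReal.ofReal (‖ω.1‖ ^ (2 * p)) := by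
    fun_prop
  have hm2 : Measurable fun ω : E d × (Fin n → E d) =>
      ENNReal.ofReal (‖ω.2 ⟨0, hn⟩‖ ^ (2 * p)) := by fun_prop
  have hm12 : Measurable fun ω : E d × (Fin n → E d) => ENNReal.ofReal (‖ω.1‖ ^ (2 * p)) +
      ENNReal.ofReal (‖ω.2 ⟨0, hn⟩‖ ^ (2 * p)) := hm1.add hm2
  have h1 : ∫⁻ ω, ENNReal.ofReal (‖ω.1‖ ^ (2 * p)) ∂(jointLaw ρ d n) =
      ∫⁻ x, ENNReal.ofReal (‖x‖ ^ (2 * p)) ∂(law ρ d) :=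
    (measurePreserving_fst (μ := law ρ d) (ν := databaseLaw ρ d n)).lintegral_comp hm
  have h2 : ∫⁻ ω, ENNReal.ofReal (‖ω.2 ⟨0, hn⟩‖ ^ (2 * p)) ∂(jointLaw ρ d n) =
      ∫⁻ x, ENNReal.ofReal (‖x‖ ^ (2 * p)) ∂(law ρ d) :=
    ((measurePreserving_eval (fun _ : Fin n => law ρ d) ⟨0, hn⟩).comp
      (measurePreserving_snd (μ := law ρ d) (ν := databaseLaw ρ d n))).lintegral_comp hm
  have hC' : ∫⁻ x, ENNReal.ofReal (‖x‖ ^ (2 * p)) ∂(law ρ d) ≤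
      ENNReal.ofReal (|C| * (d : ℝ) ^ p) :=
    (hC d).trans (ENNReal.ofReal_le_ofReal (by gcongr; exact le_abs_self C))
  calc ∫⁻ ω, ENNReal.ofReal (firstDist p d n ω) ∂(jointLaw ρ d n)
      ≤ ∫⁻ ω, ENNReal.ofReal (4 ^ p / (d : ℝ) ^ p) * (ENNReal.ofReal (‖ω.1‖ ^ (2 * p)) +
          ENNReal.ofReal (‖ω.2 ⟨0, hn⟩‖ ^ (2 * p))) ∂(jointLaw ρ d n) := by
        refine lintegral_mono fun ω => ?_
        rw [← ENNReal.ofReal_add (by positivity) (by positivity), ← ENNReal.ofReal_mul hA]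
        refine ENNReal.ofReal_le_ofReal ?_
        simp only [firstDist, hn, dite_true]
        exact norm_sub_sq_div_rpow_le hp _ _
    _ = ENNReal.ofReal (4 ^ p / (d : ℝ) ^ p) * (∫⁻ x, ENNReal.ofReal (‖x‖ ^ (2 * p)) ∂(law ρ d) +
          ∫⁻ x, ENNReal.ofReal (‖x‖ ^ (2 * p)) ∂(law ρ d)) := by
        rw [lintegral_const_mul _ hm12, lintegral_add_left hm1, h1, h2]
    _ ≤ ENNReal.ofReal (4 ^ p / (d : ℝ) ^ p) * (ENNReal.ofReal (|C| * (d : ℝ) ^ p) +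
          ENNReal.ofReal (|C| * (d : ℝ) ^ p)) := by gcongr
    _ = ENNReal.ofReal (4 ^ p * (2 * |C|)) := by
        rw [← ENNReal.ofReal_add (by positivity) (by positivity), ← ENNReal.ofReal_mul hA]
        congr 1
        have : (0 : ℝ) < (d : ℝ) ^ p := by positivity
        field_simp
        ring

/-- From above, the kernel is at most its value at the origin. From below, keeping only the first
data point costs log n / d and leaves a tail governed by one distance. -/
theorem abs_logEstimator_le (hγ : 1 ≤ γ) (hh : 0 < h) {d n : ℕ} (hd : d ≠ 0) (hn : 0 < n)
    (ω : E d × (Fin n → E d)) :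
    |logEstimator γ d h ω| ≤ |cNorm γ d - Real.log h| + Real.log n / d +
      h ^ (-(2 * γ)) * firstDist γ d n ω := by
  obtain ⟨x, y⟩ := ω
  have hdpos : (0 : ℝ) < d := by positivity
  have hn' : (0 : ℝ) < n := by exact_mod_cast hn
  have hn1 : (1 : ℝ) ≤ n := by exact_mod_cast hn
  have hlogn : 0 ≤ Real.log n / d := div_nonneg (Real.log_nonneg hn1) hdpos.le
  set t := h ^ (-(2 * γ)) with ht
  have ht0 : 0 < t := by positivity
  have hfd := firstDist_nonneg γ d n (x, y)
  have e1 : (n : ℝ) * h ^ d = Real.exp (Real.log n + d * Real.log h) := by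
    rw [Real.exp_add, Real.exp_log hn', Real.exp_nat_mul, Real.exp_log hh]
  have hexp : Real.exp (d * logEstimator γ d h (x, y)) = estimator γ d h x y := by
    rw [logEstimator, ← mul_assoc, mul_one_div_cancel hdpos.ne', one_mul,
      Real.exp_log (estimator_pos hh hn.ne' x y)]
  have hup : logEstimator γ d h (x, y) ≤ cNorm γ d - Real.log h := by
    refine le_of_mul_le_mul_left ?_ hdpos
    rw [← Real.exp_le_exp, hexp, estimator, one_div, ← div_eq_inv_mul, div_le_iff₀ (by positivity)]
    calc ∑ i, gammaKernel γ d (h⁻¹ • (x - y i)) ≤ ∑ _i : Fin n, Real.exp (d * cNorm γ d) := by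
          refine Finset.sum_le_sum fun i _ => ?_
          rw [gammaKernel_smul γ hh, Real.exp_le_exp]
          have := energy_nonneg hγ d x (y i)
          have : 0 ≤ t * energy γ d x (y i) := by positivity
          gcongr
          linarith
      _ = n * Real.exp (d * cNorm γ d) := by simp
      _ = Real.exp (d * (cNorm γ d - Real.log h)) * (n * h ^ d) := by
          rw [e1, ← Real.exp_add]
          nth_rewrite 1 [← Real.exp_log hn']
          rw [← Real.exp_add]
          congr 1
          ring
  have hlow : cNorm γ d - Real.log h - t * firstDist γ d n (x, y) - Real.log n / d ≤
      logEstimator γ d h (x, y) := by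
    rw [le_logEstimator_iff hh hn.ne' hd, estimator, e1, one_div, ← Real.exp_neg]
    have hen : energy γ d x (y ⟨0, hn⟩) ≤ firstDist γ d n (x, y) := by
      simp only [firstDist, hn, dite_true, energy]
      exact div_le_self (by positivity) (by linarith)
    calc Real.exp (d * (cNorm γ d - Real.log h - t * firstDist γ d n (x, y) - Real.log n / d))
        = Real.exp (-(Real.log n + d * Real.log h)) *
            Real.exp (d * (cNorm γ d - t * firstDist γ d n (x, y))) := by
          rw [← Real.exp_add]
          congr 1
          field_simp
          ring
      _ ≤ Real.exp (-(Real.log n + d * Real.log h)) *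
            gammaKernel γ d (h⁻¹ • (x - y ⟨0, hn⟩)) := by
          rw [gammaKernel_smul γ hh]
          gcongr
      _ ≤ _ := by
          gcongr
          exact Finset.single_le_sum (f := fun i => gammaKernel γ d (h⁻¹ • (x - y i)))
            (fun i _ => (gammaKernel_pos _ _ _).le) (Finset.mem_univ _)
  have htf : 0 ≤ t * firstDist γ d n (x, y) := by positivity
  rw [abs_le]
  constructor
  · linarith [neg_abs_le (cNorm γ d - Real.log h)]
  · linarith [le_abs_self (cNorm γ d - Real.log h)]

theorem meanTendsto (hρ : IsDensityFamily ρ) (hγ : 1 ≤ γ) (hh : 0 < h) {c α f : ℝ} {n : ℕ → ℕ}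
    (hc : Tendsto (cNorm γ) atTop (𝓝 c)) (hα : 0 < α)
    (hn : Tendsto (fun d : ℕ => Real.log (n d) / d) atTop (𝓝 α))
    (hmom : HigherMomentBound ρ γ) (hconc : ConcentratesAt ρ γ n h f) :
    MeanTendsto ρ γ n h f := by
  have := hρ.isProbabilityMeasure_law
  have := fun d => hρ.isProbabilityMeasure_databaseLaw d (n d)
  have : ∀ d, IsProbabilityMeasure (jointLaw ρ d (n d)) := fun d => by
    unfold jointLaw
    infer_instance
  obtain ⟨p, hp, C, hC⟩ := hmom
  have hp0 : 0 ≤ p := by linarith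
  set t := h ^ (-(2 * γ)) with ht
  have ht0 : 0 < t := by positivity
  have hfirst : ∀ η > 0, ∃ K, ∀ (d n : ℕ) (ω : E d × (Fin n → E d)),
      t * firstDist γ d n ω ≤ K + η * firstDist p d n ω := by
    intro η hη
    obtain ⟨K, hK⟩ := rpow_le_add_mul_rpow (γ := γ) (by linarith) hp (div_pos hη ht0)
    refine ⟨|t * K|, fun d n ω => ?_⟩
    unfold firstDist
    split_ifs with hn
    · have h1 := mul_le_mul_of_nonneg_left
        (hK (‖ω.1 - ω.2 ⟨0, hn⟩‖ ^ 2 / d) (by positivity)) ht0.le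
      have h2 : t * (K + η / t * (‖ω.1 - ω.2 ⟨0, hn⟩‖ ^ 2 / d) ^ p) =
          t * K + η * (‖ω.1 - ω.2 ⟨0, hn⟩‖ ^ 2 / d) ^ p := by
        field_simp
      linarith [le_abs_self (t * K)]
    · rw [mul_zero, mul_zero, add_zero]
      exact abs_nonneg _
  have hint : ∀ d, Integrable (fun ω => logEstimator γ d h ω) (jointLaw ρ d (n d)) := by
    intro d
    -- Integrability is claimed in every dimension. For d = 0 or an empty database the function
    -- vanishes, by `1 / 0 = 0` or `Real.log 0 = 0`.
    rcases eq_or_ne d 0 with rfl | hd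
    · have h0 : (fun ω : E 0 × (Fin (n 0) → E 0) => logEstimator γ 0 h ω) = fun _ => 0 := by
        ext ω
        simp [logEstimator]
      rw [h0]
      exact integrable_const _
    rcases Nat.eq_zero_or_pos (n d) with hnd | hnd
    · have h0 : (fun ω : E d × (Fin (n d) → E d) => logEstimator γ d h ω) = fun _ => 0 := by
        ext ω
        simp [logEstimator, estimator, hnd]
      rw [h0]
      exact integrable_const _
    obtain ⟨K, hK⟩ := hfirst 1 one_pos
    refine integrable_of_le (T := 0)
      (measurable_logEstimator γ d h (n d)).aestronglyMeasurable
      (measurable_firstDist p d (n d)) (firstDist_nonneg p d (n d))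
      ((lintegral_firstDist_le hρ hp0 hC hd (n d)).trans_lt ENNReal.ofReal_lt_top).ne
      measurable_zero (by simp)
      (K := |cNorm γ d - Real.log h| + Real.log (n d) / d + K) (η := 1) (ae_of_all _ fun ω => ?_)
    have h1 := abs_logEstimator_le hγ hh hd hnd ω
    have h2 := hK d (n d) ω
    simp only [Pi.zero_apply, ENNReal.toReal_zero, add_zero]
    linarith
  refine ⟨hint, ?_⟩
  refine tendsto_integral_of_whp (V := fun d => firstDist p d (n d)) (T := 0)
    (C := 4 ^ p * (2 * |C|)) (Eventually.of_forall hint) (fun d => measurable_firstDist p d (n d))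
    (fun d => firstDist_nonneg p d (n d)) ?_ (fun _ _ => measurable_zero) (fun η _ => by simp)
    (fun η hη => ?_) fun ε hε => ?_
  · filter_upwards [eventually_ne_atTop 0] with d hd
    exact lintegral_firstDist_le hρ hp0 hC hd (n d)
  · obtain ⟨K, hK⟩ := hfirst η hη
    refine ⟨(|c - Real.log h| + 1) + (α + 1) + K, ?_⟩
    filter_upwards [eventually_ne_atTop 0, eventually_ne_zero_of_log hα hn,
      hn.eventually (gt_mem_nhds (show α < α + 1 by linarith)),
      (hc.sub_const (Real.log h)).abs.eventually (gt_mem_nhds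
        (show |c - Real.log h| < |c - Real.log h| + 1 by linarith))] with d hd hnd hnα hcd
    refine ae_of_all _ fun ω => ?_
    have h1 := abs_logEstimator_le hγ hh hd (Nat.pos_of_ne_zero hnd) ω
    have h2 := hK d (n d) ω
    simp only [Pi.zero_apply, ENNReal.toReal_zero, add_zero]
    linarith
  · have := hconc ε hε
    simpa only [Whp, not_lt] using this

end Mean

/-! ### The critical bandwidth -/

theorem rpow_neg_lt_rpow_neg {γ a b : ℝ} (hγ : 1 ≤ γ) (ha : 0 < a) (hab : a < b) :
    b ^ (-(2 * γ)) < a ^ (-(2 * γ)) :=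
  Real.rpow_lt_rpow_of_neg ha hab (by linarith)

theorem exists_rpow_neg_eq {γ t : ℝ} (hγ : 1 ≤ γ) (ht : 0 < t) :
    ∃ h > 0, h ^ (-(2 * γ)) = t := by
  refine ⟨t ^ (-(2 * γ))⁻¹, by positivity, ?_⟩
  rw [← Real.rpow_mul ht.le, inv_mul_cancel₀ (by linarith), Real.rpow_one]

/-- The lower bound for the estimator at the critical value of the Legendre curve. -/
theorem whp_le_logEstimator_critical {ρ : (d : ℕ) → E d → ℝ} {γ h α c : ℝ} {n : ℕ → ℕ}
    {G : ℝ → ℝ} (hρ : IsDensityFamily ρ) (hγ : 1 ≤ γ)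
    (hG : ScgfTendsto (law ρ) (law ρ) (energy γ) G) (hdG : DifferentiableOn ℝ G (Ioi 0))
    (hGc : StrictConvexOn ℝ (Ioi 0) G) (hc : Tendsto (cNorm γ) atTop (𝓝 c))
    (hα : 0 < α) (hn : Tendsto (fun d : ℕ => Real.log (n d) / d) atTop (𝓝 α)) (hh : 0 < h)
    {tG : ℝ} (htG : 0 < tG) (hJ : legendre G tG = α) {ε : ℝ} (hε : 0 < ε) :
    Whp (fun d => jointLaw ρ d (n d)) fun d ω =>
      c - Real.log h - α + h ^ (-(2 * γ)) * deriv G tG - ε ≤ logEstimator γ d h ω := by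
  have hcont : ContinuousAt (fun s => c - Real.log h - legendre G s + h ^ (-(2 * γ)) * deriv G s)
      tG := by
    have h1 := (continuousOn_legendre hGc hdG).continuousAt (Ioi_mem_nhds htG)
    have h2 := (continuousOn_deriv_of_convexOn hGc.convexOn hdG).continuousAt (Ioi_mem_nhds htG)
    exact (continuousAt_const.sub h1).add (continuousAt_const.mul h2)
  -- At tG the expected number of points is not known to be exponentially large, so the bound is
  -- taken at s slightly below tG, where the curve is strictly under α, and continuity closes the
  -- gap.
  have hev := (hcont.tendsto.mono_left (nhdsWithin_le_nhds (s := Iio tG))).eventually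
    (lt_mem_nhds (show c - Real.log h - legendre G tG + h ^ (-(2 * γ)) * deriv G tG - ε / 2 <
      c - Real.log h - legendre G tG + h ^ (-(2 * γ)) * deriv G tG by linarith))
  obtain ⟨s, hs1, hs2, hs3⟩ := (hev.and ((eventually_mem_nhdsWithin).and
    (eventually_nhdsWithin_of_eventually_nhds (lt_mem_nhds htG)))).exists
  have hsJ : legendre G s < α := by
    rw [← hJ]
    exact legendre_strictMonoOn hGc hdG hs3 htG hs2
  refine (whp_le_logEstimator hρ hγ hG hdG hc hα hn hh hs3 hsJ (half_pos hε)).mono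
    (Eventually.of_forall fun d ω hω => ?_)
  rw [hJ] at hs1
  linarith

end KDE

end

/-! ### Assembly of the theorem from the shape function G. -/

open MeasureTheory Filter Topology Set

theorem theorem6
    (ρ : (d : ℕ) → KDE.E d → ℝ) (hρ : KDE.IsDensityFamily ρ)
    (hmom : KDE.SecondMomentBound ρ) (hpure : KDE.IsPure ρ) (hwell : KDE.WellBehavedCgf ρ)
    (γ : ℝ) (hγ : 1 ≤ γ)
    (hconv : ∀ h > 0, StrictConvexOn ℝ (Ioi 0) (fun m => KDE.gbar ρ γ h m)) :
    -- the replica free entropy is well defined and differentiable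
    (∀ h > 0, ∀ m > 0, (∀ d, Integrable (KDE.g ρ γ d h m) (KDE.law ρ d)) ∧
      Tendsto (fun d : ℕ => KDE.gMean ρ γ d h m) atTop (𝓝 (KDE.gbar ρ γ h m))) ∧
    (∀ α : ℝ, ∀ h > 0, DifferentiableOn ℝ (fun m => KDE.phi ρ γ α h m) (Ioi 0)) ∧
    ∀ α > 0, ∃ hG : ℝ, KDE.IsGlassBandwidth ρ γ α hG ∧
      -- the critical bandwidth is positive for densities that are at most exponentially large
      ((∃ C : ℝ, ∀ d x, ρ d x ≤ C ^ d) → 0 < hG) ∧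
      ∀ n : ℕ → ℕ, Tendsto (fun d : ℕ => Real.log (n d) / d) atTop (𝓝 α) →
        -- `φ(1)` is the annealed value
        (∀ h > 0, KDE.AnnealedConcentratesAt ρ γ n h (KDE.phi ρ γ α h 1)) ∧
        -- large bandwidth
        (∀ h > hG,
          KDE.ConcentratesAt ρ γ n h (KDE.phi ρ γ α h 1) ∧
          (KDE.HigherMomentBound ρ γ → KDE.MeanTendsto ρ γ n h (KDE.phi ρ γ α h 1))) ∧
        -- small bandwidth
        (∀ h > 0, h < hG → ∃ m ∈ Ioo (0 : ℝ) 1,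
          HasDerivAt (fun m' => KDE.phi ρ γ α h m') 0 m ∧
          (∀ m₁ ∈ Ioo (0 : ℝ) 1,
            HasDerivAt (fun m' => KDE.phi ρ γ α h m') 0 m₁ → m₁ = m) ∧
          KDE.phi ρ γ α h m < KDE.phi ρ γ α h 1 ∧
          KDE.ConcentratesAt ρ γ n h (KDE.phi ρ γ α h m) ∧
          (KDE.HigherMomentBound ρ γ → KDE.MeanTendsto ρ γ n h (KDE.phi ρ γ α h m))) := by
  obtain ⟨G, hdG, hG, hanti, ⟨M, hM⟩, hlin⟩ := KDE.exists_shape hρ hmom hpure hwell hγ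
  obtain ⟨c, hc⟩ := KDE.exists_tendsto_cNorm hγ
  have hlim : ∀ h > 0, ∀ m > 0, Tendsto (fun d : ℕ => KDE.gMean ρ γ d h m) atTop
      (𝓝 (m * (c - Real.log h) + G (m * h ^ (-(2 * γ))))) := fun h hh m hm =>
    KDE.tendsto_gMean hρ hmom hγ hG hc hh hm
  have hgbar : ∀ h > 0, ∀ m > 0, KDE.gbar ρ γ h m =
      m * (c - Real.log h) + G (m * h ^ (-(2 * γ))) := fun h hh m hm =>
    (hlim h hh m hm).limUnder_eq
  -- At h = 1 the limit of the means is G plus a linear function of m, so G inherits strict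
  -- convexity.
  have hGc : StrictConvexOn ℝ (Ioi 0) G := by
    have h1 := hconv 1 one_pos
    refine ⟨convex_Ioi 0, fun x hx y hy hxy a b ha hb hab => ?_⟩
    have hx' : 0 < x := hx
    have hy' : 0 < y := hy
    have h2 := h1.2 hx hy hxy ha hb hab
    have h3 : 0 < a * x + b * y := by positivity
    simp only [smul_eq_mul] at h2 ⊢
    rw [hgbar 1 one_pos _ h3, hgbar 1 one_pos _ hx', hgbar 1 one_pos _ hy'] at h2
    simp only [Real.one_rpow, mul_one] at h2
    linarith
  have hphi : ∀ α : ℝ, ∀ h > 0, ∀ m > 0, KDE.phi ρ γ α h m = (1 - m) / m * α +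
      1 / m * (m * (c - Real.log h) + G (m * h ^ (-(2 * γ)))) := by
    intro α h hh m hm
    rw [KDE.phi, hgbar h hh m hm]
  have ht0 : ∀ h : ℝ, 0 < h → 0 < h ^ (-(2 * γ)) := fun h hh => Real.rpow_pos_of_pos hh _
  have hmono := KDE.legendre_strictMonoOn hGc hdG
  have hD : ∀ α : ℝ, ∀ h > 0, KDE.D ρ γ α h = KDE.legendre G (h ^ (-(2 * γ))) - α := by
    intro α h hh
    have := (KDE.hasDerivAt_replica hdG (ht0 h hh) (hphi α h hh) one_pos).deriv
    rw [KDE.D, this]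
    simp
  refine ⟨fun h hh m hm => ⟨KDE.integrable_g hρ hmom hγ hh hm, ?_⟩, fun α h hh m hm => ?_,
    fun α hα => ?_⟩
  · rw [hgbar h hh m hm]
    exact hlim h hh m hm
  · exact (KDE.hasDerivAt_replica hdG (ht0 h hh) (hphi α h hh) hm).differentiableAt
      |>.differentiableWithinAt
  have hone : ∀ h > 0, KDE.phi ρ γ α h 1 = c - Real.log h + G (h ^ (-(2 * γ))) := fun h hh =>
    KDE.replica_one (hphi α h hh)
  have hann : ∀ n : ℕ → ℕ, Tendsto (fun d : ℕ => Real.log (n d) / d) atTop (𝓝 α) →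
      ∀ h > 0, KDE.AnnealedConcentratesAt ρ γ n h (KDE.phi ρ γ α h 1) := by
    intro n hn h hh
    rw [hone h hh]
    exact KDE.annealedConcentratesAt hρ hγ hG hc hα hn hh
  have hup : ∀ n : ℕ → ℕ, Tendsto (fun d : ℕ => Real.log (n d) / d) atTop (𝓝 α) →
      ∀ h > 0, ∀ m > 0, m ≤ 1 → ∀ ε > 0, KDE.Whp (fun d => KDE.jointLaw ρ d (n d))
        fun d ω => KDE.logEstimator γ d h ω ≤ KDE.phi ρ γ α h m + ε := by
    intro n hn h hh m hm hm1 ε hε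
    rw [hphi α h hh m hm]
    exact KDE.whp_logEstimator_le hρ hγ hG hc hα hn hh hm hm1 hε
  have hlarge : ∀ n : ℕ → ℕ, Tendsto (fun d : ℕ => Real.log (n d) / d) atTop (𝓝 α) →
      ∀ h > 0, KDE.legendre G (h ^ (-(2 * γ))) < α →
        KDE.ConcentratesAt ρ γ n h (KDE.phi ρ γ α h 1) := by
    intro n hn h hh hJ
    refine KDE.concentratesAt_of_whp (hup n hn h hh 1 one_pos le_rfl) fun ε hε => ?_
    -- With s = t = h^(-2γ) the bound -J(t) + t G'(t) collapses to G(t), the annealed value.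
    have h1 := KDE.whp_le_logEstimator hρ hγ hG hdG hc hα hn hh (ht0 h hh) hJ hε
    refine h1.mono (Eventually.of_forall fun d ω hω => ?_)
    rw [hone h hh]
    unfold KDE.legendre at hω
    linarith
  -- If the level α is reached at tG, the critical bandwidth solves h^(-2γ) = tG, and larger
  -- bandwidths mean smaller t. Otherwise D < 0 for all h > 0, so h_G = 0 and every bandwidth is
  -- annealed.
  rcases KDE.legendre_dichotomy hGc hanti hdG hM hα with ⟨tG, htG, hJ⟩ | hJ
  · obtain ⟨hG', hhG, hhGt⟩ := KDE.exists_rpow_neg_eq hγ htG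
    refine ⟨hG', ⟨hhG.le, fun h hh => ?_⟩, fun _ => hhG, fun n hn => ⟨hann n hn, fun h hlt => ?_,
      fun h hh hlt => ?_⟩⟩
    · rw [hD α h hh, sub_eq_zero, ← hJ]
      constructor
      · intro heq
        have h1 := hmono.injOn (ht0 h hh) htG heq
        rw [← hhGt] at h1
        by_contra hne
        rcases lt_or_gt_of_ne hne with hlt | hlt
        · exact (KDE.rpow_neg_lt_rpow_neg hγ hh hlt).ne' h1
        · exact (KDE.rpow_neg_lt_rpow_neg hγ hhG hlt).ne h1
      · rintro rfl
        rw [hhGt]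
    · have hh : 0 < h := hhG.trans hlt
      have hlt' : h ^ (-(2 * γ)) < tG := by
        rw [← hhGt]
        exact KDE.rpow_neg_lt_rpow_neg hγ hhG hlt
      have hconc := hlarge n hn h hh (by
        rw [← hJ]
        exact hmono (ht0 h hh) htG hlt')
      exact ⟨hconc, fun hhm => KDE.meanTendsto hρ hγ hh hc hα hn hhm hconc⟩
    · have hlt' : tG < h ^ (-(2 * γ)) := by
        rw [← hhGt]
        exact KDE.rpow_neg_lt_rpow_neg hγ hh hlt
      obtain ⟨m, hm, hder, huniq, hval, hphim⟩ :=
        KDE.replica_stationary hGc hdG (ht0 h hh) (hphi α h hh) htG hJ hlt'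
      have hconc : KDE.ConcentratesAt ρ γ n h (KDE.phi ρ γ α h m) := by
        refine KDE.concentratesAt_of_whp (hup n hn h hh m hm.1 hm.2.le) fun ε hε => ?_
        rw [hphim]
        exact KDE.whp_le_logEstimator_critical hρ hγ hG hdG hGc hc hα hn hh htG hJ hε
      exact ⟨m, hm, hder, huniq, hval, hconc,
        fun hhm => KDE.meanTendsto hρ hγ hh hc hα hn hhm hconc⟩
  · refine ⟨0, ⟨le_rfl, fun h hh => ?_⟩, fun ⟨C, hC⟩ => ?_, fun n hn => ⟨hann n hn, fun h hh => ?_,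
      fun h hh hlt => absurd hlt hh.le.not_gt⟩⟩
    · rw [hD α h hh]
      have := hJ _ (ht0 h hh)
      constructor
      · intro h0
        linarith
      · intro h0
        linarith
    · obtain ⟨A, hA⟩ := KDE.shape_le_of_density_le hρ hγ hG hc hC
      obtain ⟨t, ht, hle⟩ := KDE.exists_legendre_ge hdG hlin
        (show 0 < 1 / (2 * γ) by positivity) hA α
      exact absurd (hJ t ht) hle.not_gt
    · have hconc := hlarge n hn h hh (hJ _ (ht0 h hh))
      exact ⟨hconc, fun hhm => KDE.meanTendsto hρ hγ hh hc hα hn hhm hconc⟩
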